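/- Let $\mathbb K$ be a field, let $Q$ be a finite connected quiver with $n$ vertices, let $J\subset \mathbb KQ$ be the ideal generated by the arrows, and let $A=\mathbb KQ/J^2$. Modules are finitely generated right $A$-modules, and paths are composed from left to right (so that $\Omega(S_i)=\bigoplus_{\alpha:i\to j}S_j$ for the simple modules $S_i$). Let $A_0=\mathbb KQ/J$ be the direct sum of the simple modules, and let $\Omega^n$, $\Omega^{-n}$ denote $n$-th syzygies and cosyzygies in minimal projective resolutions and minimal injective coresolutions. Let $K_0$ be the abelian group generated by symbols $[M]$, one for each isomorphism class of modules, with relations $[M]=[M']+[M'']$ if $M\cong M'\oplus M''$ and $[P]=0$ for $P$ projective. Let $\overline\Omega:K_0\to K_0$ be the endomorphism with $\overline\Omega[M]=[\Omega M]$, and let $\langle \mathrm{add}\,M\rangle\subset K_0$ be the subgroup generated by the classes of the indecomposable direct summands of $M$. Put $$\phi(M)=\min\{l\in\mathbb N:\ \overline\Omega|_{\overline\Omega^{\,l+s}\langle \mathrm{add}\,M\rangle}\text{ is injective for all }s\in\mathbb N\},$$ $$\psi(M)=\phi(M)+\sup\{\mathrm{pd}\,X:\ X \text{ is a direct summand of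 }\Omega^{\phi(M)}(M),\ \mathrm{pd}\,X<\infty\},$$ and $\psi\dim(A)=\sup_M\psi(M)$. The heart $C(Q)$ is the full subquiver of $Q$ on the vertices $v$ such that $S_v$ lies in the support of both $\Omega^n(A_0)$ and $\Omega^{-n}(A_0)$; the member $M(Q)$ is the full subquiver on the remaining vertices. Write $x\preceq y$ if there is a (possibly trivial) path in $Q$ from $x$ to $y$. **Theorem.** Let $n>3$. Then $\psi\dim(A)\le 2n-3$, and $\psi\dim(A)$ is maximal, that is $\psi\dim(A)=2n-3$, if and only if all of the following hold: 1. $\preceq$ restricts to a total order on the vertices of $M(Q)$; 2. $Q$ has a sink; 3. $C(Q)$ has exactly one vertex, and there is at least one loop at it; 4. $Q$ consists of $C(Q)$, $M(Q)$ and arrows from $C(Q)$ to $M(Q)$, i.e. there is no arrow from a vertex of $M(Q)$ to a vertex of $C(Q)$; 5. at least one arrow starting in $C(Q)$ ends at the source of $M(Q)$. -/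

import Mathlib

/-! ### Igusa–Todorov functions of a ring

All modules in this part are left modules over a ring `R`; right modules over an algebra `A` are
left modules over `Aᵐᵒᵖ`. -/

universe u

namespace IgusaTodorov

section Basic

variable (R : Type u) [Ring R]

/-- `N` is (isomorphic to) a direct summand of `M`. -/
def IsSummand (N M : ModuleCat.{u} R) : Prop :=
  ∃ C : ModuleCat.{u} R, Nonempty (M ≃ₗ[R] N × C)

/-- A nonzero module which is not the direct sum of two nonzero modules. -/
def IsIndecomposable (M : ModuleCat.{u} R) : Prop :=
  Nontrivial M ∧ ∀ X Y : ModuleCat.{u} R, Nonempty (M ≃ₗ[R] X × Y) →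
    Subsingleton X ∨ Subsingleton Y

/-- `N` is the syzygy `Ω(M)`: the kernel of a projective cover `P → M`, i.e. of a surjection from
a projective module whose kernel is superfluous. -/
def IsSyzygy (M N : ModuleCat.{u} R) : Prop :=
  ∃ (P : ModuleCat.{u} R) (f : P →ₗ[R] M), Module.Projective R P ∧ Function.Surjective f ∧
    (∀ U : Submodule R P, U ⊔ LinearMap.ker f = ⊤ → U = ⊤) ∧
    Nonempty (LinearMap.ker f ≃ₗ[R] N)

/-- `N` is the `n`-th syzygy `Ω^n(M)` with respect to a minimal projective resolution. -/
def IsNthSyzygy : ℕ → ModuleCat.{u} R → ModuleCat.{u} R → Prop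
  | 0, M, N => Nonempty (M ≃ₗ[R] N)
  | n + 1, M, N => ∃ L : ModuleCat.{u} R, IsNthSyzygy n M L ∧ IsSyzygy R L N

/-- `N` is the cosyzygy `Ω^{-1}(M)`: the cokernel of an injective envelope `M → I`, i.e. of an
injection into an injective module whose image is essential. -/
def IsCosyzygy (M N : ModuleCat.{u} R) : Prop :=
  ∃ (I : ModuleCat.{u} R) (f : M →ₗ[R] I), Module.Injective R I ∧ Function.Injective f ∧
    (∀ U : Submodule R I, U ⊓ LinearMap.range f = ⊥ → U = ⊥) ∧
    Nonempty ((I ⧸ LinearMap.range f) ≃ₗ[R] N)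

/-- `N` is the `n`-th cosyzygy `Ω^{-n}(M)` with respect to a minimal injective coresolution. -/
def IsNthCosyzygy : ℕ → ModuleCat.{u} R → ModuleCat.{u} R → Prop
  | 0, M, N => Nonempty (M ≃ₗ[R] N)
  | n + 1, M, N => ∃ L : ModuleCat.{u} R, IsNthCosyzygy n M L ∧ IsCosyzygy R L N

/-- The relations of `K₀`: `[M] - [M'] - [M'']` if `M ≅ M' ⊕ M''`, and `[P]` for `P` projective.
(The first relation with `M'' = 0` also identifies isomorphic modules.) -/
def K0Rel : Set (FreeAbelianGroup (FGModuleCat.{u} R)) :=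
  {x | ∃ M M' M'' : FGModuleCat.{u} R, Nonempty (M ≃ₗ[R] M' × M'') ∧
      x = FreeAbelianGroup.of M - FreeAbelianGroup.of M' - FreeAbelianGroup.of M''} ∪
  {x | ∃ P : FGModuleCat.{u} R, Module.Projective R P ∧ x = FreeAbelianGroup.of P}

/-- The Igusa–Todorov group `K₀`, generated by the finitely generated modules. -/
abbrev K0 : Type (u + 1) :=
  FreeAbelianGroup (FGModuleCat.{u} R) ⧸ AddSubgroup.closure (K0Rel R)

/-- The class `[M]` in `K₀`. -/
def cls (M : FGModuleCat.{u} R) : K0 R :=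
  QuotientAddGroup.mk' (AddSubgroup.closure (K0Rel R)) (FreeAbelianGroup.of M)

theorem cls_prod {M M' M'' : FGModuleCat.{u} R} (e : M ≃ₗ[R] M' × M'') :
    cls R M = cls R M' + cls R M'' := by
  have h : FreeAbelianGroup.of M - FreeAbelianGroup.of M' - FreeAbelianGroup.of M'' ∈
      AddSubgroup.closure (K0Rel R) :=
    AddSubgroup.subset_closure (Or.inl ⟨M, M', M'', ⟨e⟩, rfl⟩)
  have h2 := (QuotientAddGroup.eq_zero_iff _).2 h
  have h3 : cls R M - cls R M' - cls R M'' = 0 := h2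
  rw [sub_sub, sub_eq_zero] at h3
  exact h3

theorem cls_projective (P : FGModuleCat.{u} R) (hP : Module.Projective R P) : cls R P = 0 :=
  (QuotientAddGroup.eq_zero_iff _).2 (AddSubgroup.subset_closure (Or.inr ⟨P, hP, rfl⟩))

theorem cls_iso {M N : FGModuleCat.{u} R} (e : M ≃ₗ[R] N) : cls R M = cls R N := by
  let Z : FGModuleCat.{u} R := FGModuleCat.of R PUnit.{u + 1}
  have hZ : cls R Z = 0 := cls_projective R Z (inferInstanceAs (Module.Projective R PUnit.{u + 1}))
  have e' : M ≃ₗ[R] N × Z := e.trans (LinearEquiv.prodUnique (M₂ := PUnit.{u + 1})).symm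
  rw [cls_prod R e', hZ, add_zero]

/-- A surjection onto a projective module splits. -/
theorem exists_equiv_ker_prod {X P : Type u} [AddCommGroup X] [Module R X] [AddCommGroup P]
    [Module R P] [Module.Projective R P] (g : X →ₗ[R] P) (hg : Function.Surjective g) :
    Nonempty (X ≃ₗ[R] LinearMap.ker g × P) := by
  obtain ⟨l, hl⟩ := Module.projective_lifting_property g LinearMap.id hg
  have hex : Function.Exact (LinearMap.ker g).subtype g := LinearMap.exact_subtype_ker_map g
  exact ⟨(hex.splitSurjectiveEquiv (Submodule.injective_subtype _) ⟨l, hl⟩).1⟩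

theorem exists_free_cover (M : FGModuleCat.{u} R) :
    ∃ (P : FGModuleCat.{u} R) (f : P →ₗ[R] M), Module.Projective R P ∧ Function.Surjective f := by
  obtain ⟨n, f, hf⟩ := Module.Finite.exists_fin' R M
  exact ⟨FGModuleCat.of R (Fin n → R), f,
    inferInstanceAs (Module.Projective R (Fin n → R)), hf⟩

end Basic

section Noetherian

variable (R : Type u) [Ring R] [IsNoetherianRing R]

/-- The kernel of a linear map between finitely generated modules. -/
abbrev kerObj {P M : FGModuleCat.{u} R} (f : P →ₗ[R] M) : FGModuleCat.{u} R :=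
  FGModuleCat.of R (LinearMap.ker f)

/-- Schanuel's lemma in `K₀`. -/
theorem cls_ker_eq {P Q M : FGModuleCat.{u} R} (hP : Module.Projective R P)
    (hQ : Module.Projective R Q) (f : P →ₗ[R] M) (g : Q →ₗ[R] M) (hf : Function.Surjective f)
    (hg : Function.Surjective g) : cls R (kerObj R f) = cls R (kerObj R g) := by
  let h : (P × Q) →ₗ[R] M := f.comp (LinearMap.fst R P Q) - g.comp (LinearMap.snd R P Q)
  have hmem : ∀ x : LinearMap.ker h, f x.1.1 = g x.1.2 := fun x => by
    have hx : f x.1.1 - g x.1.2 = 0 := LinearMap.mem_ker.1 x.2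
    exact sub_eq_zero.1 hx
  let X : FGModuleCat.{u} R := FGModuleCat.of R (LinearMap.ker h)
  let p : LinearMap.ker h →ₗ[R] P := (LinearMap.fst R P Q).comp (LinearMap.ker h).subtype
  let q : LinearMap.ker h →ₗ[R] Q := (LinearMap.snd R P Q).comp (LinearMap.ker h).subtype
  have hp : Function.Surjective p := fun x => by
    obtain ⟨y, hy⟩ := hg (f x)
    exact ⟨⟨(x, y), by simp [h, hy]⟩, rfl⟩
  have hq : Function.Surjective q := fun y => by
    obtain ⟨x, hx⟩ := hf (g y)
    exact ⟨⟨(x, y), by simp [h, hx]⟩, rfl⟩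
  obtain ⟨ep⟩ := exists_equiv_ker_prod R p hp
  obtain ⟨eq⟩ := exists_equiv_ker_prod R q hq
  let kp : LinearMap.ker p ≃ₗ[R] LinearMap.ker g :=
    { toFun := fun x => ⟨x.1.1.2, by
        have h1 := hmem x.1
        have h2 : x.1.1.1 = 0 := x.2
        rw [LinearMap.mem_ker, ← h1, h2, map_zero]⟩
      map_add' := fun _ _ => rfl
      map_smul' := fun _ _ => rfl
      invFun := fun y => ⟨⟨(0, y.1), by
        have := LinearMap.mem_ker.1 y.2
        simp [h, this]⟩, rfl⟩
      left_inv := fun x => by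
        have h2 : x.1.1.1 = 0 := x.2
        apply Subtype.ext; apply Subtype.ext
        exact Prod.ext h2.symm rfl
      right_inv := fun _ => rfl }
  let kq : LinearMap.ker q ≃ₗ[R] LinearMap.ker f :=
    { toFun := fun x => ⟨x.1.1.1, by
        have h1 := hmem x.1
        have h2 : x.1.1.2 = 0 := x.2
        rw [LinearMap.mem_ker, h1, h2, map_zero]⟩
      map_add' := fun _ _ => rfl
      map_smul' := fun _ _ => rfl
      invFun := fun y => ⟨⟨(y.1, 0), by
        have := LinearMap.mem_ker.1 y.2
        simp [h, this]⟩, rfl⟩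
      left_inv := fun x => by
        have h2 : x.1.1.2 = 0 := x.2
        apply Subtype.ext; apply Subtype.ext
        exact Prod.ext rfl h2.symm
      right_inv := fun _ => rfl }
  have h1 : cls R X = cls R (kerObj R g) + cls R P :=
    cls_prod R (M := X) (M' := kerObj R g) (M'' := P)
      (ep.trans (LinearEquiv.prodCongr kp (LinearEquiv.refl R P)))
  have h2 : cls R X = cls R (kerObj R f) + cls R Q :=
    cls_prod R (M := X) (M' := kerObj R f) (M'' := Q)
      (eq.trans (LinearEquiv.prodCongr kq (LinearEquiv.refl R Q)))
  rw [cls_projective R P hP, add_zero] at h1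
  rw [cls_projective R Q hQ, add_zero] at h2
  rw [← h2, h1]

/-- The class in `K₀` of the kernel of some surjection `P → M` with `P` projective. -/
noncomputable def omegaCls (M : FGModuleCat.{u} R) : K0 R :=
  cls R (kerObj R (exists_free_cover R M).choose_spec.choose)

theorem omegaCls_eq {P M : FGModuleCat.{u} R} (hP : Module.Projective R P) (f : P →ₗ[R] M)
    (hf : Function.Surjective f) : omegaCls R M = cls R (kerObj R f) :=
  cls_ker_eq R (exists_free_cover R M).choose_spec.choose_spec.1 hP _ f
    (exists_free_cover R M).choose_spec.choose_spec.2 hf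

theorem omegaCls_prod {M M' M'' : FGModuleCat.{u} R} (e : M ≃ₗ[R] M' × M'') :
    omegaCls R M = omegaCls R M' + omegaCls R M'' := by
  obtain ⟨P, f, hP, hf⟩ := exists_free_cover R M'
  obtain ⟨Q, g, hQ, hg⟩ := exists_free_cover R M''
  let PQ : FGModuleCat.{u} R := FGModuleCat.of R (P × Q)
  have hPQ : Module.Projective R PQ := inferInstanceAs (Module.Projective R (P × Q))
  let k : PQ →ₗ[R] M := e.symm.toLinearMap.comp (LinearMap.prodMap f g)
  have hk : Function.Surjective k :=
    e.symm.surjective.comp (Function.Surjective.prodMap hf hg)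
  have hmem : ∀ x : P × Q, k x = 0 ↔ f x.1 = 0 ∧ g x.2 = 0 := fun x => by
    change e.symm (f x.1, g x.2) = 0 ↔ _
    rw [LinearEquiv.map_eq_zero_iff, Prod.mk_eq_zero]
  let ek : LinearMap.ker k ≃ₗ[R] LinearMap.ker f × LinearMap.ker g :=
    { toFun := fun x => (⟨x.1.1, ((hmem x.1).1 x.2).1⟩, ⟨x.1.2, ((hmem x.1).1 x.2).2⟩)
      map_add' := fun _ _ => rfl
      map_smul' := fun _ _ => rfl
      invFun := fun y => ⟨(y.1.1, y.2.1), (hmem _).2 ⟨y.1.2, y.2.2⟩⟩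
      left_inv := fun _ => rfl
      right_inv := fun _ => rfl }
  rw [omegaCls_eq R hP f hf, omegaCls_eq R hQ g hg, omegaCls_eq R hPQ k hk]
  exact cls_prod R (M := kerObj R k) (M' := kerObj R f) (M'' := kerObj R g) ek

theorem omegaCls_projective (P : FGModuleCat.{u} R) (hP : Module.Projective R P) :
    omegaCls R P = 0 := by
  rw [omegaCls_eq R hP LinearMap.id Function.surjective_id]
  refine cls_projective R _ ?_
  have : Subsingleton (LinearMap.ker (LinearMap.id : P →ₗ[R] P)) := by
    rw [LinearMap.ker_id]; infer_instance
  exact inferInstanceAs (Module.Projective R (LinearMap.ker (LinearMap.id : P →ₗ[R] P)))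

/-- The endomorphism `Ω̄` of `K₀` with `Ω̄ [M] = [Ω M]`. -/
noncomputable def omegaBar : K0 R →+ K0 R :=
  QuotientAddGroup.lift (AddSubgroup.closure (K0Rel R)) (FreeAbelianGroup.lift (omegaCls R)) <| by
    rw [AddSubgroup.closure_le]
    rintro x (⟨M, M', M'', ⟨e⟩, rfl⟩ | ⟨P, hP, rfl⟩)
    · simp [omegaCls_prod R e]
    · simp [omegaCls_projective R P hP]

@[simp] theorem omegaBar_cls (M : FGModuleCat.{u} R) : omegaBar R (cls R M) = omegaCls R M := by
  change FreeAbelianGroup.lift (omegaCls R) (FreeAbelianGroup.of M) = _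
  simp

/-- `Ω̄ [M]` is the class of any (minimal) first syzygy of `M`. -/
theorem omegaBar_cls_of_isSyzygy {M N : FGModuleCat.{u} R} (h : IsSyzygy R M.obj N.obj) :
    omegaBar R (cls R M) = cls R N := by
  obtain ⟨P, f, hP, hf, hs, ⟨e⟩⟩ := h
  have hfin : Module.Finite R P := by
    obtain ⟨n, t, ht⟩ := Module.Finite.exists_fin' R M
    obtain ⟨l, hl⟩ := Module.projective_lifting_property f t hf
    have hr : LinearMap.range l = ⊤ := by
      refine hs _ (eq_top_iff.2 fun x _ => ?_)
      obtain ⟨y, hy⟩ := ht (f x)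
      have h1 : f (l y) = f x := by rw [← hy, ← hl]; rfl
      refine Submodule.mem_sup.2 ⟨l y, ⟨y, rfl⟩, x - l y, ?_, by abel⟩
      rw [LinearMap.mem_ker, map_sub, h1, sub_self]
    exact Module.Finite.of_surjective l (LinearMap.range_eq_top.1 hr)
  let P' : FGModuleCat.{u} R := FGModuleCat.of R P
  rw [omegaBar_cls, omegaCls_eq R (P := P') hP f hf]
  exact cls_iso R (M := kerObj R (P := P') f) (N := N) e

/-- `⟨add M⟩`: the subgroup of `K₀` generated by the classes of the indecomposable direct
summands of `M`. -/
def addSub (M : FGModuleCat.{u} R) : AddSubgroup (K0 R) :=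
  AddSubgroup.closure {x | ∃ N : FGModuleCat.{u} R, IsIndecomposable R N.obj ∧
    IsSummand R N.obj M.obj ∧ x = cls R N}

/-- The Igusa–Todorov function `φ`: the least `l` such that `Ω̄` is injective on
`Ω̄^{l+s}⟨add M⟩` for all `s`. -/
noncomputable def phi (M : FGModuleCat.{u} R) : ℕ :=
  sInf {l : ℕ | ∀ s : ℕ, Set.InjOn (omegaBar R) ((omegaBar R)^[l + s] '' (addSub R M : Set (K0 R)))}

/-- The Igusa–Todorov function `ψ(M) = φ(M) + sup {pd X : X ∣ Ω^{φ(M)}(M), pd X < ∞}`. -/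
noncomputable def psi (M : FGModuleCat.{u} R) : ℕ∞ :=
  (phi R M : ℕ∞) + sSup {d : ℕ∞ | ∃ N X : ModuleCat.{u} R, ∃ k : ℕ,
    IsNthSyzygy R (phi R M) M.obj N ∧ IsSummand R X N ∧
    CategoryTheory.projectiveDimension X = ((k : ℕ∞) : WithBot ℕ∞) ∧ d = (k : ℕ∞)}

/-- The `ψ`-dimension: the supremum of `ψ` over the finitely generated modules. -/
noncomputable def psiDim : ℕ∞ := ⨆ M : FGModuleCat.{u} R, psi R M

end Noetherian

end IgusaTodorov

/-! ### Radical square zero algebras -/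

namespace RadSqZeroAlg

section Algebra

variable (K : Type u) [Field K] (V : Type u) [Quiver.{u} V]

/-- Generators of the path algebra: the vertices and the arrows. -/
inductive Gen : Type u
  | vertex (v : V) : Gen
  | arrow {i j : V} (a : i ⟶ j) : Gen

variable [Fintype V]

/-- Defining relations of the path algebra: the vertices are orthogonal idempotents with sum `1`,
and `e_i a = a = a e_j` for an arrow `a : i ⟶ j` (paths are composed from left to right). -/
inductive PathRel : FreeAlgebra K (Gen V) → FreeAlgebra K (Gen V) → Prop
  | idem (v : V) :
      PathRel (FreeAlgebra.ι K (Gen.vertex v) * FreeAlgebra.ι K (Gen.vertex v))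
        (FreeAlgebra.ι K (Gen.vertex v))
  | orth (v w : V) (h : v ≠ w) :
      PathRel (FreeAlgebra.ι K (Gen.vertex v) * FreeAlgebra.ι K (Gen.vertex w)) 0
  | sum_one : PathRel (∑ v : V, FreeAlgebra.ι K (Gen.vertex v)) 1
  | source {i j : V} (a : i ⟶ j) :
      PathRel (FreeAlgebra.ι K (Gen.vertex i) * FreeAlgebra.ι K (Gen.arrow a))
        (FreeAlgebra.ι K (Gen.arrow a))
  | target {i j : V} (a : i ⟶ j) :
      PathRel (FreeAlgebra.ι K (Gen.arrow a) * FreeAlgebra.ι K (Gen.vertex j))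
        (FreeAlgebra.ι K (Gen.arrow a))

/-- The path algebra `KQ`. -/
def PathAlgebra : Type u := RingQuot (PathRel K V)

noncomputable instance instRingPathAlgebra : Ring (PathAlgebra K V) :=
  inferInstanceAs (Ring (RingQuot (PathRel K V)))

noncomputable instance instAlgebraPathAlgebra : Algebra K (PathAlgebra K V) :=
  inferInstanceAs (Algebra K (RingQuot (PathRel K V)))

/-- The quotient map from the free algebra to `KQ`. -/
noncomputable def toPath : FreeAlgebra K (Gen V) →ₐ[K] PathAlgebra K V :=
  RingQuot.mkAlgHom K (PathRel K V)

theorem toPath_surjective : Function.Surjective (toPath K V) :=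
  RingQuot.mkAlgHom_surjective K (PathRel K V)

theorem toPath_rel {x y : FreeAlgebra K (Gen V)} (h : PathRel K V x y) :
    toPath K V x = toPath K V y :=
  RingQuot.mkAlgHom_rel K h

/-- The image of a generator in `KQ`. -/
noncomputable def pathGen (g : Gen V) : PathAlgebra K V := toPath K V (FreeAlgebra.ι K g)

/-- The two-sided ideal `J` of `KQ` generated by the arrows. -/
noncomputable def arrowIdeal : TwoSidedIdeal (PathAlgebra K V) :=
  TwoSidedIdeal.span {x | ∃ (i j : V) (a : i ⟶ j), x = pathGen K V (Gen.arrow a)}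

/-- The relations `x y = 0` for `x, y ∈ J`; they generate the ideal `J²`. -/
def SqRel (x y : PathAlgebra K V) : Prop :=
  (∃ a ∈ arrowIdeal K V, ∃ b ∈ arrowIdeal K V, x = a * b) ∧ y = 0

/-- The radical square zero algebra `A = KQ / J²`. -/
def Alg : Type u := RingQuot (SqRel K V)

noncomputable instance instRingAlg : Ring (Alg K V) :=
  inferInstanceAs (Ring (RingQuot (SqRel K V)))

noncomputable instance instAlgebraAlg : Algebra K (Alg K V) :=
  inferInstanceAs (Algebra K (RingQuot (SqRel K V)))

/-- The quotient map from `KQ` to `A`. -/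
noncomputable def toAlg : PathAlgebra K V →ₐ[K] Alg K V :=
  RingQuot.mkAlgHom K (SqRel K V)

theorem toAlg_surjective : Function.Surjective (toAlg K V) :=
  RingQuot.mkAlgHom_surjective K (SqRel K V)

theorem toAlg_rel {x y : PathAlgebra K V} (h : SqRel K V x y) : toAlg K V x = toAlg K V y :=
  RingQuot.mkAlgHom_rel K h

/-- The ring whose left modules are the right modules over `A = KQ / J²`. -/
abbrev AlgOp : Type u := (Alg K V)ᵐᵒᵖ

/-- The image of a generator in `A`. -/
noncomputable def gen (g : Gen V) : Alg K V :=
  toAlg K V (pathGen K V g)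

/-- The idempotent `e_v` of `A`. -/
noncomputable def e (v : V) : Alg K V := gen K V (Gen.vertex v)

/-- The arrow `a` as an element of `A`. -/
noncomputable def arr {i j : V} (a : i ⟶ j) : Alg K V := gen K V (Gen.arrow a)

theorem e_mul_e_self (v : V) : e K V v * e K V v = e K V v := by
  have h := toPath_rel K V (PathRel.idem (K := K) v)
  simp only [map_mul] at h
  simp only [e, gen, pathGen, ← map_mul, h]

theorem e_mul_e_of_ne {v w : V} (hvw : v ≠ w) : e K V v * e K V w = 0 := by
  have h := toPath_rel K V (PathRel.orth (K := K) v w hvw)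
  simp only [map_mul, map_zero] at h
  simp only [e, gen, pathGen, ← map_mul]
  rw [map_mul, h, map_zero]

theorem sum_e : ∑ v : V, e K V v = 1 := by
  have h := toPath_rel K V (PathRel.sum_one (K := K) (V := V))
  simp only [map_sum, map_one] at h
  simp only [e, gen, pathGen, ← map_sum]
  rw [map_sum, h, map_one]

theorem e_mul_arr {i j : V} (a : i ⟶ j) : e K V i * arr K V a = arr K V a := by
  have h := toPath_rel K V (PathRel.source (K := K) a)
  simp only [map_mul] at h
  simp only [e, arr, gen, pathGen, ← map_mul]
  rw [map_mul, h]

theorem arr_mul_e {i j : V} (a : i ⟶ j) : arr K V a * e K V j = arr K V a := by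
  have h := toPath_rel K V (PathRel.target (K := K) a)
  simp only [map_mul] at h
  simp only [e, arr, gen, pathGen, ← map_mul]
  rw [map_mul, h]

theorem arr_mul_arr {i j k l : V} (a : i ⟶ j) (b : k ⟶ l) : arr K V a * arr K V b = 0 := by
  have h : SqRel K V (pathGen K V (Gen.arrow a) * pathGen K V (Gen.arrow b)) 0 :=
    ⟨⟨_, TwoSidedIdeal.subset_span ⟨i, j, a, rfl⟩, _,
      TwoSidedIdeal.subset_span ⟨k, l, b, rfl⟩, rfl⟩, rfl⟩
  have h2 := toAlg_rel K V h
  rw [map_mul, map_zero] at h2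
  exact h2

theorem gen_mul_gen (g h : Gen V) : gen K V g * gen K V h = 0 ∨
    ∃ k : Gen V, gen K V g * gen K V h = gen K V k := by
  classical
  rcases g with v | @⟨i, j, a⟩ <;> rcases h with w | @⟨k, l, b⟩
  · by_cases hvw : v = w
    · subst hvw
      exact Or.inr ⟨_, e_mul_e_self K V v⟩
    · exact Or.inl (e_mul_e_of_ne K V hvw)
  · by_cases hvk : v = k
    · subst hvk
      exact Or.inr ⟨_, e_mul_arr K V b⟩
    · left
      change e K V v * arr K V b = 0
      rw [← e_mul_arr K V b, ← mul_assoc, e_mul_e_of_ne K V hvk, zero_mul]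
  · by_cases hjw : j = w
    · subst hjw
      exact Or.inr ⟨_, arr_mul_e K V a⟩
    · left
      change arr K V a * e K V w = 0
      rw [← arr_mul_e K V a, mul_assoc, e_mul_e_of_ne K V hjw, mul_zero]
  · exact Or.inl (arr_mul_arr K V a b)

/-- `A` is spanned by the vertices and the arrows. -/
theorem span_gen : Submodule.span K (Set.range (gen K V)) = ⊤ := by
  set S := Submodule.span K (Set.range (gen K V)) with hS
  have hmem : ∀ g : Gen V, gen K V g ∈ S := fun g => Submodule.subset_span ⟨g, rfl⟩
  have key : ∀ x : FreeAlgebra K (Gen V), ∀ s ∈ S,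
      toAlg K V (toPath K V x) * s ∈ S := by
    intro x
    induction x using FreeAlgebra.induction with
    | grade0 r =>
      intro s hs
      rw [AlgHom.commutes, AlgHom.commutes, ← Algebra.smul_def]
      exact S.smul_mem r hs
    | grade1 g =>
      intro s hs
      change gen K V g * s ∈ S
      induction hs using Submodule.span_induction with
      | mem y hy =>
        obtain ⟨h, rfl⟩ := hy
        rcases gen_mul_gen K V g h with h0 | ⟨k, hk⟩
        · rw [h0]; exact S.zero_mem
        · rw [hk]; exact hmem k
      | zero => rw [mul_zero]; exact S.zero_mem
      | add y z _ _ hy hz => rw [mul_add]; exact S.add_mem hy hz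
      | smul c y _ hy => rw [mul_smul_comm]; exact S.smul_mem c hy
    | mul a b ha hb =>
      intro s hs
      rw [map_mul, map_mul, mul_assoc]
      exact ha _ (hb _ hs)
    | add a b ha hb =>
      intro s hs
      rw [map_add, map_add, add_mul]
      exact S.add_mem (ha _ hs) (hb _ hs)
  refine eq_top_iff.2 fun y _ => ?_
  obtain ⟨z, rfl⟩ := toAlg_surjective K V y
  obtain ⟨x, rfl⟩ := toPath_surjective K V z
  have h1 : (1 : Alg K V) ∈ S := by
    rw [← sum_e K V]
    exact S.sum_mem fun v _ => hmem _
  simpa using key x 1 h1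

variable [∀ i j : V, Finite (i ⟶ j)]

instance instFiniteGen : Finite (Gen V) := by
  let f : V ⊕ (Σ i : V, Σ j : V, (i ⟶ j)) → Gen V :=
    Sum.elim Gen.vertex fun x => Gen.arrow x.2.2
  refine Finite.of_surjective f ?_
  rintro (v | @⟨i, j, a⟩)
  · exact ⟨Sum.inl v, rfl⟩
  · exact ⟨Sum.inr ⟨i, j, a⟩, rfl⟩

instance instModuleFiniteAlg : Module.Finite K (Alg K V) :=
  ⟨(Submodule.fg_def).2 ⟨Set.range (gen K V), Set.finite_range _, span_gen K V⟩⟩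

instance instNoetherianAlgOp : IsNoetherianRing (AlgOp K V) :=
  IsNoetherianRing.of_finite K (AlgOp K V)

end Algebra

section Heart

variable (K : Type u) [Field K] (V : Type u) [Quiver.{u} V] [Fintype V]

/-- `J / J²` as a right ideal of `A`, i.e. as a left ideal of `Aᵐᵒᵖ`. -/
noncomputable def radical : Ideal (AlgOp K V) :=
  TwoSidedIdeal.asIdealOpposite
    (TwoSidedIdeal.span {x : Alg K V | ∃ (i j : V) (a : i ⟶ j), x = arr K V a})

/-- The right `A`-module `A₀ = KQ / J`, the direct sum of the simple modules `S_v`. -/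
noncomputable def A0 : ModuleCat.{u} (AlgOp K V) := ModuleCat.of (AlgOp K V) (AlgOp K V ⧸ radical K V)

/-- The simple right module `S_v` is in the support of `N` (is a composition factor of it),
i.e. `N e_v ≠ 0`. -/
def InSupport (v : V) (N : ModuleCat.{u} (AlgOp K V)) : Prop :=
  ∃ x : N, MulOpposite.op (e K V v) • x ≠ 0

/-- The vertices of the heart `C(Q)`: those `v` for which `S_v` is in the support of both
`Ω^n(A₀)` and `Ω^{-n}(A₀)`, where `n` is the number of vertices. The vertices of the member `M(Q)`
are the remaining ones. -/
def heart : Set V :=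
  {v | (∃ N, IgusaTodorov.IsNthSyzygy (AlgOp K V) (Fintype.card V) (A0 K V) N ∧
          InSupport K V v N) ∧
       (∃ N, IgusaTodorov.IsNthCosyzygy (AlgOp K V) (Fintype.card V) (A0 K V) N ∧
          InSupport K V v N)}

/-- The preorder "there is a path in `Q` from `x` to `y`", restricted to the vertices of the member,
is a total order. -/
def MemberTotallyOrdered : Prop :=
  (∀ x ∈ (heart K V)ᶜ, ∀ y ∈ (heart K V)ᶜ,
    Nonempty (Quiver.Path x y) → Nonempty (Quiver.Path y x) → x = y) ∧
  (∀ x ∈ (heart K V)ᶜ, ∀ y ∈ (heart K V)ᶜ,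
    Nonempty (Quiver.Path x y) ∨ Nonempty (Quiver.Path y x))

/-- `s` is a source of the full subquiver `M(Q)`. -/
def IsMemberSource (s : V) : Prop :=
  s ∈ (heart K V)ᶜ ∧ ∀ x ∈ (heart K V)ᶜ, IsEmpty (x ⟶ s)

/-- `v` is a sink of the whole quiver. -/
def IsSink (v : V) : Prop := ∀ w : V, IsEmpty (v ⟶ w)

end Heart

end RadSqZeroAlg

/-! Write n for the number of vertices. Since J² = 0, every syzygy lies in the radical of a
projective module and is semisimple, and the syzygy of a semisimple module is supported exactly on
the successors of its support (`supp_ker_iff`; dually `supp_coker_iff`). Homological questions thus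
become questions about walks in Q: the heart consists of the vertices at which some walk of length n
ends and some walk of length n starts (`mem_heart_iff`), and the projective dimension of a nonzero
semisimple module is the maximal length of a walk starting in its support
(`hasProjectiveDimensionLE_iff`). A vertex is called endless if arbitrarily long walks start there.

After one step Ω̄ lives on the free group on the non-projective simples, that is, on the vertices
that are not sinks (`exists_combCls_eq`, `combCls_injective`). There it is a nonnegative integer
matrix T with nonzero entries exactly at the arrows. Hence φ(M) is at most one more than the longest
chain of T ending in 0. Such a chain is bounded by the number of non-sinks, and by one less if an
endless vertex exists, because T is then not nilpotent (`index_le`).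

Upper bound: let φ ≥ 1 and let k be the finite projective dimension of a summand of Ω^φ(M). A walk
realising k starts at a non-endless vertex and so repeats no vertex. If no vertex is endless,
prolonging it backwards by φ − 1 arrows gives φ + k ≤ n ≤ 2n − 4. If c is endless, there is still a
sink, so φ ≤ n − 1, and the walk avoids c, so k ≤ n − 2. Equality makes the walk pass through all
vertices except c, which dictates the shape of Q (`isExtremal_of_walk`).

Lower bound: the five conditions yield a loop at c, an arrow c → s and a walk of length n − 2 from s
(`IsExtremal.exists_walk`). For M = S_c ⊕ e_cA/S_s the second summand forces φ(M) = n − 1, while the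
loop keeps S_s, of projective dimension n − 2, as a summand of Ω^φ(M). -/

namespace RadSqZeroAlg

/-! ### Representations of A: characters and nonvanishing of arrows -/

section Lift

variable (K : Type u) [Field K] (V : Type u) [Quiver.{u} V] [Fintype V]
  {B : Type*} [Ring B] [Algebra K B]

/-- The universal property of the path algebra. -/
theorem exists_pathAlgebra_lift (f : Gen V → B)
    (hf : ∀ x y, PathRel K V x y → FreeAlgebra.lift K f x = FreeAlgebra.lift K f y) :
    ∃ F : PathAlgebra K V →ₐ[K] B, ∀ x, F (toPath K V x) = FreeAlgebra.lift K f x :=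
  ⟨RingQuot.liftAlgHom K ⟨FreeAlgebra.lift K f, fun x y h => hf x y h⟩, fun x =>
    RingQuot.liftAlgHom_mkAlgHom_apply K (FreeAlgebra.lift K f) (fun x y h => hf x y h) x⟩

/-- An algebra map out of the path algebra which kills all products `a y b` with arrows `a` and
`b` factors through `KQ / J²`. -/
theorem exists_alg_lift (F : PathAlgebra K V →ₐ[K] B)
    (hF : ∀ (i j k l : V) (a : i ⟶ j) (b : k ⟶ l) (y : PathAlgebra K V),
      F (pathGen K V (Gen.arrow a)) * F y * F (pathGen K V (Gen.arrow b)) = 0) :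
    ∃ G : Alg K V →ₐ[K] B, ∀ x, G (toAlg K V x) = F x := by
  -- The free middle factor y absorbs inner multiplications when the arrows are replaced by elements
  -- of J, first the left one and then the right one.
  have h1 : ∀ x ∈ arrowIdeal K V, ∀ (k l : V) (b : k ⟶ l) (y : PathAlgebra K V),
      F x * F y * F (pathGen K V (Gen.arrow b)) = 0 := by
    intro x hx
    induction hx using TwoSidedIdeal.span_induction with
    | mem x h => obtain ⟨i, j, a, rfl⟩ := h; exact fun k l b y => hF i j k l a b y
    | zero => intros; simp
    | add x y _ _ hx hy =>
      intro k l b z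
      rw [map_add, add_mul, add_mul, hx, hy, add_zero]
    | neg x _ hx => intro k l b z; rw [map_neg, neg_mul, neg_mul, hx, neg_zero]
    | left_absorb c x _ hx =>
      intro k l b z; rw [map_mul, mul_assoc, mul_assoc, ← mul_assoc (F x), hx, mul_zero]
    | right_absorb c x _ hx =>
      intro k l b z; rw [map_mul, mul_assoc (F x), ← map_mul, hx]
  have h2 : ∀ x ∈ arrowIdeal K V, ∀ y ∈ arrowIdeal K V, ∀ z, F x * F z * F y = 0 := by
    intro x hx y hy
    induction hy using TwoSidedIdeal.span_induction with
    | mem y h => obtain ⟨i, j, a, rfl⟩ := h; exact fun z => h1 x hx i j a z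
    | zero => intros; simp
    | add y y' _ _ hy hy' =>
      intro z
      rw [map_add, mul_add, hy, hy', add_zero]
    | neg y _ hy => intro z; rw [map_neg, mul_neg, hy, neg_zero]
    | left_absorb c y _ hy => intro z; rw [map_mul, mul_assoc, ← mul_assoc (F z), ← map_mul,
        ← mul_assoc, hy]
    | right_absorb c y _ hy => intro z; rw [map_mul, ← mul_assoc, hy, zero_mul]
  have h3 : ∀ ⦃x y⦄, SqRel K V x y → F x = F y := by
    rintro x y ⟨⟨a, ha, b, hb, rfl⟩, rfl⟩
    have := h2 a ha b hb 1
    rw [map_one, mul_one] at this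
    rw [map_mul, this, map_zero]
  exact ⟨RingQuot.liftAlgHom K ⟨F, h3⟩, fun x => RingQuot.liftAlgHom_mkAlgHom_apply K F h3 x⟩

open Classical in
theorem exists_character (v : V) : ∃ G : Alg K V →ₐ[K] K,
    (∀ w, G (e K V w) = if w = v then 1 else 0) ∧
    ∀ (i j : V) (a : i ⟶ j), G (arr K V a) = 0 := by
  let f : Gen V → K := fun g => match g with
    | Gen.vertex w => if w = v then 1 else 0
    | Gen.arrow _ => 0
  obtain ⟨F, hF⟩ := exists_pathAlgebra_lift K V f (by
    intro x y h
    cases h with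
    | idem w => by_cases h : w = v <;> simp [f, h]
    | orth w w' h =>
      by_cases h1 : w = v <;> by_cases h2 : w' = v <;> simp [f, h1, h2]
      exact h (h1.trans h2.symm)
    | sum_one => simp [f]
    | source a => simp [f]
    | target a => simp [f])
  have hF' : ∀ g, F (pathGen K V g) = f g := fun g => by
    rw [pathGen, hF, FreeAlgebra.lift_ι_apply]
  obtain ⟨G, hG⟩ := exists_alg_lift K V F (by
    intro i j k l a b y
    rw [hF' (Gen.arrow a)]
    simp [f])
  exact ⟨G, fun w => by rw [e, gen, hG, hF'], fun i j a => by rw [arr, gen, hG, hF']⟩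

open Classical in
-- A is represented by 2×2 matrices whose rows are labelled by i and j, with a as the matrix unit
-- E₁₂ and every other arrow as 0. Labelling rows rather than vertices lets the same formula serve
-- for a loop, whose vertex becomes the identity.
theorem smul_arr_eq_zero {i j : V} (a : i ⟶ j) (c : K) (hc : c • arr K V a = 0) : c = 0 := by
  let f : Gen V → Matrix (Fin 2) (Fin 2) K := fun g => match g with
    | Gen.vertex w => Matrix.diagonal fun p => if w = ![i, j] p then 1 else 0
    | @Gen.arrow _ _ k l b =>
      if (⟨k, l, b⟩ : Σ k l : V, (k ⟶ l)) = ⟨i, j, a⟩ then !![0, 1; 0, 0] else 0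
  obtain ⟨F, hF⟩ := exists_pathAlgebra_lift K V f (by
    intro x y h
    cases h with
    | idem w =>
      rw [map_mul, FreeAlgebra.lift_ι_apply]
      simp only [f, Matrix.diagonal_mul_diagonal]
      congr 1
      ext p
      split_ifs <;> simp
    | orth w w' h =>
      rw [map_mul, FreeAlgebra.lift_ι_apply, FreeAlgebra.lift_ι_apply, map_zero]
      simp only [f, Matrix.diagonal_mul_diagonal]
      rw [← Matrix.diagonal_zero]
      congr 1
      ext p
      split_ifs with h1 h2
      · exact absurd (h1.trans h2.symm) h
      all_goals simp
    | sum_one =>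
      rw [map_sum, map_one]
      ext p q
      rw [Matrix.sum_apply]
      simp only [f, FreeAlgebra.lift_ι_apply, Matrix.diagonal_apply, Matrix.one_apply]
      split_ifs
      · rw [Finset.sum_eq_single (![i, j] p)] <;> simp +contextual
      · simp
    | @source k l b =>
      rw [map_mul, FreeAlgebra.lift_ι_apply, FreeAlgebra.lift_ι_apply]
      by_cases h : (⟨k, l, b⟩ : Σ k l : V, (k ⟶ l)) = ⟨i, j, a⟩
      · cases h
        ext p q
        fin_cases p <;> fin_cases q <;> simp [f]
      · simp only [f, if_neg h, mul_zero]
    | @target k l b =>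
      rw [map_mul, FreeAlgebra.lift_ι_apply, FreeAlgebra.lift_ι_apply]
      by_cases h : (⟨k, l, b⟩ : Σ k l : V, (k ⟶ l)) = ⟨i, j, a⟩
      · cases h
        ext p q
        fin_cases p <;> fin_cases q <;> simp [f]
      · simp only [f, if_neg h, zero_mul])
  have hF' : ∀ g, F (pathGen K V g) = f g := fun g => by
    rw [pathGen, hF, FreeAlgebra.lift_ι_apply]
  have h10 : ∀ y, F y 1 0 = 0 := by
    intro y
    obtain ⟨x, rfl⟩ := toPath_surjective K V y
    rw [hF]
    induction x using FreeAlgebra.induction with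
    | grade0 r => simp [Matrix.algebraMap_matrix_apply]
    | grade1 g =>
      rw [FreeAlgebra.lift_ι_apply]
      rcases g with w | ⟨b⟩
      · simp [f]
      · simp only [f]; split_ifs <;> simp
    | mul x y hx hy => simp [map_mul, Matrix.mul_apply, hx, hy]
    | add x y hx hy => simp [map_add, hx, hy]
  have hE : ∀ g : Gen V, (∃ (k l : V) (b : k ⟶ l), g = Gen.arrow b) →
      ∃ t : K, F (pathGen K V g) = !![0, t; 0, 0] := by
    rintro _ ⟨k, l, b, rfl⟩
    rw [hF']
    simp only [f]
    split_ifs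
    · exact ⟨1, rfl⟩
    · exact ⟨0, by ext p q; fin_cases p <;> fin_cases q <;> rfl⟩
  obtain ⟨G, hG⟩ := exists_alg_lift K V F (by
    intro i j k l a b y
    obtain ⟨t, ht⟩ := hE _ ⟨i, j, a, rfl⟩
    obtain ⟨s, hs⟩ := hE _ ⟨k, l, b, rfl⟩
    have := h10 y
    rw [ht, hs]
    ext p q
    fin_cases p <;> fin_cases q <;> simp [Matrix.mul_apply, Matrix.vecMul, dotProduct, this])
  have h := congrArg G hc
  rw [map_smul, arr, gen, hG, hF', map_zero] at h
  have h2 := congrFun (congrFun h 0) 1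
  simpa [f] using h2

end Lift

/-! ### Calculus in the opposite algebra -/

section Opposite

variable {K : Type u} [Field K] {V : Type u} [Quiver.{u} V] [Fintype V]

variable (K) in
/-- The idempotent `e_v`, acting on right `A`-modules. -/
noncomputable def oe (v : V) : AlgOp K V := MulOpposite.op (e K V v)

variable (K) in
/-- The arrow `a`, acting on right `A`-modules. -/
noncomputable def oa {i j : V} (a : i ⟶ j) : AlgOp K V := MulOpposite.op (arr K V a)

variable (K) in
/-- The character of `A` belonging to the simple module `S_v`. -/
noncomputable def chi (v : V) : AlgOp K V →ₐ[K] K :=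
  AlgHom.fromOpposite (exists_character K V v).choose fun _ _ => mul_comm _ _

theorem oe_mul_oe_self (v : V) : oe K v * oe K v = oe K v :=
  congrArg MulOpposite.op (e_mul_e_self K V v)

theorem oe_mul_oe_of_ne {v w : V} (h : v ≠ w) : oe K v * oe K w = 0 :=
  congrArg MulOpposite.op (e_mul_e_of_ne K V h.symm)

variable (K V) in
theorem sum_oe : ∑ v : V, oe K v = 1 := by
  have := congrArg MulOpposite.op (sum_e K V)
  rwa [Finset.op_sum] at this

theorem oa_mul_oe {i j : V} (a : i ⟶ j) : oa K a * oe K i = oa K a :=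
  congrArg MulOpposite.op (e_mul_arr K V a)

theorem oe_mul_oa {i j : V} (a : i ⟶ j) : oe K j * oa K a = oa K a :=
  congrArg MulOpposite.op (arr_mul_e K V a)

theorem oa_mul_oa {i j k l : V} (a : i ⟶ j) (b : k ⟶ l) : oa K a * oa K b = 0 :=
  congrArg MulOpposite.op (arr_mul_arr K V b a)

theorem oa_mul_oe_of_ne {i j v : V} (a : i ⟶ j) (h : i ≠ v) : oa K a * oe K v = 0 := by
  rw [← oa_mul_oe, mul_assoc, oe_mul_oe_of_ne h, mul_zero]

theorem oe_mul_oa_of_ne {i j v : V} (a : i ⟶ j) (h : v ≠ j) : oe K v * oa K a = 0 := by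
  rw [← oe_mul_oa, ← mul_assoc, oe_mul_oe_of_ne h, zero_mul]

open Classical in
theorem chi_oe (v w : V) : chi K v (oe K w) = if w = v then 1 else 0 :=
  (exists_character K V v).choose_spec.1 w

theorem chi_oe_self (v : V) : chi K v (oe K v) = 1 := by simp [chi_oe]

theorem chi_oe_of_ne {v w : V} (h : w ≠ v) : chi K v (oe K w) = 0 := by simp [chi_oe, h]

@[simp] theorem chi_oa (v : V) {i j : V} (a : i ⟶ j) : chi K v (oa K a) = 0 :=
  (exists_character K V v).choose_spec.2 i j a

theorem smul_oa_eq_zero {i j : V} (a : i ⟶ j) {c : K} (h : c • oa K a = 0) : c = 0 :=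
  smul_arr_eq_zero K V a c (MulOpposite.op_injective (by rw [MulOpposite.op_smul]; exact h))

@[elab_as_elim]
theorem algOp_induction {p : AlgOp K V → Prop} (r : AlgOp K V) (zero : p 0)
    (add : ∀ x y, p x → p y → p (x + y)) (smul : ∀ (c : K) x, p x → p (c • x))
    (vertex : ∀ v : V, p (oe K v)) (arrow : ∀ (i j : V) (a : i ⟶ j), p (oa K a)) : p r := by
  have h : ∀ x : Alg K V, p (MulOpposite.op x) := by
    intro x
    have hx : x ∈ Submodule.span K (Set.range (gen K V)) := by rw [span_gen]; trivial
    induction hx using Submodule.span_induction with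
    | mem x hx =>
      obtain ⟨(v | a), rfl⟩ := hx
      · exact vertex v
      · exact arrow _ _ a
    | zero => exact zero
    | add x y _ _ hx hy => exact add _ _ hx hy
    | smul c x _ hx => exact smul c _ hx
  exact h r.unop

/-- Products of arrows vanish, so only the coefficient of the idempotent at j matters: an arrow
ending at j spans a copy of S_j. -/
theorem mul_oa {i j : V} (a : i ⟶ j) (r : AlgOp K V) : r * oa K a = chi K j r • oa K a := by
  induction r using algOp_induction with
  | zero => simp
  | add x y hx hy => rw [add_mul, hx, hy, map_add, add_smul]
  | smul c x hx => rw [smul_mul_assoc, hx, map_smul, smul_assoc]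
  | vertex v =>
    by_cases h : v = j
    · subst h; rw [oe_mul_oa, chi_oe_self, one_smul]
    · rw [oe_mul_oa_of_ne a h, chi_oe_of_ne h, zero_smul]
  | arrow k l b => rw [oa_mul_oa, chi_oa, zero_smul]

theorem oa_mul {i j : V} (a : i ⟶ j) (r : AlgOp K V) : oa K a * r = chi K i r • oa K a := by
  induction r using algOp_induction with
  | zero => simp
  | add x y hx hy => rw [mul_add, hx, hy, map_add, add_smul]
  | smul c x hx => rw [mul_smul_comm, hx, map_smul, smul_assoc]
  | vertex v =>
    by_cases h : i = v
    · subst h; rw [oa_mul_oe, chi_oe_self, one_smul]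
    · rw [oa_mul_oe_of_ne a h, chi_oe_of_ne (Ne.symm h), zero_smul]
  | arrow k l b => rw [oa_mul_oa, chi_oa, zero_smul]

theorem chi_eq_zero_of_oa_mul {i j : V} (a : i ⟶ j) {r : AlgOp K V} (h : oa K a * r = 0) :
    chi K i r = 0 := by
  rw [oa_mul] at h
  exact smul_oa_eq_zero a h

variable (K V) in
/-- The span of the arrows. -/
noncomputable def arrowSpan : Submodule K (AlgOp K V) :=
  Submodule.span K {x | ∃ (i j : V) (a : i ⟶ j), x = oa K a}

theorem sub_sum_chi_mem (r : AlgOp K V) : r - ∑ v, chi K v r • oe K v ∈ arrowSpan K V := by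
  induction r using algOp_induction with
  | zero => simp
  | add x y hx hy =>
    have := add_mem hx hy
    simp only [map_add, add_smul, Finset.sum_add_distrib]
    convert this using 1
    abel
  | smul c x hx =>
    have := (arrowSpan K V).smul_mem c hx
    simpa [smul_sub, Finset.smul_sum, smul_smul] using this
  | vertex v =>
    rw [Finset.sum_eq_single v, chi_oe_self, one_smul, sub_self]
    · exact zero_mem _
    · intro w _ h; rw [chi_oe_of_ne (Ne.symm h), zero_smul]
    · simp
  | arrow i j a => 
    have h : oa K a ∈ arrowSpan K V := Submodule.subset_span ⟨i, j, a, rfl⟩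
    simpa using h

theorem mem_arrowSpan {r : AlgOp K V} : r ∈ arrowSpan K V ↔ ∀ v, chi K v r = 0 := by
  refine ⟨fun h v => ?_, fun h => ?_⟩
  · induction h using Submodule.span_induction with
    | mem x hx => obtain ⟨i, j, a, rfl⟩ := hx; exact chi_oa v a
    | zero => simp
    | add x y _ _ hx hy => rw [map_add, hx, hy, add_zero]
    | smul c x _ hx => rw [map_smul, hx, smul_zero]
  · have := sub_sum_chi_mem r
    simpa [h] using this

/-- Identifies the two-sided ideal generated by the arrows with their mere linear span. -/
theorem mem_radical {r : AlgOp K V} : r ∈ radical K V ↔ ∀ v, chi K v r = 0 := by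
  rw [radical, TwoSidedIdeal.mem_asIdealOpposite]
  refine ⟨fun h v => ?_, fun h => ?_⟩
  · have key : ∀ x : Alg K V, x ∈ TwoSidedIdeal.span
        {x : Alg K V | ∃ (i j : V) (a : i ⟶ j), x = arr K V a} →
        chi K v (MulOpposite.op x) = 0 := by
      intro x hx
      induction hx using TwoSidedIdeal.span_induction with
      | mem x hx => obtain ⟨i, j, a, rfl⟩ := hx; exact chi_oa v a
      | zero => simp
      | add x y _ _ hx hy => rw [MulOpposite.op_add, map_add, hx, hy, add_zero]
      | neg x _ hx => rw [MulOpposite.op_neg, map_neg, hx, neg_zero]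
      | left_absorb c x _ hx => rw [MulOpposite.op_mul, map_mul, hx, zero_mul]
      | right_absorb c x _ hx => rw [MulOpposite.op_mul, map_mul, hx, mul_zero]
    exact key _ h
  · have hr := mem_arrowSpan.2 h
    induction hr using Submodule.span_induction with
    | mem x hx =>
      obtain ⟨i, j, a, rfl⟩ := hx
      exact TwoSidedIdeal.subset_span ⟨i, j, a, rfl⟩
    | zero => exact zero_mem _
    | add x y hx' hy' hx hy =>
      exact add_mem (hx (mem_arrowSpan.1 hx')) (hy (mem_arrowSpan.1 hy'))
    | smul c x hx' hx =>
      have := hx (mem_arrowSpan.1 hx')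
      rw [MulOpposite.unop_smul, Algebra.smul_def]
      exact TwoSidedIdeal.mul_mem_left _ _ _ this

end Opposite

end RadSqZeroAlg

namespace RadSqZeroAlg

/-! ### Radical, socle and support of a module -/

section Radical

variable (K : Type u) [Field K] (V : Type u) [Quiver.{u} V] [Fintype V]
  (M : Type u) [AddCommGroup M] [Module (AlgOp K V) M]

/-- The submodule `M J` generated by the images of the arrows. -/
noncomputable def rad : Submodule (AlgOp K V) M :=
  Submodule.span (AlgOp K V) {y | ∃ (i j : V) (a : i ⟶ j) (x : M), y = oa K a • x}

/-- The elements annihilated by the arrows. -/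
noncomputable def soc : Submodule (AlgOp K V) M where
  carrier := {x | ∀ (i j : V) (a : i ⟶ j), oa K a • x = 0}
  zero_mem' := fun i j a => smul_zero _
  add_mem' := fun hx hy i j a => by rw [smul_add, hx, hy, add_zero]
  smul_mem' := fun r x hx i j a => by
    rw [smul_smul, oa_mul, Algebra.smul_def, mul_smul, hx, smul_zero]

/-- All arrows act as zero; equivalently, the module is semisimple. -/
def ArrowsVanish : Prop := ∀ (i j : V) (a : i ⟶ j) (x : M), oa K a • x = 0

/-- The simple module `S_v` is in the support of `M`. -/
def Supp (v : V) : Prop := ∃ x : M, oe K v • x ≠ 0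

variable {K V M}

theorem mem_soc {x : M} : x ∈ soc K V M ↔ ∀ (i j : V) (a : i ⟶ j), oa K a • x = 0 := Iff.rfl

theorem oa_smul_mem_rad {i j : V} (a : i ⟶ j) (x : M) : oa K a • x ∈ rad K V M :=
  Submodule.subset_span ⟨i, j, a, x, rfl⟩

theorem rad_le_soc : rad K V M ≤ soc K V M := by
  rw [rad, Submodule.span_le]
  rintro _ ⟨i, j, a, x, rfl⟩ k l b
  rw [smul_smul, oa_mul_oa, zero_smul]

theorem ArrowsVanish.rad_eq_bot (h : ArrowsVanish K V M) : rad K V M = ⊥ := by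
  rw [rad, Submodule.span_eq_bot]
  rintro _ ⟨i, j, a, x, rfl⟩
  exact h i j a x

theorem ArrowsVanish.of_injective {N : Type u} [AddCommGroup N] [Module (AlgOp K V) N]
    (h : ArrowsVanish K V N) (f : M →ₗ[AlgOp K V] N) (hf : Function.Injective f) :
    ArrowsVanish K V M := fun i j a x => hf (by rw [map_smul, h, map_zero])

theorem ArrowsVanish.of_surjective {N : Type u} [AddCommGroup N] [Module (AlgOp K V) N]
    (h : ArrowsVanish K V M) (f : M →ₗ[AlgOp K V] N) (hf : Function.Surjective f) :
    ArrowsVanish K V N := fun i j a x => by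
  obtain ⟨y, rfl⟩ := hf x
  rw [← map_smul, h, map_zero]

theorem arrowsVanish_of_le_soc {U : Submodule (AlgOp K V) M} (h : U ≤ soc K V M) :
    ArrowsVanish K V U := fun i j a x => Subtype.ext (h x.2 i j a)

theorem arrowsVanish_quotient {U : Submodule (AlgOp K V) M} (h : rad K V M ≤ U) :
    ArrowsVanish K V (M ⧸ U) := fun i j a x => by
  obtain ⟨y, rfl⟩ := Submodule.Quotient.mk_surjective U x
  rw [← Submodule.Quotient.mk_smul, Submodule.Quotient.mk_eq_zero]
  exact h (oa_smul_mem_rad a y)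

theorem Supp.of_injective {N : Type u} [AddCommGroup N] [Module (AlgOp K V) N] {v : V}
    (h : Supp K V M v) (f : M →ₗ[AlgOp K V] N) (hf : Function.Injective f) : Supp K V N v := by
  obtain ⟨x, hx⟩ := h
  refine ⟨f x, fun h0 => hx (hf ?_)⟩
  rw [map_smul, h0, map_zero]

theorem Supp.of_surjective {N : Type u} [AddCommGroup N] [Module (AlgOp K V) N] {v : V}
    (h : Supp K V N v) (f : M →ₗ[AlgOp K V] N) (hf : Function.Surjective f) : Supp K V M v := by
  obtain ⟨x, hx⟩ := h
  obtain ⟨y, rfl⟩ := hf x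
  refine ⟨y, fun h0 => hx ?_⟩
  rw [← map_smul, h0, map_zero]

theorem supp_iff_of_equiv {N : Type u} [AddCommGroup N] [Module (AlgOp K V) N] {v : V}
    (f : M ≃ₗ[AlgOp K V] N) : Supp K V M v ↔ Supp K V N v :=
  ⟨fun h => h.of_injective f.toLinearMap f.injective,
    fun h => h.of_surjective f.toLinearMap f.surjective⟩

theorem supp_prod {N : Type u} [AddCommGroup N] [Module (AlgOp K V) N] {v : V} :
    Supp K V (M × N) v ↔ Supp K V M v ∨ Supp K V N v := by
  constructor
  · rintro ⟨⟨x, y⟩, h⟩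
    by_cases hx : oe K v • x = 0
    · exact Or.inr ⟨y, fun hy => h (Prod.ext hx hy)⟩
    · exact Or.inl ⟨x, hx⟩
  · rintro (h | h)
    · exact h.of_injective (LinearMap.inl _ _ _) LinearMap.inl_injective
    · exact h.of_injective (LinearMap.inr _ _ _) LinearMap.inr_injective

theorem not_supp_of_subsingleton [Subsingleton M] (v : V) : ¬ Supp K V M v :=
  fun ⟨_, hx⟩ => hx (Subsingleton.elim _ _)

theorem exists_supp [Nontrivial M] : ∃ v, Supp K V M v := by
  by_contra! h
  obtain ⟨x, hx⟩ := exists_ne (0 : M)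
  refine hx ?_
  rw [← one_smul (AlgOp K V) x, ← sum_oe K V, Finset.sum_smul]
  exact Finset.sum_eq_zero fun v _ => by_contra fun h0 => h v ⟨x, h0⟩

/-- Nakayama's lemma for the square zero radical. -/
theorem eq_top_of_sup_rad {U : Submodule (AlgOp K V) M} (h : U ⊔ rad K V M = ⊤) : U = ⊤ := by
  refine top_le_iff.1 (h ▸ sup_le le_rfl ?_)
  rw [rad, Submodule.span_le]
  rintro _ ⟨i, j, a, x, rfl⟩
  obtain ⟨u, hu, t, ht, rfl⟩ := Submodule.mem_sup.1 (h.symm ▸ Submodule.mem_top : x ∈ U ⊔ rad K V M)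
  rw [smul_add, rad_le_soc ht, add_zero]
  exact U.smul_mem _ hu

theorem eq_bot_of_inf_soc {U : Submodule (AlgOp K V) M} (h : U ⊓ soc K V M = ⊥) : U = ⊥ := by
  refine (Submodule.eq_bot_iff _).2 fun x hx => ?_
  have h1 : x ∈ soc K V M := fun i j a => by
    have : oa K a • x ∈ U ⊓ soc K V M := ⟨U.smul_mem _ hx, rad_le_soc (oa_smul_mem_rad a x)⟩
    rwa [h, Submodule.mem_bot] at this
  have : x ∈ U ⊓ soc K V M := ⟨hx, h1⟩
  rwa [h, Submodule.mem_bot] at this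

theorem arrowSpan_smul {r : AlgOp K V} (hr : r ∈ arrowSpan K V) {x : M} (hx : x ∈ soc K V M) :
    r • x = 0 := by
  induction hr using Submodule.span_induction with
  | mem r hr => obtain ⟨i, j, a, rfl⟩ := hr; exact hx i j a
  | zero => rw [zero_smul]
  | add r s _ _ hr hs => rw [add_smul, hr, hs, add_zero]
  | smul c r _ hr => rw [Algebra.smul_def, mul_smul, hr, smul_zero]

theorem arrowSpan_smul_mem {r : AlgOp K V} (hr : r ∈ arrowSpan K V) (x : M) :
    r • x ∈ rad K V M := by
  induction hr using Submodule.span_induction with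
  | mem r hr => obtain ⟨i, j, a, rfl⟩ := hr; exact oa_smul_mem_rad a x
  | zero => rw [zero_smul]; exact zero_mem _
  | add r s _ _ hr hs => rw [add_smul]; exact add_mem hr hs
  | smul c r _ hr => rw [Algebra.smul_def, mul_smul]; exact Submodule.smul_mem _ _ hr

variable [Module K M] [IsScalarTower K (AlgOp K V) M]

theorem smul_oe_smul (v : V) (r : AlgOp K V) {x : M} (hx : x ∈ soc K V M) :
    r • oe K v • x = chi K v r • oe K v • x := by
  have h : r * oe K v - chi K v r • oe K v ∈ arrowSpan K V := mem_arrowSpan.2 fun w => by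
    rw [map_sub, map_mul, map_smul, smul_eq_mul]
    by_cases hw : v = w
    · subst hw; rw [sub_self]
    · rw [chi_oe_of_ne hw, mul_zero, mul_zero, sub_self]
  have := arrowSpan_smul h hx
  rw [sub_smul, sub_eq_zero, mul_smul, smul_assoc] at this
  exact this

theorem oe_smul_smul (v : V) (r : AlgOp K V) {x : M} (hx : x ∈ soc K V M) :
    oe K v • r • x = chi K v r • oe K v • x := by
  have h : oe K v * r - chi K v r • oe K v ∈ arrowSpan K V := mem_arrowSpan.2 fun w => by
    rw [map_sub, map_mul, map_smul, smul_eq_mul]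
    by_cases hw : v = w
    · subst hw; rw [mul_comm, sub_self]
    · rw [chi_oe_of_ne hw, zero_mul, mul_zero, sub_self]
  have := arrowSpan_smul h hx
  rw [sub_smul, sub_eq_zero, mul_smul, smul_assoc] at this
  exact this

end Radical

/-! ### Modules killed by the arrows are semisimple -/

section Semisimple

variable {K : Type u} [Field K] {V : Type u} [Quiver.{u} V] [Fintype V]
  {M : Type u} [AddCommGroup M] [Module (AlgOp K V) M]

/-- Submodules of a module annihilated by the arrows are direct summands. -/
theorem ArrowsVanish.exists_retraction (h : ArrowsVanish K V M) (Z : Submodule (AlgOp K V) M) :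
    ∃ g : M →ₗ[AlgOp K V] Z, ∀ z : Z, g z = z := by
  let _ : Module K M := Module.compHom M (algebraMap K (AlgOp K V))
  have _ : IsScalarTower K (AlgOp K V) M := ⟨fun c r x => by
    rw [Algebra.smul_def, mul_smul]; rfl⟩
  have hM : ∀ x : M, x ∈ soc K V M := fun x i j a => h i j a x
  have hZ : ∀ x : Z, x ∈ soc K V Z := fun x i j a => Subtype.ext (h i j a x)
  obtain ⟨p, hp⟩ := LinearMap.exists_leftInverse_of_injective
    (Z.subtype.restrictScalars K) (LinearMap.ker_eq_bot.2 Z.injective_subtype)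
  have hp' : ∀ z : Z, p z = z := fun z => LinearMap.congr_fun hp z
  -- Cutting the K-linear retraction p into its diagonal blocks e_v p e_v makes it A-linear, because
  -- r acts on a v-block as the scalar χ_v(r).
  refine ⟨{ toFun := fun y => ∑ v : V, oe K v • p (oe K v • y)
            map_add' := fun x y => by simp only [smul_add, map_add, Finset.sum_add_distrib]
            map_smul' := fun r x => ?_ }, fun z => ?_⟩
  · rw [RingHom.id_apply, Finset.smul_sum]
    refine Finset.sum_congr rfl fun v _ => ?_
    rw [oe_smul_smul v r (hM x), map_smul, smul_oe_smul v r (hZ _), smul_comm]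
  · change ∑ v : V, oe K v • p (oe K v • (z : M)) = z
    have : ∀ v : V, oe K v • p (oe K v • (z : M)) = oe K v • z := fun v => by
      rw [← Submodule.coe_smul, hp', smul_smul, oe_mul_oe_self]
    simp only [this]
    rw [← Finset.sum_smul, sum_oe, one_smul]

/-- Superfluous submodules are contained in the radical. -/
theorem le_rad_of_superfluous (N : Submodule (AlgOp K V) M)
    (h : ∀ U : Submodule (AlgOp K V) M, U ⊔ N = ⊤ → U = ⊤) : N ≤ rad K V M := by
  obtain ⟨g, hg⟩ := (arrowsVanish_quotient (le_refl (rad K V M))).exists_retraction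
    (N.map (rad K V M).mkQ)
  -- The preimage of a complement of the image of N in M/MJ spans M together with N, so superfluity
  -- makes it all of M and the image of N is zero.
  have h1 := h ((LinearMap.ker g).comap (rad K V M).mkQ) (by
    refine eq_top_iff.2 fun x _ => ?_
    obtain ⟨y, hy, hy'⟩ := (g ((rad K V M).mkQ x)).2
    refine Submodule.mem_sup.2 ⟨x - y, ?_, y, hy, by abel⟩
    rw [Submodule.mem_comap, LinearMap.mem_ker, map_sub, map_sub, sub_eq_zero, hy', hg])
  intro x hx
  have h2 : x ∈ (LinearMap.ker g).comap (rad K V M).mkQ := h1 ▸ Submodule.mem_top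
  have h3 := hg ⟨_, Submodule.mem_map_of_mem hx⟩
  rw [Submodule.mem_comap, LinearMap.mem_ker] at h2
  change g ((rad K V M).mkQ x) = _ at h3
  rw [h2] at h3
  have h4 := congrArg Subtype.val h3
  exact (Submodule.Quotient.mk_eq_zero _).1 h4.symm

/-- Essential submodules contain the socle. -/
theorem soc_le_of_essential (N : Submodule (AlgOp K V) M)
    (h : ∀ U : Submodule (AlgOp K V) M, U ⊓ N = ⊥ → U = ⊥) : soc K V M ≤ N := by
  obtain ⟨g, hg⟩ := (arrowsVanish_of_le_soc (le_refl (soc K V M))).exists_retraction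
    (N.comap (soc K V M).subtype)
  -- A complement of N ∩ soc M inside the socle meets N trivially, so it vanishes by essentiality.
  have h1 := h ((LinearMap.ker g).map (soc K V M).subtype) (by
    refine (Submodule.eq_bot_iff _).2 ?_
    rintro _ ⟨⟨y, hy, rfl⟩, hx⟩
    have h0 := hg ⟨y, hx⟩
    change g y = _ at h0
    rw [LinearMap.mem_ker.1 hy] at h0
    have h2 : (0 : soc K V M) = y := congrArg Subtype.val h0
    rw [← h2, map_zero])
  intro x hx
  let y : soc K V M := ⟨x, hx⟩
  have h2 : y - g y ∈ LinearMap.ker g := by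
    rw [LinearMap.mem_ker, map_sub, hg, sub_self]
  have h3 := Submodule.mem_map_of_mem (f := (soc K V M).subtype) h2
  rw [h1, Submodule.mem_bot, map_sub, sub_eq_zero] at h3
  change x = _ at h3
  rw [h3]
  exact (g y).2

end Semisimple

/-! ### Supports of syzygies and cosyzygies -/

section Covers

variable {K : Type u} [Field K] {V : Type u} [Quiver.{u} V] [Fintype V]
  {P : Type u} [AddCommGroup P] [Module (AlgOp K V) P]

/-- Inside a free module the coordinates r of x satisfy a r = 0, hence χ_i(r) = 0 because arrows are
nonzero. So an arrow kills in P only what J² = 0 and its source oblige it to kill; this is how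
projectivity enters the support computations. -/
theorem oe_smul_mem_rad_of_projective [Module.Projective (AlgOp K V) P] {i j : V} (a : i ⟶ j)
    {x : P} (hx : oa K a • x = 0) : oe K i • x ∈ rad K V P := by
  obtain ⟨s, hs⟩ := Module.projective_def.1 ‹Module.Projective (AlgOp K V) P›
  have h1 : oa K a • s x = 0 := by rw [← map_smul, hx, map_zero]
  rw [← hs (oe K i • x), map_smul, Finsupp.linearCombination_apply, Finsupp.sum]
  refine sum_mem fun p _ => arrowSpan_smul_mem (mem_arrowSpan.2 fun v => ?_) p
  rw [Finsupp.smul_apply, smul_eq_mul, map_mul]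
  by_cases hv : i = v
  · subst hv
    rw [chi_eq_zero_of_oa_mul a (DFunLike.congr_fun h1 p), mul_zero]
  · rw [chi_oe_of_ne hv, zero_mul]

variable {X : Type u} [AddCommGroup X] [Module (AlgOp K V) X]

/-- The w-component of a radical element comes from generators a • x with a ending at w, and such a
generator is zero when the source component of x already lies in the radical. -/
theorem supp_of_supp_ker {f : P →ₗ[AlgOp K V] X} (hk : LinearMap.ker f ≤ rad K V P)
    {w : V} (h : Supp K V (LinearMap.ker f) w) :
    ∃ v, Nonempty (v ⟶ w) ∧ ∃ x : P, oe K v • x ∉ rad K V P := by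
  obtain ⟨⟨y, hy⟩, hw⟩ := h
  have hw' : oe K w • y ≠ 0 := fun h0 => hw (Subtype.ext h0)
  have hsub : ∀ y ∈ rad K V P, oe K w • y ≠ 0 →
      ∃ v, Nonempty (v ⟶ w) ∧ ∃ x : P, oe K v • x ∉ rad K V P := by
    intro y hy
    induction hy using Submodule.span_induction with
    | mem y hy =>
      obtain ⟨i, j, a, x, rfl⟩ := hy
      intro h
      by_cases hj : w = j
      · subst hj
        refine ⟨i, ⟨a⟩, x, fun hr => h ?_⟩
        rw [← oa_mul_oe a, mul_smul, rad_le_soc hr, smul_zero]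
      · rw [smul_smul, oe_mul_oa_of_ne a hj, zero_smul] at h
        exact absurd rfl h
    | zero => intro h; exact absurd (smul_zero _) h
    | add x y _ _ hx hy =>
      intro h
      by_cases h0 : oe K w • x = 0
      · refine hy fun h1 => h ?_
        rw [smul_add, h0, h1, add_zero]
      · exact hx h0
    | smul r x hr hx =>
      intro h
      refine hx fun h0 => h ?_
      let _ : Module K P := Module.compHom P (algebraMap K (AlgOp K V))
      have _ : IsScalarTower K (AlgOp K V) P := ⟨fun c r x => by
        rw [Algebra.smul_def, mul_smul]; rfl⟩
      rw [oe_smul_smul w r (rad_le_soc hr), h0, smul_zero]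
  exact hsub y (hk hy) hw'

/-- The support of a syzygy of a semisimple module consists of the successors of its support. -/
theorem supp_ker_iff [Module.Projective (AlgOp K V) P] {f : P →ₗ[AlgOp K V] X}
    (hf : Function.Surjective f) (hX : ArrowsVanish K V X) (hk : LinearMap.ker f ≤ rad K V P)
    (w : V) : Supp K V (LinearMap.ker f) w ↔ ∃ v, Nonempty (v ⟶ w) ∧ Supp K V X v := by
  have hle : rad K V P ≤ LinearMap.ker f := by
    rw [rad, Submodule.span_le]
    rintro _ ⟨i, j, a, x, rfl⟩
    rw [SetLike.mem_coe, LinearMap.mem_ker, map_smul, hX]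
  -- For semisimple X the kernel of the cover is the whole radical of P.
  have heq := le_antisymm hk hle
  constructor
  · intro h
    obtain ⟨v, ha, x, hx⟩ := supp_of_supp_ker hk h
    refine ⟨v, ha, f x, fun h0 => hx ?_⟩
    rw [← heq, LinearMap.mem_ker, map_smul, h0]
  · rintro ⟨v, ⟨a⟩, y, hy⟩
    obtain ⟨x, rfl⟩ := hf y
    refine ⟨⟨oa K a • x, hle (oa_smul_mem_rad a x)⟩, fun h0 => hy ?_⟩
    have h1 : oe K w • oa K a • x = 0 := congrArg Subtype.val h0
    rw [smul_smul, oe_mul_oa] at h1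
    rw [← map_smul]
    exact hle (oe_smul_mem_rad_of_projective a h1)

/-- The submodule generated by the arrow is a copy of S_j, so a ↦ y is well defined on it;
injectivity extends this map to the whole algebra, and the image of 1 is the required x. This is the
dual of `oe_smul_mem_rad_of_projective`. -/
theorem exists_oa_smul_eq_of_injective {I : Type u} [AddCommGroup I] [Module (AlgOp K V) I]
    (hI : Module.Injective (AlgOp K V) I) {i j : V} (a : i ⟶ j) {y : I}
    (hy : y ∈ soc K V I) (hj : oe K j • y = y) : ∃ x : I, oa K a • x = y := by
  let _ : Module K I := Module.compHom I (algebraMap K (AlgOp K V))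
  have _ : IsScalarTower K (AlgOp K V) I := ⟨fun c r x => by
    rw [Algebra.smul_def, mul_smul]; rfl⟩
  have hker : ∀ r : AlgOp K V, r * oa K a = 0 → r • y = 0 := fun r hr => by
    rw [mul_oa] at hr
    rw [← hj, smul_oe_smul j r hy, smul_oa_eq_zero a hr, zero_smul]
  let s : AlgOp K V →ₗ[AlgOp K V] AlgOp K V := LinearMap.toSpanSingleton _ _ (oa K a)
  let t : AlgOp K V →ₗ[AlgOp K V] I := LinearMap.toSpanSingleton _ _ y
  have hst : LinearMap.ker s ≤ LinearMap.ker t := fun r hr => hker r hr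
  let g : LinearMap.range s →ₗ[AlgOp K V] I :=
    ((LinearMap.ker s).liftQ t hst).comp s.quotKerEquivRange.symm.toLinearMap
  have hg : g ⟨s 1, 1, rfl⟩ = y := by
    have h1 : s.quotKerEquivRange.symm ⟨s 1, 1, rfl⟩ = (LinearMap.ker s).mkQ 1 := by
      rw [LinearEquiv.symm_apply_eq]; rfl
    change (LinearMap.ker s).liftQ t hst (s.quotKerEquivRange.symm ⟨s 1, 1, rfl⟩) = y
    rw [h1, Submodule.mkQ_apply, Submodule.liftQ_apply]
    exact one_smul _ y
  obtain ⟨h, hh⟩ := hI.out (LinearMap.range s).subtype (Submodule.injective_subtype _) g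
  refine ⟨h 1, ?_⟩
  rw [← map_smul, ← hg, ← hh]
  congr 1
  change oa K a • (1 : AlgOp K V) = (1 : AlgOp K V) • oa K a
  rw [smul_eq_mul, smul_eq_mul, mul_one, one_mul]

/-- The support of a cosyzygy of a semisimple module consists of the predecessors of its
support. -/
theorem supp_coker_iff {I : Type u} [AddCommGroup I] [Module (AlgOp K V) I]
    (hI : Module.Injective (AlgOp K V) I) {f : X →ₗ[AlgOp K V] I}
    (hf : Function.Injective f) (hX : ArrowsVanish K V X) (hk : soc K V I ≤ LinearMap.range f)
    (w : V) : Supp K V (I ⧸ LinearMap.range f) w ↔ ∃ v, Nonempty (w ⟶ v) ∧ Supp K V X v := by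
  have hle : LinearMap.range f ≤ soc K V I := by
    rintro _ ⟨x, rfl⟩ i j a
    rw [← map_smul, hX, map_zero]
  constructor
  · rintro ⟨q, hq⟩
    obtain ⟨x, rfl⟩ := Submodule.Quotient.mk_surjective _ q
    rw [← Submodule.Quotient.mk_smul, Ne, Submodule.Quotient.mk_eq_zero] at hq
    have h1 : oe K w • x ∉ soc K V I := fun h => hq (hk h)
    rw [mem_soc] at h1
    push Not at h1
    obtain ⟨i, j, a, ha⟩ := h1
    have hi : i = w := by
      by_contra hne
      rw [smul_smul, oa_mul_oe_of_ne a hne, zero_smul] at ha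
      exact ha rfl
    subst hi
    rw [smul_smul, oa_mul_oe] at ha
    obtain ⟨y, hy⟩ := hk (rad_le_soc (oa_smul_mem_rad a x))
    refine ⟨j, ⟨a⟩, y, fun h0 => ha ?_⟩
    rw [← oe_mul_oa, mul_smul, ← hy, ← map_smul, h0, map_zero]
  · rintro ⟨v, ⟨a⟩, y, hy⟩
    have hz : f (oe K v • y) ∈ soc K V I := hle ⟨_, rfl⟩
    obtain ⟨x, hx⟩ := exists_oa_smul_eq_of_injective hI a hz (by
      rw [← map_smul, smul_smul, oe_mul_oe_self])
    refine ⟨Submodule.Quotient.mk x, fun h0 => hy (hf ?_)⟩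
    rw [← Submodule.Quotient.mk_smul, Submodule.Quotient.mk_eq_zero] at h0
    rw [← hx, ← oa_mul_oe a, mul_smul, hle h0, map_zero]

theorem arrowsVanish_coker {I : Type u} [AddCommGroup I] [Module (AlgOp K V) I]
    {f : X →ₗ[AlgOp K V] I} (hk : soc K V I ≤ LinearMap.range f) :
    ArrowsVanish K V (I ⧸ LinearMap.range f) :=
  arrowsVanish_quotient (rad_le_soc.trans hk)

end Covers

end RadSqZeroAlg

namespace RadSqZeroAlg

/-! ### Simple modules and decomposition of semisimple ones -/

section Simple

variable (K : Type u) [Field K] (V : Type u) [Quiver.{u} V] [Fintype V]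

/-- The simple module `S_v`. -/
def Simp (_ : V) : Type u := K

variable (v : V)

noncomputable instance : AddCommGroup (Simp K V v) := inferInstanceAs (AddCommGroup K)

instance : Nontrivial (Simp K V v) := inferInstanceAs (Nontrivial K)

noncomputable instance : Module K (Simp K V v) := inferInstanceAs (Module K K)

noncomputable instance : Module (AlgOp K V) (Simp K V v) :=
  Module.compHom K (chi K v).toRingHom

variable {K V v} in
theorem smul_simp (r : AlgOp K V) (x : Simp K V v) : r • x = chi K v r • x := rfl

instance : IsScalarTower K (AlgOp K V) (Simp K V v) :=
  ⟨fun c r x => by rw [smul_simp, map_smul, smul_simp, smul_assoc]⟩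

instance : Module.Finite K (Simp K V v) := inferInstanceAs (Module.Finite K K)

instance : Module.Finite (AlgOp K V) (Simp K V v) :=
  Module.Finite.of_restrictScalars_finite K _ _

variable {K V v}

theorem arrowsVanish_simp : ArrowsVanish K V (Simp K V v) := fun i j a x => by
  rw [smul_simp, chi_oa, zero_smul]

theorem supp_simp {w : V} : Supp K V (Simp K V v) w ↔ w = v := by
  constructor
  · rintro ⟨x, hx⟩
    by_contra h
    rw [smul_simp, chi_oe_of_ne h, zero_smul] at hx
    exact hx rfl
  · rintro rfl
    obtain ⟨x, hx⟩ := exists_ne (0 : Simp K V w)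
    exact ⟨x, by rwa [smul_simp, chi_oe_self, one_smul]⟩

/-- The line through e_v x is a copy of S_v, and a K-functional with value 1 there, precomposed with
e_v, is an A-linear retraction onto it. -/
theorem ArrowsVanish.exists_equiv_prod_simp {M : Type u} [AddCommGroup M] [Module (AlgOp K V) M]
    (h : ArrowsVanish K V M) (hv : Supp K V M v) :
    ∃ M' : Submodule (AlgOp K V) M, Nonempty (M ≃ₗ[AlgOp K V] M' × Simp K V v) := by
  let _ : Module K M := Module.compHom M (algebraMap K (AlgOp K V))
  have _ : IsScalarTower K (AlgOp K V) M := ⟨fun c r x => by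
    rw [Algebra.smul_def, mul_smul]; rfl⟩
  have hM : ∀ x : M, x ∈ soc K V M := fun x i j a => h i j a x
  obtain ⟨x, hx⟩ := hv
  obtain ⟨p, hp⟩ := LinearMap.exists_leftInverse_of_injective
    (LinearMap.toSpanSingleton K M (oe K v • x)) (LinearMap.ker_toSpanSingleton K hx)
  have hp1 : p (oe K v • x) = 1 := by
    have := LinearMap.congr_fun hp 1
    simpa using this
  let g : M →ₗ[AlgOp K V] Simp K V v :=
    { toFun := fun y => p (oe K v • y)
      map_add' := fun y z => by rw [smul_add, map_add]; rfl
      map_smul' := fun r y => by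
        rw [oe_smul_smul v r (hM y), map_smul]; rfl }
  let s : Simp K V v →ₗ[AlgOp K V] M :=
    { toFun := fun t => (show K from t) • oe K v • x
      map_add' := fun y z => add_smul (show K from y) (show K from z) _
      map_smul' := fun r t => by
        rw [RingHom.id_apply, smul_comm r (show K from t) (oe K v • x), smul_oe_smul v r (hM x),
          smul_smul, mul_comm]
        rfl }
  have hgs : g.comp s = LinearMap.id := by
    ext t
    change p (oe K v • (show K from t) • oe K v • x) = t
    rw [smul_comm (oe K v) (show K from t) (oe K v • x), smul_smul, oe_mul_oe_self, map_smul, hp1]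
    exact mul_one (show K from t)
  have hex : Function.Exact (LinearMap.ker g).subtype g := LinearMap.exact_subtype_ker_map g
  exact ⟨LinearMap.ker g, ⟨(hex.splitSurjectiveEquiv (Submodule.injective_subtype _) ⟨s, hgs⟩).1⟩⟩

variable [∀ i j : V, Finite (i ⟶ j)]

/-- Semisimple modules are built from zero by adding simple summands. -/
theorem arrowsVanish_induction {C : ModuleCat.{u} (AlgOp K V) → Prop}
    (zero : ∀ N : ModuleCat.{u} (AlgOp K V), Subsingleton N → C N)
    (prod : ∀ (N N' : ModuleCat.{u} (AlgOp K V)) (v : V), Module.Finite (AlgOp K V) N' →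
      ArrowsVanish K V N' → C N' → (N ≃ₗ[AlgOp K V] N' × Simp K V v) → C N)
    (N : ModuleCat.{u} (AlgOp K V)) (hfin : Module.Finite (AlgOp K V) N)
    (hN : ArrowsVanish K V N) : C N := by
  have : IsArtinianRing (AlgOp K V) := IsArtinianRing.of_finite K (AlgOp K V)
  obtain ⟨n, hn⟩ := ENat.ne_top_iff_exists.1 (Module.length_ne_top (R := AlgOp K V) (M := N))
  induction n using Nat.strong_induction_on generalizing N with
  | _ n ih =>
    rcases subsingleton_or_nontrivial N with h | h
    · exact zero N h
    · obtain ⟨v, hv⟩ := exists_supp (K := K) (V := V) (M := N)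
      obtain ⟨N', ⟨e⟩⟩ := hN.exists_equiv_prod_simp hv
      have hN' : ArrowsVanish K V N' := hN.of_injective N'.subtype N'.injective_subtype
      obtain ⟨m, hm⟩ := ENat.ne_top_iff_exists.1 (Module.length_ne_top (R := AlgOp K V) (M := N'))
      have hlt : m < n := by
        have h1 := e.length_eq
        rw [Module.length_prod, ← hn, ← hm] at h1
        have h2 : 0 < Module.length (AlgOp K V) (Simp K V v) := Module.length_pos
        have h3 : (m : ℕ∞) < n := by
          rw [h1]
          rw [add_comm]
          exact ENat.lt_add_left (ENat.natCast_ne_top m) h2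
        exact_mod_cast h3
      exact prod N (ModuleCat.of _ N') v inferInstance hN'
        (ih m hlt (ModuleCat.of _ N') inferInstance hN' hm) e

end Simple

/-! ### Projective covers -/

section Projective

variable (K : Type u) [Field K] {V : Type u} [Quiver.{u} V] [Fintype V]

/-- The indecomposable projective module `e_v A`. -/
noncomputable def Proj (v : V) : Submodule (AlgOp K V) (AlgOp K V) where
  carrier := {x | x * oe K v = x}
  zero_mem' := zero_mul _
  add_mem' := fun {x y} hx hy => by
    change (x + y) * _ = _
    rw [add_mul, hx, hy]
  smul_mem' := fun r x hx => by
    change r * x * _ = _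
    rw [mul_assoc, hx]; rfl

variable {K}

theorem mem_proj {v : V} {x : AlgOp K V} : x ∈ Proj K v ↔ x * oe K v = x := Iff.rfl

theorem oe_mem_proj (v : V) : oe K v ∈ Proj K v := oe_mul_oe_self v

instance projective_proj (v : V) : Module.Projective (AlgOp K V) (Proj K v) := by
  refine Module.Projective.of_split (Proj K v).subtype
    (LinearMap.codRestrict (Proj K v) (LinearMap.toSpanSingleton _ _ (oe K v)) fun r => ?_) ?_
  · change r * oe K v * oe K v = r * oe K v
    rw [mul_assoc, oe_mul_oe_self]
  · ext x
    exact x.2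

theorem mem_rad_proj {v : V} {x : Proj K v} (h : chi K v x = 0) : x ∈ rad K V (Proj K v) := by
  have h1 : (x : AlgOp K V) ∈ arrowSpan K V := mem_arrowSpan.2 fun w => by
    by_cases hw : v = w
    · subst hw; exact h
    · rw [← mem_proj.1 x.2, map_mul, chi_oe_of_ne hw, mul_zero]
  have h2 : x = (x : AlgOp K V) • (⟨oe K v, oe_mem_proj v⟩ : Proj K v) :=
    Subtype.ext (mem_proj.1 x.2).symm
  rw [h2]
  exact arrowSpan_smul_mem h1 _

theorem chi_eq_zero_of_mem_rad {M : Type u} [AddCommGroup M] [Module (AlgOp K V) M] {v : V}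
    (f : M →ₗ[AlgOp K V] Simp K V v) {x : M} (hx : x ∈ rad K V M) : f x = 0 := by
  have h : rad K V M ≤ LinearMap.ker f := by
    rw [rad, Submodule.span_le]
    rintro _ ⟨i, j, a, x, rfl⟩
    rw [SetLike.mem_coe, LinearMap.mem_ker, map_smul, arrowsVanish_simp]
  exact h hx

/-- The projective cover of `S_v`. -/
noncomputable def projCover (v : V) : Proj K v →ₗ[AlgOp K V] Simp K V v where
  toFun x := chi K v x
  map_add' _ _ := map_add (chi K v) _ _
  map_smul' _ _ := map_mul (chi K v) _ _

theorem projCover_surjective (v : V) : Function.Surjective (projCover (K := K) v) := fun t => by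
  refine ⟨⟨(show K from t) • oe K v, ?_⟩, ?_⟩
  · rw [mem_proj, smul_mul_assoc, oe_mul_oe_self]
  · change chi K v ((show K from t) • oe K v) = t
    rw [map_smul, chi_oe_self]
    exact mul_one (show K from t)

theorem ker_projCover_le (v : V) : LinearMap.ker (projCover (K := K) v) ≤ rad K V (Proj K v) :=
  fun _ hx => mem_rad_proj hx

theorem map_mem_rad {M N : Type u} [AddCommGroup M] [Module (AlgOp K V) M] [AddCommGroup N]
    [Module (AlgOp K V) N] (f : M →ₗ[AlgOp K V] N) {x : M} (hx : x ∈ rad K V M) :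
    f x ∈ rad K V N := by
  have h : rad K V M ≤ (rad K V N).comap f := by
    rw [rad, Submodule.span_le]
    rintro _ ⟨i, j, a, x, rfl⟩
    rw [SetLike.mem_coe, Submodule.mem_comap, map_smul]
    exact oa_smul_mem_rad a _
  exact h hx

theorem prod_mem_rad {M N : Type u} [AddCommGroup M] [Module (AlgOp K V) M] [AddCommGroup N]
    [Module (AlgOp K V) N] {x : M × N} (h1 : x.1 ∈ rad K V M) (h2 : x.2 ∈ rad K V N) :
    x ∈ rad K V (M × N) := by
  have := add_mem (map_mem_rad (LinearMap.inl (AlgOp K V) M N) h1)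
    (map_mem_rad (LinearMap.inr (AlgOp K V) M N) h2)
  simpa using this

variable [∀ i j : V, Finite (i ⟶ j)]

theorem exists_cover_of_arrowsVanish (N : ModuleCat.{u} (AlgOp K V))
    (hfin : Module.Finite (AlgOp K V) N) (hN : ArrowsVanish K V N) :
    ∃ (P : ModuleCat.{u} (AlgOp K V)) (f : P →ₗ[AlgOp K V] N), Module.Projective (AlgOp K V) P ∧
      Module.Finite (AlgOp K V) P ∧ Function.Surjective f ∧ LinearMap.ker f ≤ rad K V P := by
  refine arrowsVanish_induction (C := fun N => ∃ (P : ModuleCat.{u} (AlgOp K V))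
    (f : P →ₗ[AlgOp K V] N), Module.Projective (AlgOp K V) P ∧ Module.Finite (AlgOp K V) P ∧
    Function.Surjective f ∧ LinearMap.ker f ≤ rad K V P) ?_ ?_ N hfin hN
  · intro N hN
    refine ⟨N, LinearMap.id, inferInstance, inferInstance, Function.surjective_id, ?_⟩
    rw [LinearMap.ker_id]
    exact bot_le
  · rintro N N' v _ _ ⟨P, f, hP, hPf, hf, hk⟩ e
    refine ⟨ModuleCat.of _ (P × Proj K v),
      e.symm.toLinearMap.comp (LinearMap.prodMap f (projCover v)), ?_, ?_, ?_, ?_⟩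
    · exact inferInstanceAs (Module.Projective (AlgOp K V) (P × Proj K v))
    · exact inferInstanceAs (Module.Finite (AlgOp K V) (P × Proj K v))
    · exact e.symm.surjective.comp (Function.Surjective.prodMap hf (projCover_surjective v))
    · intro x hx
      have h1 : e.symm (f x.1, projCover v x.2) = 0 := hx
      rw [LinearEquiv.map_eq_zero_iff, Prod.mk_eq_zero] at h1
      exact prod_mem_rad (hk h1.1) (ker_projCover_le v h1.2)

/-- Finitely generated modules have projective covers. -/
theorem exists_cover (N : ModuleCat.{u} (AlgOp K V)) (hfin : Module.Finite (AlgOp K V) N) :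
    ∃ (P : ModuleCat.{u} (AlgOp K V)) (f : P →ₗ[AlgOp K V] N), Module.Projective (AlgOp K V) P ∧
      Module.Finite (AlgOp K V) P ∧ Function.Surjective f ∧ LinearMap.ker f ≤ rad K V P := by
  obtain ⟨P, p, hP, hPf, hp, hk⟩ := exists_cover_of_arrowsVanish
    (ModuleCat.of (AlgOp K V) (N ⧸ rad K V N))
    (inferInstanceAs (Module.Finite (AlgOp K V) (N ⧸ rad K V N)))
    (arrowsVanish_quotient (M := N) le_rfl)
  -- The cover of the semisimple top N/NJ lifts to N; Nakayama makes the lift surjective.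
  obtain ⟨f, hf⟩ := Module.projective_lifting_property (rad K V N).mkQ p
    (Submodule.mkQ_surjective _)
  refine ⟨P, f, hP, hPf, ?_, fun x hx => hk ?_⟩
  · rw [← LinearMap.range_eq_top]
    refine eq_top_of_sup_rad (eq_top_iff.2 fun y _ => ?_)
    obtain ⟨x, hx⟩ := hp ((rad K V N).mkQ y)
    refine Submodule.mem_sup.2 ⟨f x, ⟨x, rfl⟩, y - f x, ?_, by abel⟩
    rw [← Submodule.ker_mkQ (rad K V N), LinearMap.mem_ker, map_sub, ← hx, ← hf]
    exact sub_self _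
  · rw [LinearMap.mem_ker, ← hf, LinearMap.comp_apply, LinearMap.mem_ker.1 hx, map_zero]

end Projective

/-! ### Injective envelopes of semisimple modules -/

section Injective

variable (K : Type u) [Field K] {V : Type u} [Quiver.{u} V] [Fintype V]

/-- The linear functionals `l` on `A` with `l (e_v s) = l s`. -/
def injFunctionals (v : V) : Submodule K (AlgOp K V →ₗ[K] K) where
  carrier := {l | ∀ s, l (oe K v * s) = l s}
  zero_mem' := fun _ => rfl
  add_mem' := fun {l m} hl hm s => by
    change l _ + m _ = l s + m s
    rw [hl, hm]
  smul_mem' := fun c l hl s => by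
    change c • l _ = c • l s
    rw [hl]

/-- The indecomposable injective module `D (A e_v)`. -/
def Inj (v : V) : Type u := injFunctionals K v

variable (v : V)

noncomputable instance : AddCommGroup (Inj K v) :=
  inferInstanceAs (AddCommGroup (injFunctionals K v))

noncomputable instance : Module K (Inj K v) := inferInstanceAs (Module K (injFunctionals K v))

variable {K v}

/-- The linear functional belonging to an element of `D (A e_v)`. -/
def Inj.functional (l : Inj K v) : AlgOp K V →ₗ[K] K := Subtype.val (show injFunctionals K v from l)

@[ext] theorem Inj.ext {l m : Inj K v} (h : ∀ s, l.functional s = m.functional s) : l = m :=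
  Subtype.ext (LinearMap.ext h)

theorem Inj.functional_oe_mul (l : Inj K v) (s : AlgOp K V) :
    l.functional (oe K v * s) = l.functional s :=
  Subtype.prop (show injFunctionals K v from l) s

theorem Inj.functional_add (l m : Inj K v) (s : AlgOp K V) :
    (l + m).functional s = l.functional s + m.functional s := rfl

theorem Inj.functional_smul_left (c : K) (l : Inj K v) (s : AlgOp K V) :
    (c • l).functional s = c * l.functional s := rfl

/-- An element of `D (A e_v)` given by a functional. -/
def Inj.mk (l : AlgOp K V →ₗ[K] K) (hl : ∀ s, l (oe K v * s) = l s) : Inj K v :=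
  (⟨l, hl⟩ : injFunctionals K v)

@[simp] theorem Inj.functional_mk (l : AlgOp K V →ₗ[K] K) (hl : ∀ s, l (oe K v * s) = l s)
    (s : AlgOp K V) : (Inj.mk l hl).functional s = l s := rfl

noncomputable instance : SMul (AlgOp K V) (Inj K v) :=
  ⟨fun r l => Inj.mk (l.functional.comp (LinearMap.mulRight K r)) fun s => by
    simp only [LinearMap.comp_apply, LinearMap.mulRight_apply]
    rw [mul_assoc, l.functional_oe_mul]⟩

theorem Inj.functional_smul (r : AlgOp K V) (l : Inj K v) (s : AlgOp K V) :
    (r • l).functional s = l.functional (s * r) := rfl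

noncomputable instance : Module (AlgOp K V) (Inj K v) where
  one_smul l := Inj.ext fun s => by rw [Inj.functional_smul, mul_one]
  mul_smul r r' l := Inj.ext fun s => by
    rw [Inj.functional_smul, Inj.functional_smul, Inj.functional_smul, mul_assoc]
  smul_zero _ := rfl
  smul_add _ _ _ := rfl
  add_smul r r' l := Inj.ext fun s => by
    rw [Inj.functional_add, Inj.functional_smul, Inj.functional_smul, Inj.functional_smul,
      mul_add, map_add]
  zero_smul l := Inj.ext fun s => by
    rw [Inj.functional_smul, mul_zero, map_zero]; rfl

instance : IsScalarTower K (AlgOp K V) (Inj K v) := ⟨fun c r l => Inj.ext fun s => by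
  rw [Inj.functional_smul, Inj.functional_smul_left, Inj.functional_smul, mul_smul_comm, map_smul,
    smul_eq_mul]⟩

/-- A map g into D(A e_v) is determined by the functional x ↦ g(x)(1), since g(x)(s) = g(s x)(1).
Functionals extend over the field K, and inserting e_v puts the extension into the required
subspace. -/
theorem injective_inj (v : V) : Module.Injective (AlgOp K V) (Inj K v) where
  out X Y _ _ _ _ f hf g := by
    let _ : Module K X := Module.compHom X (algebraMap K (AlgOp K V))
    let _ : Module K Y := Module.compHom Y (algebraMap K (AlgOp K V))
    have _ : IsScalarTower K (AlgOp K V) X := ⟨fun c r x => by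
      rw [Algebra.smul_def, mul_smul]; rfl⟩
    have _ : IsScalarTower K (AlgOp K V) Y := ⟨fun c r x => by
      rw [Algebra.smul_def, mul_smul]; rfl⟩
    let p : X →ₗ[K] K :=
      { toFun := fun x => (g x).functional 1
        map_add' := fun x y => by rw [map_add, Inj.functional_add]
        map_smul' := fun c x => by
          have h : c • x = algebraMap K (AlgOp K V) c • x := rfl
          rw [h, map_smul, algebraMap_smul, Inj.functional_smul_left]; rfl }
    let f' : X →ₗ[K] Y := f.restrictScalars K
    obtain ⟨t, ht⟩ := LinearMap.exists_leftInverse_of_injective f' (LinearMap.ker_eq_bot.2 hf)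
    let q : Y →ₗ[K] K := p.comp t
    have hq : ∀ x, q (f x) = (g x).functional 1 := fun x => by
      change p (t (f' x)) = p x
      have := LinearMap.congr_fun ht x
      rw [LinearMap.comp_apply] at this
      rw [this]; rfl
    refine ⟨{ toFun := fun y => Inj.mk
                (q.comp ((LinearMap.toSpanSingleton (AlgOp K V) Y y).restrictScalars K |>.comp
                  (LinearMap.mulLeft K (oe K v)))) fun s => ?_
              map_add' := fun y z => Inj.ext fun s => ?_
              map_smul' := fun r y => Inj.ext fun s => ?_ }, fun x => Inj.ext fun s => ?_⟩
    · change q ((oe K v * (oe K v * s)) • y) = q ((oe K v * s) • y)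
      rw [← mul_assoc, oe_mul_oe_self]
    · change q ((oe K v * s) • (y + z)) = q ((oe K v * s) • y) + q ((oe K v * s) • z)
      rw [smul_add, map_add]
    · change q ((oe K v * s) • r • y) = q ((oe K v * (s * r)) • y)
      rw [smul_smul, mul_assoc]
    · change q ((oe K v * s) • f x) = _
      rw [← map_smul, hq, map_smul, Inj.functional_smul, one_mul, Inj.functional_oe_mul]

/-- The injective envelope of `S_v`. -/
noncomputable def injEnvelope (v : V) : Simp K V v →ₗ[AlgOp K V] Inj K v where
  toFun t := Inj.mk ((show K from t) • (chi K v).toLinearMap) fun s => by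
    change (show K from t) * chi K v (oe K v * s) = (show K from t) * chi K v s
    rw [map_mul, chi_oe_self, one_mul]
  map_add' x y := Inj.ext fun s => add_mul (show K from x) (show K from y) (chi K v s)
  map_smul' r x := Inj.ext fun s => by
    change chi K v r * (show K from x) * chi K v s = (show K from x) * chi K v (s * r)
    rw [map_mul]
    ring

theorem injEnvelope_injective (v : V) : Function.Injective (injEnvelope (K := K) v) := by
  intro x y h
  have h1 : (show K from x) * chi K v 1 = (show K from y) * chi K v 1 :=
    congrArg (fun l => l.functional 1) h
  rw [map_one, mul_one, mul_one] at h1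
  exact h1

/-- A functional in the socle vanishes on all arrows, so it is a multiple of χ_v. -/
theorem soc_inj_le (v : V) : soc K V (Inj K v) ≤ LinearMap.range (injEnvelope (K := K) v) := by
  intro l hl
  have h1 : ∀ r ∈ arrowSpan K V, l.functional r = 0 := fun r hr => by
    have h2 : r • l = 0 := arrowSpan_smul hr hl
    rw [← one_mul r, ← Inj.functional_smul, h2]; rfl
  refine ⟨(l.functional 1 : K), Inj.ext fun s => ?_⟩
  change l.functional 1 * chi K v s = l.functional s
  have h3 : oe K v * s - chi K v s • oe K v ∈ arrowSpan K V := mem_arrowSpan.2 fun w => by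
    rw [map_sub, map_mul, map_smul, smul_eq_mul]
    by_cases hw : v = w
    · subst hw; rw [mul_comm, sub_self]
    · rw [chi_oe_of_ne hw, zero_mul, mul_zero, sub_self]
  have h4 := h1 _ h3
  rw [map_sub, Inj.functional_oe_mul, map_smul, sub_eq_zero, ← mul_one (oe K v),
    Inj.functional_oe_mul, smul_eq_mul] at h4
  rw [h4]
  exact mul_comm _ _

theorem injective_prod {I I' : Type u} [AddCommGroup I] [Module (AlgOp K V) I] [AddCommGroup I']
    [Module (AlgOp K V) I'] (h : Module.Injective (AlgOp K V) I)
    (h' : Module.Injective (AlgOp K V) I') : Module.Injective (AlgOp K V) (I × I') where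
  out X Y _ _ _ _ f hf g := by
    obtain ⟨k, hk⟩ := h.out f hf ((LinearMap.fst _ _ _).comp g)
    obtain ⟨k', hk'⟩ := h'.out f hf ((LinearMap.snd _ _ _).comp g)
    exact ⟨k.prod k', fun x => Prod.ext (hk x) (hk' x)⟩

variable [∀ i j : V, Finite (i ⟶ j)]

instance : Module.Finite K (AlgOp K V) :=
  Module.Finite.equiv (MulOpposite.opLinearEquiv K (M := Alg K V))

instance : Module.Finite (AlgOp K V) (Inj K v) := by
  have : Module.Finite K (Inj K v) := inferInstanceAs (Module.Finite K (injFunctionals K v))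
  exact Module.Finite.of_restrictScalars_finite K _ _

theorem exists_envelope_of_arrowsVanish (N : ModuleCat.{u} (AlgOp K V))
    (hfin : Module.Finite (AlgOp K V) N) (hN : ArrowsVanish K V N) :
    ∃ (I : ModuleCat.{u} (AlgOp K V)) (f : N →ₗ[AlgOp K V] I), Module.Injective (AlgOp K V) I ∧
      Module.Finite (AlgOp K V) I ∧ Function.Injective f ∧
      soc K V I ≤ LinearMap.range f := by
  refine arrowsVanish_induction (C := fun N => ∃ (I : ModuleCat.{u} (AlgOp K V))
    (f : N →ₗ[AlgOp K V] I), Module.Injective (AlgOp K V) I ∧ Module.Finite (AlgOp K V) I ∧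
    Function.Injective f ∧ soc K V I ≤ LinearMap.range f) ?_ ?_ N hfin hN
  · intro N hN
    refine ⟨N, LinearMap.id, ⟨fun X Y _ _ _ _ f _ g => ⟨0, fun x => Subsingleton.elim _ _⟩⟩,
      inferInstance, Function.injective_id, ?_⟩
    rw [LinearMap.range_id]
    exact le_top
  · rintro N N' v _ _ ⟨I, f, hI, hIf, hf, hk⟩ e
    refine ⟨ModuleCat.of _ (I × Inj K v),
      (LinearMap.prodMap f (injEnvelope v)).comp e.toLinearMap, injective_prod hI (injective_inj v),
      inferInstanceAs (Module.Finite (AlgOp K V) (I × Inj K v)), ?_, ?_⟩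
    · exact (Function.Injective.prodMap hf (injEnvelope_injective v)).comp e.injective
    · intro x hx
      obtain ⟨y, hy⟩ := hk (fun i j a => congrArg Prod.fst (hx i j a) : x.1 ∈ soc K V I)
      obtain ⟨z, hz⟩ := soc_inj_le v
        (fun i j a => congrArg Prod.snd (hx i j a) : x.2 ∈ soc K V (Inj K v))
      refine ⟨e.symm (y, z), ?_⟩
      change LinearMap.prodMap f (injEnvelope v) (e (e.symm (y, z))) = x
      rw [LinearEquiv.apply_symm_apply]
      exact Prod.ext hy hz

end Injective

end RadSqZeroAlg

namespace RadSqZeroAlg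

open IgusaTodorov CategoryTheory

/-! ### Walks in the quiver -/

section Walk

/-- There is a path of length `n` from `v` to `w`. -/
def Walk {V : Type u} [Quiver.{u} V] : ℕ → V → V → Prop
  | 0, v, w => v = w
  | n + 1, v, w => ∃ x, Walk n v x ∧ Nonempty (x ⟶ w)

variable {V : Type u} [Quiver.{u} V]

theorem Walk.trans {m n : ℕ} {v w x : V} (h : Walk m v w) (h' : Walk n w x) :
    Walk (m + n) v x := by
  induction n generalizing x with
  | zero => obtain rfl : w = x := h'; exact h
  | succ n ih => obtain ⟨y, hy, ha⟩ := h'; exact ⟨y, ih hy, ha⟩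

theorem walk_one {v w : V} (h : Nonempty (v ⟶ w)) : Walk 1 v w := ⟨v, rfl, h⟩

theorem walk_one_iff {v w : V} : Walk 1 v w ↔ Nonempty (v ⟶ w) :=
  ⟨fun ⟨_, h, h'⟩ => by obtain rfl := h; exact h', walk_one⟩

theorem walk_add {m n : ℕ} {v w : V} : Walk (m + n) v w ↔ ∃ x, Walk m v x ∧ Walk n x w := by
  refine ⟨fun h => ?_, fun ⟨x, h, h'⟩ => h.trans h'⟩
  induction n generalizing w with
  | zero => exact ⟨w, h, rfl⟩
  | succ n ih =>
    obtain ⟨y, hy, ha⟩ := h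
    obtain ⟨x, hx, hxy⟩ := ih hy
    exact ⟨x, hx, y, hxy, ha⟩

theorem walk_succ_iff {n : ℕ} {v w : V} :
    Walk (n + 1) v w ↔ ∃ x, Nonempty (v ⟶ x) ∧ Walk n x w := by
  rw [add_comm, walk_add]
  simp only [walk_one_iff]

end Walk

variable {K : Type u} [Field K] {V : Type u} [Quiver.{u} V] [Fintype V]

/-! ### Iterated syzygies and walks -/

section Syzygy

variable {M N : ModuleCat.{u} (AlgOp K V)}

theorem isSyzygy_of_cover {P : ModuleCat.{u} (AlgOp K V)} (hP : Module.Projective (AlgOp K V) P)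
    (f : P →ₗ[AlgOp K V] M) (hf : Function.Surjective f) (hk : LinearMap.ker f ≤ rad K V P)
    (e : LinearMap.ker f ≃ₗ[AlgOp K V] N) : IsSyzygy (AlgOp K V) M N :=
  ⟨P, f, hP, hf, fun _ hU => eq_top_of_sup_rad
    (top_le_iff.1 (hU ▸ sup_le_sup_left hk _)), ⟨e⟩⟩

theorem exists_cover_of_isSyzygy (h : IsSyzygy (AlgOp K V) M N) :
    ∃ (P : ModuleCat.{u} (AlgOp K V)) (f : P →ₗ[AlgOp K V] M), Module.Projective (AlgOp K V) P ∧
      Function.Surjective f ∧ LinearMap.ker f ≤ rad K V P ∧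
      Nonempty (LinearMap.ker f ≃ₗ[AlgOp K V] N) := by
  obtain ⟨P, f, hP, hf, hs, e⟩ := h
  exact ⟨P, f, hP, hf, le_rad_of_superfluous _ hs, e⟩

theorem arrowsVanish_of_isSyzygy (h : IsSyzygy (AlgOp K V) M N) : ArrowsVanish K V N := by
  obtain ⟨P, f, -, -, hk, ⟨e⟩⟩ := exists_cover_of_isSyzygy h
  exact (arrowsVanish_of_le_soc (hk.trans rad_le_soc)).of_surjective e.toLinearMap e.surjective

theorem supp_of_isSyzygy (h : IsSyzygy (AlgOp K V) M N) (hM : ArrowsVanish K V M) (w : V) :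
    Supp K V N w ↔ ∃ v, Nonempty (v ⟶ w) ∧ Supp K V M v := by
  obtain ⟨P, f, hP, hf, hk, ⟨e⟩⟩ := exists_cover_of_isSyzygy h
  rw [← supp_iff_of_equiv e, supp_ker_iff hf hM hk]

theorem finite_of_isSyzygy [∀ i j : V, Finite (i ⟶ j)] (h : IsSyzygy (AlgOp K V) M N)
    (hM : Module.Finite (AlgOp K V) M) :
    Module.Finite (AlgOp K V) N := by
  obtain ⟨P, f, hP, hf, hs, ⟨e⟩⟩ := h
  have hfin : Module.Finite (AlgOp K V) P := by
    obtain ⟨n, t, ht⟩ := Module.Finite.exists_fin' (AlgOp K V) M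
    obtain ⟨l, hl⟩ := Module.projective_lifting_property f t hf
    have hr : LinearMap.range l = ⊤ := by
      refine hs _ (eq_top_iff.2 fun x _ => ?_)
      obtain ⟨y, hy⟩ := ht (f x)
      have h1 : f (l y) = f x := by rw [← hy, ← hl]; rfl
      refine Submodule.mem_sup.2 ⟨l y, ⟨y, rfl⟩, x - l y, ?_, by abel⟩
      rw [LinearMap.mem_ker, map_sub, h1, sub_self]
    exact Module.Finite.of_surjective l (LinearMap.range_eq_top.1 hr)
  exact Module.Finite.equiv e

theorem exists_isSyzygy [∀ i j : V, Finite (i ⟶ j)] (M : ModuleCat.{u} (AlgOp K V))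
    (hM : Module.Finite (AlgOp K V) M) :
    ∃ N, IsSyzygy (AlgOp K V) M N := by
  obtain ⟨P, f, hP, -, hf, hk⟩ := exists_cover M hM
  exact ⟨ModuleCat.of _ (LinearMap.ker f), isSyzygy_of_cover hP f hf hk (LinearEquiv.refl _ _)⟩

theorem finite_of_isNthSyzygy [∀ i j : V, Finite (i ⟶ j)] {n : ℕ}
    (h : IsNthSyzygy (AlgOp K V) n M N)
    (hM : Module.Finite (AlgOp K V) M) : Module.Finite (AlgOp K V) N := by
  induction n generalizing N with
  | zero =>
    obtain ⟨e⟩ := h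
    exact Module.Finite.equiv e
  | succ n ih =>
    obtain ⟨L, hL, h⟩ := h
    exact finite_of_isSyzygy h (ih hL)

theorem exists_isNthSyzygy [∀ i j : V, Finite (i ⟶ j)] (n : ℕ) (M : ModuleCat.{u} (AlgOp K V))
    (hM : Module.Finite (AlgOp K V) M) : ∃ N, IsNthSyzygy (AlgOp K V) n M N := by
  induction n with
  | zero => exact ⟨M, ⟨LinearEquiv.refl _ _⟩⟩
  | succ n ih =>
    obtain ⟨L, hL⟩ := ih
    obtain ⟨N, hN⟩ := exists_isSyzygy L (finite_of_isNthSyzygy hL hM)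
    exact ⟨N, L, hL, hN⟩

theorem arrowsVanish_of_isNthSyzygy {n : ℕ} (h : IsNthSyzygy (AlgOp K V) n M N)
    (hM : ArrowsVanish K V M) : ArrowsVanish K V N := by
  cases n with
  | zero =>
    obtain ⟨e⟩ := h
    exact hM.of_surjective e.toLinearMap e.surjective
  | succ n =>
    obtain ⟨L, _, h⟩ := h
    exact arrowsVanish_of_isSyzygy h

theorem supp_of_isNthSyzygy {n : ℕ} (h : IsNthSyzygy (AlgOp K V) n M N)
    (hM : ArrowsVanish K V M) (w : V) :
    Supp K V N w ↔ ∃ v, Supp K V M v ∧ Walk n v w := by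
  induction n generalizing N w with
  | zero =>
    obtain ⟨e⟩ := h
    rw [← supp_iff_of_equiv e]
    exact ⟨fun h => ⟨w, h, rfl⟩, fun ⟨v, h, hvw⟩ => by obtain rfl : v = w := hvw; exact h⟩
  | succ n ih =>
    obtain ⟨L, hL, h⟩ := h
    rw [supp_of_isSyzygy h (arrowsVanish_of_isNthSyzygy hL hM)]
    constructor
    · rintro ⟨x, ha, hx⟩
      obtain ⟨v, hv, hvx⟩ := (ih hL x).1 hx
      exact ⟨v, hv, x, hvx, ha⟩
    · rintro ⟨v, hv, x, hvx, ha⟩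
      exact ⟨x, ha, (ih hL x).2 ⟨v, hv, hvx⟩⟩

/-- Here M need not be semisimple. Only its first syzygy is, which costs one step: n + 1 syzygies
yield a walk of length n. -/
theorem exists_walk_of_isNthSyzygy {n : ℕ} (h : IsNthSyzygy (AlgOp K V) (n + 1) M N) {w : V}
    (hw : Supp K V N w) : ∃ v, Walk n v w := by
  induction n generalizing N w with
  | zero => exact ⟨w, rfl⟩
  | succ n ih =>
    obtain ⟨L, hL, h⟩ := h
    have hL' : ArrowsVanish K V L := by
      obtain ⟨L', _, h⟩ := hL
      exact arrowsVanish_of_isSyzygy h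
    obtain ⟨x, ha, hx⟩ := (supp_of_isSyzygy h hL' w).1 hw
    obtain ⟨v, hv⟩ := ih hL hx
    exact ⟨v, x, hv, ha⟩

end Syzygy

/-! ### Iterated cosyzygies and walks -/

section Cosyzygy

variable {M N : ModuleCat.{u} (AlgOp K V)}

theorem arrowsVanish_and_supp_of_isCosyzygy (h : IsCosyzygy (AlgOp K V) M N)
    (hM : ArrowsVanish K V M) : ArrowsVanish K V N ∧
      ∀ w, Supp K V N w ↔ ∃ v, Nonempty (w ⟶ v) ∧ Supp K V M v := by
  obtain ⟨I, f, hI, hf, hs, ⟨e⟩⟩ := h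
  have hk : soc K V I ≤ LinearMap.range f := soc_le_of_essential _ hs
  refine ⟨(arrowsVanish_coker hk).of_surjective e.toLinearMap e.surjective, fun w => ?_⟩
  rw [← supp_iff_of_equiv e, supp_coker_iff hI hf hM hk]

theorem arrowsVanish_and_supp_of_isNthCosyzygy {n : ℕ} (h : IsNthCosyzygy (AlgOp K V) n M N)
    (hM : ArrowsVanish K V M) : ArrowsVanish K V N ∧
      ∀ w, Supp K V N w ↔ ∃ v, Supp K V M v ∧ Walk n w v := by
  induction n generalizing N with
  | zero =>
    obtain ⟨e⟩ := h
    refine ⟨hM.of_surjective e.toLinearMap e.surjective, fun w => ?_⟩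
    rw [← supp_iff_of_equiv e]
    exact ⟨fun h => ⟨w, h, rfl⟩, fun ⟨v, h, hvw⟩ => by obtain rfl : w = v := hvw; exact h⟩
  | succ n ih =>
    obtain ⟨L, hL, h⟩ := h
    obtain ⟨h1, h2⟩ := ih hL
    obtain ⟨h3, h4⟩ := arrowsVanish_and_supp_of_isCosyzygy h h1
    refine ⟨h3, fun w => ?_⟩
    rw [h4]
    constructor
    · rintro ⟨x, ha, hx⟩
      obtain ⟨v, hv, hvx⟩ := (h2 x).1 hx
      exact ⟨v, hv, walk_succ_iff.2 ⟨x, ha, hvx⟩⟩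
    · rintro ⟨v, hv, hwv⟩
      obtain ⟨x, ha, hxv⟩ := walk_succ_iff.1 hwv
      exact ⟨x, ha, (h2 x).2 ⟨v, hv, hxv⟩⟩

variable [∀ i j : V, Finite (i ⟶ j)]

theorem exists_isNthCosyzygy (n : ℕ) (M : ModuleCat.{u} (AlgOp K V))
    (hM : Module.Finite (AlgOp K V) M) (hM' : ArrowsVanish K V M) :
    ∃ N, IsNthCosyzygy (AlgOp K V) n M N ∧ Module.Finite (AlgOp K V) N := by
  induction n with
  | zero => exact ⟨M, ⟨LinearEquiv.refl _ _⟩, hM⟩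
  | succ n ih =>
    obtain ⟨L, hL, hLf⟩ := ih
    obtain ⟨I, f, hI, hIf, hf, hk⟩ := exists_envelope_of_arrowsVanish L hLf
      (arrowsVanish_and_supp_of_isNthCosyzygy hL hM').1
    refine ⟨ModuleCat.of _ (I ⧸ LinearMap.range f), ⟨L, hL, I, f, hI, hf, fun U hU => ?_,
      ⟨LinearEquiv.refl _ _⟩⟩, inferInstanceAs (Module.Finite (AlgOp K V) (I ⧸ LinearMap.range f))⟩
    exact eq_bot_of_inf_soc (le_bot_iff.1 (hU ▸ inf_le_inf_left _ hk))

end Cosyzygy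

/-! ### Combinatorial description of the heart -/

section Heart

theorem arrowsVanish_A0 : ArrowsVanish K V (A0 K V) := fun i j a x => by
  obtain ⟨r, rfl⟩ := Submodule.Quotient.mk_surjective (radical K V) x
  refine (Submodule.Quotient.mk_eq_zero (radical K V) (x := oa K a • r)).2 ?_
  refine mem_radical.2 fun v => ?_
  rw [smul_eq_mul, map_mul, chi_oa, zero_mul]

theorem supp_A0 (v : V) : Supp K V (A0 K V) v := by
  refine ⟨Submodule.Quotient.mk (p := radical K V) 1, fun h => ?_⟩
  have h1 := (Submodule.Quotient.mk_eq_zero (radical K V) (x := oe K v • (1 : AlgOp K V))).1 h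
  have h2 := mem_radical.1 h1 v
  rw [smul_eq_mul, mul_one, chi_oe_self] at h2
  exact one_ne_zero h2

/-- Every simple occurs in A₀, so the supports in question are the end points and the starting
points of all walks of length n. -/
theorem mem_heart_iff [∀ i j : V, Finite (i ⟶ j)] (v : V) :
    v ∈ heart K V ↔ (∃ x, Walk (Fintype.card V) x v) ∧ ∃ x, Walk (Fintype.card V) v x := by
  have hfin : Module.Finite (AlgOp K V) (A0 K V) :=
    inferInstanceAs (Module.Finite (AlgOp K V) (AlgOp K V ⧸ radical K V))
  constructor
  · rintro ⟨⟨N, hN, hv⟩, N', hN', hv'⟩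
    obtain ⟨x, -, hx⟩ := (supp_of_isNthSyzygy hN arrowsVanish_A0 v).1 hv
    obtain ⟨y, -, hy⟩ := ((arrowsVanish_and_supp_of_isNthCosyzygy hN' arrowsVanish_A0).2 v).1 hv'
    exact ⟨⟨x, hx⟩, y, hy⟩
  · rintro ⟨⟨x, hx⟩, y, hy⟩
    obtain ⟨N, hN⟩ := exists_isNthSyzygy (Fintype.card V) (A0 K V) hfin
    obtain ⟨N', hN', -⟩ := exists_isNthCosyzygy (Fintype.card V) (A0 K V) hfin arrowsVanish_A0
    exact ⟨⟨N, hN, (supp_of_isNthSyzygy hN arrowsVanish_A0 v).2 ⟨x, supp_A0 x, hx⟩⟩,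
      N', hN', ((arrowsVanish_and_supp_of_isNthCosyzygy hN' arrowsVanish_A0).2 v).2
        ⟨y, supp_A0 y, hy⟩⟩

end Heart

/-! ### Projective dimension of semisimple modules -/

section ProjectiveDimension

/-- The kernel of the projective cover is supported on the successors of the support, so it vanishes
exactly when the support consists of sinks. -/
theorem projective_iff_of_arrowsVanish [∀ i j : V, Finite (i ⟶ j)]
    (X : ModuleCat.{u} (AlgOp K V)) (hfin : Module.Finite (AlgOp K V) X)
    (hX : ArrowsVanish K V X) :
    Module.Projective (AlgOp K V) X ↔ ∀ v w, Supp K V X v → IsEmpty (v ⟶ w) := by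
  constructor
  · rintro h v w ⟨x, hx⟩
    refine ⟨fun a => hx ?_⟩
    have := oe_smul_mem_rad_of_projective a (hX v w a x)
    rwa [hX.rad_eq_bot, Submodule.mem_bot] at this
  · intro h
    obtain ⟨P, f, hP, -, hf, hk⟩ := exists_cover X hfin
    have : Subsingleton (LinearMap.ker f) := by
      by_contra hne
      rw [not_subsingleton_iff_nontrivial] at hne
      obtain ⟨w, hw⟩ := exists_supp (K := K) (V := V) (M := LinearMap.ker f)
      obtain ⟨v, ⟨a⟩, hv⟩ := (supp_ker_iff hf hX hk w).1 hw
      exact (h v w hv).false a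
    rw [Submodule.subsingleton_iff_eq_bot, LinearMap.ker_eq_bot] at this
    exact Module.Projective.of_equiv (LinearEquiv.ofBijective f ⟨this, hf⟩)

/-- Dimension shift along a projective cover. -/
theorem hasProjectiveDimensionLE_succ_iff {P X : ModuleCat.{u} (AlgOp K V)}
    (hP : Module.Projective (AlgOp K V) P) (f : P →ₗ[AlgOp K V] X) (hf : Function.Surjective f)
    (k : ℕ) : HasProjectiveDimensionLE X (k + 1) ↔
      HasProjectiveDimensionLE (ModuleCat.of (AlgOp K V) (LinearMap.ker f)) k :=
  (LinearMap.shortExact_shortComplexKer hf).hasProjectiveDimensionLT_X₃_iff k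
    P.projective_of_categoryTheory_projective

theorem hasProjectiveDimensionLE_zero_iff (X : ModuleCat.{u} (AlgOp K V)) :
    HasProjectiveDimensionLE X 0 ↔ Module.Projective (AlgOp K V) X := by
  rw [← projective_iff_hasProjectiveDimensionLE_zero]
  exact (IsProjective.iff_projective X).symm

/-- The projective dimension of a semisimple module is the maximal length of a path starting in
its support. -/
theorem hasProjectiveDimensionLE_iff [∀ i j : V, Finite (i ⟶ j)] (k : ℕ)
    (X : ModuleCat.{u} (AlgOp K V)) (hfin : Module.Finite (AlgOp K V) X)
    (hX : ArrowsVanish K V X) :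
    HasProjectiveDimensionLE X k ↔ ∀ v w, Supp K V X v → ¬ Walk (k + 1) v w := by
  induction k generalizing X with
  | zero =>
    rw [hasProjectiveDimensionLE_zero_iff, projective_iff_of_arrowsVanish X hfin hX]
    simp only [zero_add, walk_one_iff, not_nonempty_iff]
  | succ k ih =>
    obtain ⟨P, f, hP, hPf, hf, hk⟩ := exists_cover X hfin
    rw [hasProjectiveDimensionLE_succ_iff hP f hf, ih (ModuleCat.of _ (LinearMap.ker f))
      inferInstance (arrowsVanish_of_le_soc (hk.trans rad_le_soc))]
    constructor
    · intro h v w hv hw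
      obtain ⟨x, ha, hx⟩ := walk_succ_iff.1 hw
      exact h x w ((supp_ker_iff hf hX hk x).2 ⟨v, ha, hv⟩) hx
    · intro h x w hx hw
      obtain ⟨v, ha, hv⟩ := (supp_ker_iff hf hX hk x).1 hx
      exact h v w hv (walk_succ_iff.2 ⟨x, ha, hw⟩)

theorem exists_walk_of_projectiveDimension_eq [∀ i j : V, Finite (i ⟶ j)] {k : ℕ}
    (X : ModuleCat.{u} (AlgOp K V)) (hfin : Module.Finite (AlgOp K V) X)
    (hX : ArrowsVanish K V X) (hk : projectiveDimension X = ((k : ℕ∞) : WithBot ℕ∞)) :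
    ∃ v w, Supp K V X v ∧ Walk k v w ∧ ∀ x, ¬ Walk (k + 1) v x := by
  have h1 := (hasProjectiveDimensionLE_iff k X hfin hX).1
    ((projectiveDimension_le_iff X k).1 hk.le)
  cases k with
  | zero =>
    -- The zero module has dimension ⊥ rather than 0.
    have : Nontrivial X := by
      by_contra hne
      rw [not_nontrivial_iff_subsingleton] at hne
      have := (projectiveDimension_eq_bot_iff X).2 (ModuleCat.isZero_of_subsingleton X)
      rw [this] at hk
      exact absurd hk (by simp)
    obtain ⟨v, hv⟩ := exists_supp (K := K) (V := V) (M := X)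
    exact ⟨v, v, hv, rfl, fun x => h1 v x hv⟩
  | succ k =>
    have h2 : ¬ HasProjectiveDimensionLE X k :=
      (projectiveDimension_ge_iff X (k + 1)).1 hk.ge
    rw [hasProjectiveDimensionLE_iff k X hfin hX] at h2
    push Not at h2
    obtain ⟨v, w, hv, hw⟩ := h2
    exact ⟨v, w, hv, hw, fun x => h1 v x hv⟩

theorem projectiveDimension_simp_eq [∀ i j : V, Finite (i ⟶ j)] {k : ℕ} {v : V}
    (h : ∃ w, Walk k v w) (h' : ∀ w, ¬ Walk (k + 1) v w) :
    projectiveDimension (ModuleCat.of (AlgOp K V) (Simp K V v)) =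
      ((k : ℕ∞) : WithBot ℕ∞) := by
  refine le_antisymm ((projectiveDimension_le_iff _ k).2 ?_)
    ((projectiveDimension_ge_iff _ k).2 ?_)
  · rw [hasProjectiveDimensionLE_iff k _ inferInstance arrowsVanish_simp]
    intro v' w hv hw
    rw [supp_simp.1 hv] at hw
    exact h' w hw
  · obtain ⟨w, hw⟩ := h
    cases k with
    | zero =>
      intro h0
      have := isZero_of_hasProjectiveDimensionLT_zero (ModuleCat.of (AlgOp K V) (Simp K V v))
      exact not_subsingleton (Simp K V v) (ModuleCat.subsingleton_of_isZero this)
    | succ k =>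
      intro h0
      have h1 : HasProjectiveDimensionLE (ModuleCat.of (AlgOp K V) (Simp K V v)) k := h0
      rw [hasProjectiveDimensionLE_iff k _ inferInstance arrowsVanish_simp] at h1
      exact h1 v w (supp_simp.2 rfl) hw

end ProjectiveDimension

end RadSqZeroAlg

namespace RadSqZeroAlg

open IgusaTodorov CategoryTheory

/-! ### Multiplicities of simple summands as functions on K₀ -/

section Multiplicity

variable {K : Type u} [Field K] {V : Type u} [Quiver.{u} V] [Fintype V]

/-- The `S_v`-isotypic part of the socle. -/
noncomputable def isoSoc (K : Type u) [Field K] {V : Type u} [Quiver.{u} V] [Fintype V] (v : V)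
    (M : Type u) [AddCommGroup M] [Module (AlgOp K V) M] : Submodule (AlgOp K V) M where
  carrier := {x | x ∈ soc K V M ∧ oe K v • x = x}
  zero_mem' := ⟨zero_mem _, smul_zero _⟩
  add_mem' := fun hx hy => ⟨add_mem hx.1 hy.1, by rw [smul_add, hx.2, hy.2]⟩
  smul_mem' := fun r x hx => by
    refine ⟨Submodule.smul_mem _ _ hx.1, ?_⟩
    have h : oe K v * r * oe K v - r * oe K v ∈ arrowSpan K V := mem_arrowSpan.2 fun w => by
      rw [map_sub, map_mul, map_mul, map_mul]
      by_cases hw : v = w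
      · subst hw; rw [chi_oe_self]; ring
      · rw [chi_oe_of_ne hw]; ring
    have h1 := arrowSpan_smul h hx.1
    rwa [sub_smul, sub_eq_zero, mul_smul, mul_smul, mul_smul, hx.2] at h1

/-- The `S_v`-isotypic part of the socle modulo the radical; its length is the multiplicity of
`S_v` as a direct summand. -/
abbrev IsoTop (K : Type u) [Field K] {V : Type u} [Quiver.{u} V] [Fintype V] (v : V)
    (M : Type u) [AddCommGroup M] [Module (AlgOp K V) M] : Type u :=
  isoSoc K v M ⧸ (rad K V M).comap (isoSoc K v M).subtype

variable {M M' M'' : Type u} [AddCommGroup M] [Module (AlgOp K V) M] [AddCommGroup M']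
  [Module (AlgOp K V) M'] [AddCommGroup M''] [Module (AlgOp K V) M'']

theorem map_mem_isoSoc (v : V) (f : M →ₗ[AlgOp K V] M') {x : M} (hx : x ∈ isoSoc K v M) :
    f x ∈ isoSoc K v M' :=
  ⟨fun i j a => by rw [← map_smul, hx.1 i j a, map_zero], by rw [← map_smul, hx.2]⟩

theorem prod_mem_isoSoc (v : V) {x : M'} {y : M''} (hx : x ∈ isoSoc K v M')
    (hy : y ∈ isoSoc K v M'') : (x, y) ∈ isoSoc K v (M' × M'') :=
  ⟨fun i j a => Prod.ext (hx.1 i j a) (hy.1 i j a), Prod.ext hx.2 hy.2⟩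

/-- The map on isotypic parts induced by a linear map. -/
noncomputable def isoTopMap (v : V) (f : M →ₗ[AlgOp K V] M') :
    isoSoc K v M →ₗ[AlgOp K V] IsoTop K v M' :=
  (Submodule.mkQ _).comp (f.restrict fun _ hx => map_mem_isoSoc v f hx)

theorem isoTopMap_eq_zero_iff (v : V) (f : M →ₗ[AlgOp K V] M') (x : isoSoc K v M) :
    isoTopMap v f x = 0 ↔ f x ∈ rad K V M' :=
  Submodule.Quotient.mk_eq_zero _

theorem nonempty_isoTop_equiv_prod (v : V) (e : M ≃ₗ[AlgOp K V] M' × M'') :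
    Nonempty (IsoTop K v M ≃ₗ[AlgOp K V] IsoTop K v M' × IsoTop K v M'') := by
  let f' : M →ₗ[AlgOp K V] M' := (LinearMap.fst _ _ _).comp e.toLinearMap
  let f'' : M →ₗ[AlgOp K V] M'' := (LinearMap.snd _ _ _).comp e.toLinearMap
  let g := (isoTopMap v f').prod (isoTopMap v f'')
  have hker : (rad K V M).comap (isoSoc K v M).subtype = LinearMap.ker g := by
    ext x
    rw [LinearMap.mem_ker, Submodule.mem_comap]
    change _ ↔ (isoTopMap v f' x, isoTopMap v f'' x) = 0
    rw [Prod.mk_eq_zero, isoTopMap_eq_zero_iff, isoTopMap_eq_zero_iff]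
    refine ⟨fun h => ⟨map_mem_rad f' h, map_mem_rad f'' h⟩, fun ⟨h1, h2⟩ => ?_⟩
    have := map_mem_rad e.symm.toLinearMap (prod_mem_rad (x := e x) h1 h2)
    rwa [LinearEquiv.coe_coe, LinearEquiv.symm_apply_apply] at this
  have hsurj : Function.Surjective g := by
    rintro ⟨p, q⟩
    obtain ⟨x, rfl⟩ := Submodule.Quotient.mk_surjective _ p
    obtain ⟨y, rfl⟩ := Submodule.Quotient.mk_surjective _ q
    refine ⟨⟨e.symm (x, y), map_mem_isoSoc v e.symm.toLinearMap (prod_mem_isoSoc v x.2 y.2)⟩, ?_⟩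
    refine Prod.ext (congrArg Submodule.Quotient.mk (Subtype.ext ?_))
      (congrArg Submodule.Quotient.mk (Subtype.ext ?_))
    · change (e (e.symm (x, y))).1 = x
      rw [LinearEquiv.apply_symm_apply]
    · change (e (e.symm (x, y))).2 = y
      rw [LinearEquiv.apply_symm_apply]
  exact ⟨(Submodule.quotEquivOfEq _ _ hker).trans (g.quotKerEquivOfSurjective hsurj)⟩

variable (K) in
/-- The multiplicity of `S_v` as a direct summand of `M`. -/
noncomputable def mult (v : V) (M : Type u) [AddCommGroup M] [Module (AlgOp K V) M] : ℕ :=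
  (Module.length (AlgOp K V) (IsoTop K v M)).toNat

theorem mult_eq_zero_of_le (v : V) (h : isoSoc K v M ≤ rad K V M) : mult K v M = 0 := by
  have : Subsingleton (IsoTop K v M) := by
    rw [Submodule.Quotient.subsingleton_iff]
    exact eq_top_iff.2 fun x _ => h x.2
  rw [mult, Module.length_eq_zero, ENat.toNat_zero]

/-- At a non-sink the socle of a projective module lies in its radical. This is what lets the
multiplicity descend to K₀, where projectives are zero. -/
theorem mult_eq_zero_of_projective [Module.Projective (AlgOp K V) M] {v w : V} (a : v ⟶ w) :
    mult K v M = 0 := by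
  refine mult_eq_zero_of_le v fun x hx => ?_
  have := oe_smul_mem_rad_of_projective a (hx.1 v w a)
  rwa [hx.2] at this

theorem mult_simp_of_ne {v w : V} (h : v ≠ w) : mult K v (Simp K V w) = 0 := by
  refine mult_eq_zero_of_le v fun x hx => ?_
  have h1 := hx.2
  rw [smul_simp, chi_oe_of_ne h, zero_smul] at h1
  rw [← h1]
  exact zero_mem _

variable [∀ i j : V, Finite (i ⟶ j)]

theorem length_ne_top_of_finite (M : Type u) [AddCommGroup M] [Module (AlgOp K V) M]
    [Module.Finite (AlgOp K V) M] : Module.length (AlgOp K V) M ≠ ⊤ := by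
  have : IsArtinianRing (AlgOp K V) := IsArtinianRing.of_finite K (AlgOp K V)
  exact Module.length_ne_top

theorem mult_prod (v : V) [Module.Finite (AlgOp K V) M'] [Module.Finite (AlgOp K V) M'']
    (e : M ≃ₗ[AlgOp K V] M' × M'') : mult K v M = mult K v M' + mult K v M'' := by
  obtain ⟨g⟩ := nonempty_isoTop_equiv_prod v e
  rw [mult, g.length_eq, Module.length_prod, ENat.toNat_add (length_ne_top_of_finite _)
    (length_ne_top_of_finite _)]
  rfl

theorem mult_simp_self (v : V) : mult K v (Simp K V v) ≠ 0 := by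
  have hne : Nontrivial (IsoTop K v (Simp K V v)) := by
    rw [Submodule.Quotient.nontrivial_iff]
    obtain ⟨x, hx⟩ := exists_ne (0 : Simp K V v)
    intro h
    have h1 : (⟨x, fun i j a => arrowsVanish_simp i j a x, by
      rw [smul_simp, chi_oe_self, one_smul]⟩ : isoSoc K v (Simp K V v)) ∈
        (rad K V (Simp K V v)).comap (isoSoc K v (Simp K V v)).subtype := h ▸ Submodule.mem_top
    rw [Submodule.mem_comap, arrowsVanish_simp.rad_eq_bot, Submodule.mem_bot] at h1
    exact hx h1
  rw [mult, Ne, ENat.toNat_eq_zero, not_or]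
  exact ⟨(Module.length_pos (R := AlgOp K V) (M := IsoTop K v (Simp K V v))).ne',
    length_ne_top_of_finite _⟩

variable (K) in
/-- The multiplicity of the non-projective simple module `S_v`, as a homomorphism on `K₀`. -/
theorem exists_multHom {v w : V} (a : v ⟶ w) : ∃ f : K0 (AlgOp K V) →+ ℤ,
    ∀ M : FGModuleCat.{u} (AlgOp K V), f (cls (AlgOp K V) M) = mult K v M := by
  refine ⟨QuotientAddGroup.lift (AddSubgroup.closure (K0Rel (AlgOp K V)))
    (FreeAbelianGroup.lift fun M : FGModuleCat.{u} (AlgOp K V) => (mult K v M : ℤ)) ?_, fun M => ?_⟩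
  · rw [AddSubgroup.closure_le]
    rintro x (⟨M, M', M'', ⟨e⟩, rfl⟩ | ⟨P, hP, rfl⟩)
    · simp [mult_prod v e]
    · simp [mult_eq_zero_of_projective (M := P) a]
  · change FreeAbelianGroup.lift _ (FreeAbelianGroup.of M) = _
    simp

end Multiplicity

/-! ### Non-sinks and the classes of simple modules -/

section NonSink

variable (V : Type u) [Quiver.{u} V] [Fintype V]

/-- The vertices which are not sinks. -/
abbrev NonSink : Type u := {v : V // ¬ IsSink V v}

open Classical in
noncomputable instance : Fintype (NonSink V) := Fintype.ofFinite _

variable {V} in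
theorem sum_nonSink {α : Type*} [AddCommMonoid α] (f : V → α) (hf : ∀ v, IsSink V v → f v = 0) :
    ∑ v : NonSink V, f v.1 = ∑ v, f v := by
  classical
  rw [← Finset.sum_subtype (Finset.univ.filter fun v => ¬ IsSink V v) (by simp) f]
  refine Finset.sum_subset (Finset.filter_subset _ _) fun v _ hv => hf v ?_
  simpa using hv

end NonSink

section Classes

variable (K : Type u) [Field K] {V : Type u} [Quiver.{u} V] [Fintype V]

/-- The class of `S_v` in `K₀`. -/
noncomputable def simpCls (v : V) : K0 (AlgOp K V) :=
  cls (AlgOp K V) (FGModuleCat.of (AlgOp K V) (Simp K V v))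

/-- The map from `ℤ`-combinations of non-projective simple modules to `K₀`. -/
noncomputable def combCls : (NonSink V → ℤ) →+ K0 (AlgOp K V) where
  toFun x := ∑ v, x v • simpCls K v.1
  map_zero' := by simp
  map_add' x y := by simp [add_smul, Finset.sum_add_distrib]

variable {K} in
theorem combCls_apply (x : NonSink V → ℤ) : combCls K x = ∑ v, x v • simpCls K v.1 := rfl

variable [∀ i j : V, Finite (i ⟶ j)]

theorem simpCls_eq_zero {v : V} (h : IsSink V v) : simpCls K v = 0 := by
  refine cls_projective _ _ ?_
  refine (projective_iff_of_arrowsVanish (ModuleCat.of (AlgOp K V) (Simp K V v)) inferInstance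
    arrowsVanish_simp).2 fun x w hx => ?_
  rw [supp_simp.1 hx]
  exact h w

theorem cls_of_arrowsVanish (N : FGModuleCat.{u} (AlgOp K V)) (hN : ArrowsVanish K V N) :
    ∃ m : V → ℕ, cls (AlgOp K V) N = ∑ v, m v • simpCls K v ∧ ∀ v, m v ≠ 0 ↔ Supp K V N v := by
  classical
  -- The induction runs over arbitrary modules, while classes exist only for finitely generated
  -- ones; quantifying over N' ≅ N bridges the two.
  have key := arrowsVanish_induction (K := K) (V := V)
    (C := fun N => ∀ N' : FGModuleCat.{u} (AlgOp K V), (N' ≃ₗ[AlgOp K V] N) → ∃ m : V → ℕ, cls (AlgOp K V) N' = ∑ v, m v • simpCls K v ∧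
      ∀ v, m v ≠ 0 ↔ Supp K V N' v) ?_ ?_ N.obj inferInstance hN
  · exact key N (LinearEquiv.refl _ _)
  · intro N _ N' e
    have : Subsingleton N' := e.toEquiv.subsingleton
    refine ⟨0, ?_, fun v => ?_⟩
    · rw [cls_projective (AlgOp K V) N' inferInstance]
      simp
    · simpa using not_supp_of_subsingleton v
  · intro N N' v hfin _ ih e L e'
    obtain ⟨m, hm, hm'⟩ := ih (FGModuleCat.of (AlgOp K V) N') (LinearEquiv.refl _ _)
    refine ⟨m + Pi.single v 1, ?_, fun w => ?_⟩
    · rw [cls_prod (AlgOp K V) (M := L) (M' := FGModuleCat.of (AlgOp K V) N')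
        (M'' := FGModuleCat.of (AlgOp K V) (Simp K V v)) (e'.trans e), hm]
      simp only [Pi.add_apply, add_smul, Finset.sum_add_distrib]
      congr 1
      rw [Finset.sum_eq_single v]
      · rw [Pi.single_eq_same, one_smul]; rfl
      · intro w _ hw
        rw [Pi.single_eq_of_ne hw, zero_smul]
      · simp
    · rw [supp_iff_of_equiv (e'.trans e), supp_prod, supp_simp]
      have := hm' w
      by_cases hw : w = v
      · subst hw; simp
      · simp only [Pi.add_apply, Pi.single_eq_of_ne hw, add_zero, hw, or_false]
        exact this

/-- The first syzygy is semisimple whatever M is, so Ω̄ sends every class to a combination of simple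
classes. -/
theorem omegaBar_cls_eq (M : FGModuleCat.{u} (AlgOp K V)) :
    ∃ m : V → ℕ, omegaBar (AlgOp K V) (cls (AlgOp K V) M) = ∑ v, m v • simpCls K v ∧
      (ArrowsVanish K V M → ∀ w, m w ≠ 0 ↔ ∃ v, Nonempty (v ⟶ w) ∧ Supp K V M v) := by
  obtain ⟨P, f, hP, hPf, hf, hk⟩ := exists_cover M.obj inferInstance
  let P' : FGModuleCat.{u} (AlgOp K V) := FGModuleCat.of (AlgOp K V) P
  let f' : P' →ₗ[AlgOp K V] M := f
  obtain ⟨m, hm, hm'⟩ := cls_of_arrowsVanish K (kerObj (AlgOp K V) f')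
    (arrowsVanish_of_le_soc (hk.trans rad_le_soc))
  refine ⟨m, ?_, fun hM w => ?_⟩
  · rw [omegaBar_cls, omegaCls_eq (AlgOp K V) (P := P') hP f' hf, hm]
  · rw [hm']
    exact supp_ker_iff hf hM hk w

theorem exists_transfer : ∃ t : V → V → ℕ,
    (∀ v, omegaBar (AlgOp K V) (simpCls K v) = ∑ w, t v w • simpCls K w) ∧
    ∀ v w, t v w ≠ 0 ↔ Nonempty (v ⟶ w) := by
  have h := fun v : V => omegaBar_cls_eq K (FGModuleCat.of (AlgOp K V) (Simp K V v))
  choose t ht ht' using h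
  refine ⟨t, ht, fun v w => ?_⟩
  rw [ht' v arrowsVanish_simp]
  constructor
  · rintro ⟨x, hx, hxv⟩
    rwa [supp_simp.1 hxv] at hx
  · exact fun h => ⟨v, h, supp_simp.2 rfl⟩

/-- The multiplicities form a dual family: the one at v is nonzero on S_v and zero on every other
simple. -/
theorem combCls_injective : Function.Injective (combCls K (V := V)) := by
  rw [injective_iff_map_eq_zero]
  intro x hx
  ext v
  obtain ⟨w, ⟨a⟩⟩ : ∃ w, Nonempty (v.1 ⟶ w) := by
    have := v.2
    simp only [IsSink] at this
    push Not at this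
    exact this
  obtain ⟨f, hf⟩ := exists_multHom K a
  have h := congrArg f hx
  rw [combCls_apply, map_sum, map_zero, Finset.sum_eq_single v] at h
  · rw [map_zsmul, simpCls, hf, smul_eq_mul, mul_eq_zero] at h
    rcases h with h | h
    · exact h
    · exact absurd (by exact_mod_cast h) (mult_simp_self (K := K) v.1)
  · intro w _ hw
    rw [map_zsmul, simpCls, hf]
    have h0 : mult K v.1 (Simp K V w.1) = 0 :=
      mult_simp_of_ne fun h => hw (Subtype.ext h.symm)
    change x w • ((mult K v.1 (Simp K V w.1) : ℕ) : ℤ) = 0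
    rw [h0]
    simp
  · simp

/-- From the first syzygy on, everything happens in the group on the non-sinks: simples at sinks are
projective and drop out. -/
theorem exists_combCls_eq (z : K0 (AlgOp K V)) :
    ∃ x : NonSink V → ℤ, omegaBar (AlgOp K V) z = combCls K x := by
  have h : ∀ M : FGModuleCat.{u} (AlgOp K V),
      omegaBar (AlgOp K V) (cls (AlgOp K V) M) ∈ (combCls K (V := V)).range := fun M => by
    obtain ⟨m, hm, -⟩ := omegaBar_cls_eq K M
    refine ⟨fun v => m v.1, ?_⟩
    rw [hm, combCls_apply, ← sum_nonSink (fun v => m v • simpCls K v) fun v hv => by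
      rw [simpCls_eq_zero K hv, smul_zero]]
    simp
  have h2 : omegaBar (AlgOp K V) z ∈ (combCls K (V := V)).range := by
    obtain ⟨y, rfl⟩ := QuotientAddGroup.mk'_surjective _ z
    induction y using FreeAbelianGroup.induction_on with
    | zero => rw [map_zero, map_zero]; exact zero_mem _
    | of M => exact h M
    | neg M ih => rw [map_neg, map_neg]; exact neg_mem ih
    | add x y hx hy => rw [map_add, map_add]; exact add_mem hx hy
  obtain ⟨x, hx⟩ := h2
  exact ⟨x, hx.symm⟩

end Classes

end RadSqZeroAlg

namespace RadSqZeroAlg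

open IgusaTodorov CategoryTheory

/-! ### Nilpotent chains of the transfer matrix -/

section Kernel

/-- A chain of length `k + 1` of a nilpotent vector bounds the dimension of the kernel of the
iterate, and so the rank of the iterate. -/
theorem succ_add_finrank_range_le {F W : Type*} [Field F] [AddCommGroup W] [Module F W]
    [FiniteDimensional F W] (f : Module.End F W) {k : ℕ} {x : W} (h : (f ^ (k + 1)) x = 0)
    (h' : (f ^ k) x ≠ 0) :
    k + 1 + Module.finrank F (LinearMap.range (f ^ (k + 1))) ≤ Module.finrank F W := by
  -- The kernels grow strictly up to exponent k + 1: f^(k−i) x is killed by f^(i+1) but not by f^i.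
  have key : ∀ i ≤ k + 1, i ≤ Module.finrank F (LinearMap.ker (f ^ i)) := by
    intro i
    induction i with
    | zero => intro _; exact Nat.zero_le _
    | succ i ih =>
      intro hi
      refine lt_of_le_of_lt (ih (by omega)) (Submodule.finrank_lt_finrank_of_lt ?_)
      refine lt_of_le_of_ne (fun y hy => ?_) fun heq => h' ?_
      · rw [LinearMap.mem_ker, pow_succ', Module.End.mul_apply, LinearMap.mem_ker.1 hy, map_zero]
      · have h1 : (f ^ (k - i)) x ∈ LinearMap.ker (f ^ (i + 1)) := by
          rw [LinearMap.mem_ker, ← Module.End.mul_apply, ← pow_add,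
            show i + 1 + (k - i) = k + 1 by omega, h]
        rw [← heq, LinearMap.mem_ker, ← Module.End.mul_apply, ← pow_add,
          show i + (k - i) = k by omega] at h1
        exact h1
  have h1 := key (k + 1) le_rfl
  have h2 := LinearMap.finrank_range_add_finrank_ker (f ^ (k + 1))
  omega

end Kernel

section Transfer

variable {V : Type u} [Quiver.{u} V] [Fintype V]

/-- The linear map given by a matrix of multiplicities on the vertices which are not sinks. -/
noncomputable def transfer (S : Type*) [CommRing S] (t : V → V → ℕ) :
    (NonSink V → S) →ₗ[S] (NonSink V → S) where
  toFun x w := ∑ v, (t v.1 w.1 : S) * x v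
  map_add' x y := by ext w; simp [mul_add, Finset.sum_add_distrib]
  map_smul' c x := by ext w; simp [Finset.mul_sum, mul_left_comm]

theorem transfer_apply {S : Type*} [CommRing S] (t : V → V → ℕ) (x : NonSink V → S)
    (w : NonSink V) : transfer S t x w = ∑ v, (t v.1 w.1 : S) * x v := rfl

variable {t : V → V → ℕ}

/-- Passes from ℤ, where K₀ lives, to ℚ, where ranks can be compared. -/
theorem transfer_iterate_intCast (k : ℕ) (x : NonSink V → ℤ) :
    (transfer ℚ t)^[k] (fun v => (x v : ℚ)) = fun v => (((transfer ℤ t)^[k] x v : ℤ) : ℚ) := by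
  induction k with
  | zero => rfl
  | succ k ih =>
    rw [Function.iterate_succ_apply', Function.iterate_succ_apply', ih]
    ext w
    simp [transfer_apply]

open Classical in
-- All entries are nonnegative, so nothing cancels and powers of T detect walks. Every intermediate
-- vertex of a walk has an outgoing arrow, so restricting to non-sinks loses no walk.
theorem transfer_iterate_single (ht : ∀ v w, t v w ≠ 0 ↔ Nonempty (v ⟶ w)) (v : NonSink V) (k : ℕ)
    (w : NonSink V) : 0 ≤ (transfer ℤ t)^[k] (Pi.single v 1) w ∧
      (0 < (transfer ℤ t)^[k] (Pi.single v 1) w ↔ Walk k v.1 w.1) := by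
  induction k generalizing w with
  | zero =>
    by_cases h : w = v
    · subst h
      simp [Walk]
    · have h1 : v.1 ≠ w.1 := fun h' => h (Subtype.ext h'.symm)
      simp [Walk, h, h1]
  | succ k ih =>
    rw [Function.iterate_succ_apply', transfer_apply]
    have hnn : ∀ x ∈ Finset.univ, 0 ≤ (t x.1 w.1 : ℤ) * (transfer ℤ t)^[k] (Pi.single v 1) x :=
      fun x _ => mul_nonneg (Int.natCast_nonneg _) (ih x).1
    refine ⟨Finset.sum_nonneg hnn, ?_⟩
    rw [Finset.sum_pos_iff_of_nonneg hnn]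
    constructor
    · rintro ⟨x, -, hx⟩
      have h0 : t x.1 w.1 ≠ 0 := fun h0 => by simp [h0] at hx
      refine ⟨x.1, (ih x).2.1 ?_, (ht _ _).1 h0⟩
      exact pos_of_mul_pos_right hx (Int.natCast_nonneg _)
    · rintro ⟨x, hx, ⟨a⟩⟩
      let x' : NonSink V := ⟨x, fun h => (h w.1).false a⟩
      refine ⟨x', Finset.mem_univ _, mul_pos ?_ ((ih x').2.2 hx)⟩
      have := (ht x w.1).2 ⟨a⟩
      exact_mod_cast Nat.pos_of_ne_zero this

/-- A vector dying after exactly k + 1 steps gives a kernel of T^(k+1) of dimension at least k + 1.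
An endless vertex makes T^(k+1) nonzero and so uses up one more dimension. -/
theorem index_le (ht : ∀ v w, t v w ≠ 0 ↔ Nonempty (v ⟶ w)) {k : ℕ} {x : NonSink V → ℤ}
    (h : (transfer ℤ t)^[k + 1] x = 0) (h' : (transfer ℤ t)^[k] x ≠ 0) :
    k + 1 ≤ Fintype.card (NonSink V) ∧
      ((∃ v : V, ∀ m, ∃ w, Walk m v w) → k + 2 ≤ Fintype.card (NonSink V)) := by
  classical
  have h1 := succ_add_finrank_range_le (transfer ℚ t) (k := k) (x := fun v => (x v : ℚ)) (by
      rw [Module.End.pow_apply, transfer_iterate_intCast, h]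
      ext v; simp) (by
      rw [Module.End.pow_apply, transfer_iterate_intCast]
      intro h0
      refine h' (funext fun v => ?_)
      have h1 : (((transfer ℤ t)^[k] x v : ℤ) : ℚ) = 0 := congrFun h0 v
      exact_mod_cast h1)
  rw [Module.finrank_fintype_fun_eq_card] at h1
  refine ⟨by omega, fun ⟨v, hv⟩ => ?_⟩
  have hpos : 0 < Module.finrank ℚ (LinearMap.range (transfer ℚ t ^ (k + 1))) := by
    -- One arrow more than needed, so that the vertex w reached after k + 1 steps is not a sink.
    obtain ⟨u, w, hw, ⟨a⟩⟩ := hv (k + 2)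
    obtain ⟨v1, hv1⟩ := hv 1
    have hvN : ¬ IsSink V v := fun hs => by
      obtain ⟨a⟩ := walk_one_iff.1 hv1
      exact (hs _).false a
    let v' : NonSink V := ⟨v, hvN⟩
    let w' : NonSink V := ⟨w, fun hs => (hs _).false a⟩
    have h2 := (transfer_iterate_single ht v' (k + 1) w').2.2 hw
    rw [Module.finrank_pos_iff_exists_ne_zero]
    refine ⟨⟨_, fun x => ((Pi.single v' 1 : NonSink V → ℤ) x : ℚ), rfl⟩, fun h0 => ?_⟩
    have h3 : (transfer ℚ t ^ (k + 1)) (fun x => ((Pi.single v' 1 : NonSink V → ℤ) x : ℚ)) w' = 0 :=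
      congrFun (congrArg Subtype.val h0) w'
    rw [Module.End.pow_apply, transfer_iterate_intCast] at h3
    beta_reduce at h3
    have h4 : (transfer ℤ t)^[k + 1] (Pi.single v' 1) w' = 0 := by exact_mod_cast h3
    omega
  omega

end Transfer

/-! ### Bounds for φ -/

section Phi

variable {K : Type u} [Field K] {V : Type u} [Quiver.{u} V] [Fintype V]
  [∀ i j : V, Finite (i ⟶ j)] {t : V → V → ℕ}

theorem omegaBar_combCls
    (ht : ∀ v, omegaBar (AlgOp K V) (simpCls K v) = ∑ w, t v w • simpCls K w)
    (x : NonSink V → ℤ) :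
    omegaBar (AlgOp K V) (combCls K x) = combCls K (transfer ℤ t x) := by
  have h : ∀ v : NonSink V, omegaBar (AlgOp K V) (x v • simpCls K v.1) =
      ∑ w : NonSink V, ((t v.1 w.1 : ℤ) * x v) • simpCls K w.1 := fun v => by
    rw [map_zsmul, ht, ← sum_nonSink (fun w => t v.1 w • simpCls K w) fun w hw => by
      rw [simpCls_eq_zero K hw, smul_zero], Finset.smul_sum]
    refine Finset.sum_congr rfl fun w _ => ?_
    rw [← natCast_zsmul, smul_smul, mul_comm]
  rw [combCls_apply, map_sum, combCls_apply]
  simp only [h, transfer_apply, Finset.sum_smul]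
  exact Finset.sum_comm

theorem omegaBar_iterate_combCls
    (ht : ∀ v, omegaBar (AlgOp K V) (simpCls K v) = ∑ w, t v w • simpCls K w)
    (k : ℕ) (x : NonSink V → ℤ) :
    (omegaBar (AlgOp K V))^[k] (combCls K x) = combCls K ((transfer ℤ t)^[k] x) := by
  induction k with
  | zero => rfl
  | succ k ih =>
    rw [Function.iterate_succ_apply', ih, omegaBar_combCls ht, Function.iterate_succ_apply']

variable (K) in
-- One application of Ω̄ reaches the simples, and b further ones exhaust every chain of T ending in
-- 0. The two alternatives in `hb` are the two bounds of `index_le`.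
theorem injOn_omegaBar {b : ℕ} (hb : Fintype.card (NonSink V) ≤ b ∨
      (∃ v : V, ∀ m, ∃ w, Walk m v w) ∧ Fintype.card (NonSink V) ≤ b + 1)
    (H : AddSubgroup (K0 (AlgOp K V))) (s : ℕ) :
    Set.InjOn (omegaBar (AlgOp K V)) ((omegaBar (AlgOp K V))^[b + 1 + s] '' (H : Set _)) := by
  obtain ⟨t, ht, ht'⟩ := exists_transfer K (V := V)
  rintro _ ⟨y, _, rfl⟩ _ ⟨z, _, rfl⟩ h
  rw [← sub_eq_zero, ← map_sub, ← iterate_map_sub] at h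
  rw [← sub_eq_zero, ← iterate_map_sub]
  obtain ⟨x, hx⟩ := exists_combCls_eq K (y - z)
  rw [show b + 1 + s = b + s + 1 by omega, Function.iterate_succ_apply, hx,
    omegaBar_iterate_combCls ht] at h ⊢
  rw [omegaBar_combCls ht, ← Function.iterate_succ_apply' (transfer ℤ t)] at h
  have h0 := combCls_injective K (h.trans (map_zero _).symm)
  by_cases h1 : (transfer ℤ t)^[b + s] x = 0
  · rw [h1, map_zero]
  · obtain ⟨h2, h3⟩ := index_le ht' h0 h1
    rcases hb with hb | ⟨hE, hb⟩
    · omega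
    · have := h3 hE
      omega

theorem phi_le {b : ℕ} (hb : Fintype.card (NonSink V) ≤ b ∨
      (∃ v : V, ∀ m, ∃ w, Walk m v w) ∧ Fintype.card (NonSink V) ≤ b + 1)
    (M : FGModuleCat.{u} (AlgOp K V)) : phi (AlgOp K V) M ≤ b + 1 :=
  Nat.sInf_le fun s => injOn_omegaBar K hb _ s

/-- Ω̄ identifies the distinct elements Ω̄^l z and 0 of the l-th image. The hypothesis `hb` makes
the set defining φ nonempty; the infimum of the empty set would be 0. -/
theorem le_phi {b l : ℕ} (hb : Fintype.card (NonSink V) ≤ b ∨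
      (∃ v : V, ∀ m, ∃ w, Walk m v w) ∧ Fintype.card (NonSink V) ≤ b + 1)
    (M : FGModuleCat.{u} (AlgOp K V)) {z : K0 (AlgOp K V)} (hz : z ∈ addSub (AlgOp K V) M)
    (h : (omegaBar (AlgOp K V))^[l + 1] z = 0) (h' : (omegaBar (AlgOp K V))^[l] z ≠ 0) :
    l + 1 ≤ phi (AlgOp K V) M := by
  have hmem := Nat.sInf_mem (s := {l : ℕ | ∀ s : ℕ, Set.InjOn (omegaBar (AlgOp K V))
    ((omegaBar (AlgOp K V))^[l + s] '' (addSub (AlgOp K V) M : Set (K0 (AlgOp K V))))})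
    ⟨b + 1, fun s => injOn_omegaBar K hb _ s⟩
  change ∀ s : ℕ, Set.InjOn _ ((omegaBar (AlgOp K V))^[phi (AlgOp K V) M + s] '' _) at hmem
  by_contra! hlt
  have h1 := hmem (l - phi (AlgOp K V) M)
  rw [show phi (AlgOp K V) M + (l - phi (AlgOp K V) M) = l by omega] at h1
  refine h' (h1 ⟨z, hz, rfl⟩ ⟨0, zero_mem _, iterate_map_zero _ _⟩ ?_)
  rw [← Function.iterate_succ_apply' (omegaBar (AlgOp K V)), h, map_zero]

end Phi

end RadSqZeroAlg

namespace RadSqZeroAlg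

/-! ### Endless vertices and lengths of walks -/

section Endless

variable {V : Type u} [Quiver.{u} V]

/-- There are arbitrarily long paths starting at `v`; equivalently, `S_v` has infinite projective
dimension. -/
def Endless (v : V) : Prop := ∀ m, ∃ w, Walk m v w

theorem Walk.exists_prefix {m n : ℕ} {v w : V} (h : Walk n v w) (hmn : m ≤ n) :
    ∃ x, Walk m v x := by
  rw [← Nat.add_sub_cancel' hmn, walk_add] at h
  exact ⟨h.choose, h.choose_spec.1⟩

theorem Walk.exists_suffix {m n : ℕ} {v w : V} (h : Walk n v w) (hmn : m ≤ n) :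
    ∃ x, Walk m x w := by
  rw [← Nat.sub_add_cancel hmn, walk_add] at h
  exact ⟨h.choose, h.choose_spec.2⟩

theorem walk_mul_of_cycle {c : ℕ} {x : V} (h : Walk c x x) (m : ℕ) : Walk (m * c) x x := by
  induction m with
  | zero => rw [zero_mul]; rfl
  | succ m ih => rw [add_mul, one_mul]; exact ih.trans h

theorem endless_of_cycle {c : ℕ} {x : V} (h : Walk (c + 1) x x) : Endless x := fun m =>
  (walk_mul_of_cycle h m).exists_prefix (Nat.le_mul_of_pos_right m c.succ_pos)

theorem Endless.of_walk {k : ℕ} {v w : V} (hw : Endless w) (h : Walk k v w) : Endless v :=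
  fun m => by
    obtain ⟨x, hx⟩ := hw m
    exact (h.trans hx).exists_prefix (Nat.le_add_left m k)

theorem not_endless_of_forall_not_walk {v : V} {k : ℕ} (h : ∀ w, ¬ Walk k v w) : ¬ Endless v :=
  fun hv => by
    obtain ⟨w, hw⟩ := hv k
    exact h w hw

theorem Walk.exists_seq {k : ℕ} {v w : V} (h : Walk k v w) :
    ∃ p : ℕ → V, p 0 = v ∧ p k = w ∧ ∀ i j, i ≤ j → j ≤ k → Walk (j - i) (p i) (p j) := by
  induction k generalizing w with
  | zero =>
    refine ⟨fun _ => v, rfl, h, fun i j hij hj => ?_⟩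
    obtain rfl : j = 0 := by omega
    rw [Nat.zero_sub]; rfl
  | succ k ih =>
    obtain ⟨x, hx, ha⟩ := h
    obtain ⟨p, h0, hk, hp⟩ := ih hx
    refine ⟨fun i => if i ≤ k then p i else w, by simpa using h0, by simp, fun i j hij hj => ?_⟩
    by_cases hjk : j ≤ k
    · simp only [hjk, hij.trans hjk, if_true]
      exact hp i j hij hjk
    · obtain rfl : j = k + 1 := by omega
      by_cases hik : i ≤ k
      · simp only [hik, hjk, if_true, if_false]
        rw [Nat.sub_add_comm hik]
        exact ⟨p k, hp i k hik le_rfl, hk.symm ▸ ha⟩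
      · simp only [hik, hjk, if_false]
        obtain rfl : i = k + 1 := by omega
        rw [Nat.sub_self]; rfl

/-- A path starting at a vertex with bounded path lengths has no repeated vertices. -/
theorem Walk.exists_injOn {k : ℕ} {v w : V} (h : Walk k v w) (hv : ¬ Endless v) :
    ∃ p : ℕ → V, p 0 = v ∧ (∀ i j, i ≤ j → j ≤ k → Walk (j - i) (p i) (p j)) ∧
      (∀ i ≤ k, ¬ Endless (p i)) ∧ Set.InjOn p (Finset.range (k + 1)) := by
  obtain ⟨p, h0, -, hp⟩ := h.exists_seq
  have hne : ∀ i ≤ k, ¬ Endless (p i) := fun i hi hE => hv (by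
    have := hE.of_walk (hp 0 i (Nat.zero_le _) hi)
    rwa [h0] at this)
  have hlt : ∀ i j, i < j → j ≤ k → p i ≠ p j := fun i j hij hj heq => by
    refine hne j hj (endless_of_cycle (c := j - i - 1) ?_)
    have := hp i j hij.le hj
    rw [heq] at this
    rwa [show j - i - 1 + 1 = j - i by omega]
  refine ⟨p, h0, hp, hne, fun i hi j hj heq => ?_⟩
  simp only [Finset.coe_range, Set.mem_Iio] at hi hj
  rcases lt_trichotomy i j with h | h | h
  · exact absurd heq (hlt i j h (by omega))
  · exact h
  · exact absurd heq.symm (hlt j i h (by omega))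

theorem nonempty_path_iff {v w : V} : Nonempty (Quiver.Path v w) ↔ ∃ m, Walk m v w := by
  constructor
  · rintro ⟨p⟩
    induction p with
    | nil => exact ⟨0, rfl⟩
    | cons p a ih =>
      obtain ⟨m, hm⟩ := ih
      exact ⟨m + 1, _, hm, ⟨a⟩⟩
  · rintro ⟨m, hm⟩
    induction m generalizing w with
    | zero => obtain rfl : v = w := hm; exact ⟨Quiver.Path.nil⟩
    | succ m ih =>
      obtain ⟨x, hx, ⟨a⟩⟩ := hm
      obtain ⟨p⟩ := ih hx
      exact ⟨p.cons a⟩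

/-- Without a sink every walk can be prolonged. -/
theorem exists_isSink {v : V} (hv : ¬ Endless v) : ∃ w : V, IsSink V w := by
  by_contra! h
  refine hv fun m => ?_
  induction m with
  | zero => exact ⟨v, rfl⟩
  | succ m ih =>
    obtain ⟨x, hx⟩ := ih
    have := h x
    simp only [IsSink] at this
    push Not at this
    obtain ⟨w, ha⟩ := this
    exact ⟨w, x, hx, ha⟩

variable [Fintype V]

theorem Walk.lt_card {k : ℕ} {v w : V} (h : Walk k v w) (hv : ¬ Endless v) :
    k < Fintype.card V := by
  classical
  obtain ⟨p, -, -, -, hp⟩ := h.exists_injOn hv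
  have := (Finset.range (k + 1)).card_image_of_injOn hp
  rw [Finset.card_range] at this
  have h2 := Finset.card_le_univ ((Finset.range (k + 1)).image p)
  omega

/-- The k + 1 vertices of the walk are distinct and none of them is endless, so c is a further
vertex. -/
theorem Walk.succ_lt_card {k : ℕ} {v w c : V} (h : Walk k v w) (hv : ¬ Endless v)
    (hc : Endless c) : k + 1 < Fintype.card V := by
  classical
  obtain ⟨p, -, -, hp', hp⟩ := h.exists_injOn hv
  have hcard := (Finset.range (k + 1)).card_image_of_injOn hp
  rw [Finset.card_range] at hcard
  have hc' : c ∉ (Finset.range (k + 1)).image p := fun hmem => by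
    obtain ⟨i, hi, rfl⟩ := Finset.mem_image.1 hmem
    exact hp' i (by rw [Finset.mem_range] at hi; omega) hc
  have := Finset.card_insert_of_notMem hc'
  have h2 := Finset.card_le_univ (insert c ((Finset.range (k + 1)).image p))
  omega

theorem endless_iff (v : V) : Endless v ↔ ∃ w, Walk (Fintype.card V) v w :=
  ⟨fun h => h _, fun ⟨_, h⟩ => by_contra fun hv => lt_irrefl _ (h.lt_card hv)⟩

theorem Endless.exists_arrow {v : V} (h : Endless v) : ∃ w, Nonempty (v ⟶ w) ∧ Endless w := by
  obtain ⟨w, hw⟩ := h (Fintype.card V + 1)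
  obtain ⟨x, ha, hx⟩ := walk_succ_iff.1 hw
  exact ⟨x, ha, (endless_iff x).2 ⟨w, hx⟩⟩

theorem card_nonSink_lt {v : V} (hv : ¬ Endless v) :
    Fintype.card (NonSink V) < Fintype.card V := by
  obtain ⟨w, hw⟩ := exists_isSink hv
  exact Fintype.card_subtype_lt (x := w) (not_not.2 hw)

theorem card_nonSink_le : Fintype.card (NonSink V) ≤ Fintype.card V :=
  Fintype.card_subtype_le _

end Endless

/-! ### Shape of the extremal quivers -/

section Extremal

variable (K : Type u) [Field K] {V : Type u} [Quiver.{u} V] [Fintype V]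
  [∀ i j : V, Finite (i ⟶ j)]

theorem mem_heart_iff_endless (v : V) :
    v ∈ heart K V ↔ (∃ x, Walk (Fintype.card V) x v) ∧ Endless v := by
  rw [mem_heart_iff, endless_iff]

theorem mem_heart_of_cycle {c : ℕ} {x : V} (h : Walk (c + 1) x x) : x ∈ heart K V :=
  (mem_heart_iff_endless K x).2 ⟨(walk_mul_of_cycle h (Fintype.card V)).exists_suffix
    (Nat.le_mul_of_pos_right _ c.succ_pos), endless_of_cycle h⟩

variable (V) in
/-- The quivers for which the `ψ`-dimension is maximal. -/
def IsExtremal : Prop :=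
  MemberTotallyOrdered K V ∧
  (∃ v : V, IsSink V v) ∧
  (∃ c : V, heart K V = {c} ∧ Nonempty (c ⟶ c)) ∧
  (∀ x ∈ (heart K V)ᶜ, ∀ c ∈ heart K V, IsEmpty (x ⟶ c)) ∧
  (∃ c ∈ heart K V, ∃ s : V, IsMemberSource K V s ∧ Nonempty (c ⟶ s))

/-- The walk has n − 1 distinct vertices, none endless, so together with c they are all. An endless
vertex has an endless successor, whence the loop at c and the heart {c}. The walk orders the member,
and an arrow prolonging it at either end would make it too long: its end is a sink, and the arrow
into s comes from c. -/
theorem isExtremal_of_walk (hn : 3 < Fintype.card V) {c s u w : V} (hc : Endless c)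
    (hs : ¬ Endless s) (hw : Walk (Fintype.card V - 2) s w) (hu : Nonempty (u ⟶ s)) :
    IsExtremal K V := by
  classical
  obtain ⟨p, h0, hp, hpE, hinj⟩ := hw.exists_injOn hs
  have hcover : ∀ x, x = c ∨ ∃ i ≤ Fintype.card V - 2, x = p i := by
    have hcard := (Finset.range (Fintype.card V - 2 + 1)).card_image_of_injOn hinj
    rw [Finset.card_range] at hcard
    have hc' : c ∉ (Finset.range (Fintype.card V - 2 + 1)).image p := fun hmem => by
      obtain ⟨i, hi, rfl⟩ := Finset.mem_image.1 hmem
      exact hpE i (by rw [Finset.mem_range] at hi; omega) hc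
    have h1 := Finset.card_insert_of_notMem hc'
    have h2 := Finset.eq_univ_of_card _ (show (insert c ((Finset.range
      (Fintype.card V - 2 + 1)).image p)).card = Fintype.card V by omega)
    intro x
    have hx := Finset.mem_univ x
    rw [← h2, Finset.mem_insert, Finset.mem_image] at hx
    rcases hx with hx | ⟨i, hi, rfl⟩
    · exact Or.inl hx
    · exact Or.inr ⟨i, by rw [Finset.mem_range] at hi; omega, rfl⟩
  have hE : ∀ x, Endless x → x = c := fun x hx => by
    rcases hcover x with h | ⟨i, hi, rfl⟩
    · exact h
    · exact absurd hx (hpE i hi)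
  have hloop : Nonempty (c ⟶ c) := by
    obtain ⟨x, ha, hx⟩ := hc.exists_arrow
    rwa [hE x hx] at ha
  have hheart : heart K V = {c} := by
    ext x
    rw [Set.mem_singleton_iff]
    refine ⟨fun hx => hE x ((mem_heart_iff_endless K x).1 hx).2, ?_⟩
    rintro rfl
    exact mem_heart_of_cycle K (c := 0) (walk_one hloop)
  have hmem : ∀ x, x ∈ (heart K V)ᶜ ↔ ¬ Endless x := fun x => by
    rw [hheart, Set.mem_compl_iff, Set.mem_singleton_iff]
    exact not_congr ⟨fun h => h ▸ hc, hE x⟩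
  have hmem' : ∀ x, x ∈ (heart K V)ᶜ → ∃ i ≤ Fintype.card V - 2, x = p i := fun x hx => by
    rcases hcover x with h | h
    · exact absurd (h ▸ hc) ((hmem x).1 hx)
    · exact h
  have hsrc : ∀ x ∈ (heart K V)ᶜ, IsEmpty (x ⟶ s) := fun x hx => ⟨fun a => by
    have := ((walk_one ⟨a⟩).trans hw).succ_lt_card ((hmem x).1 hx) hc
    omega⟩
  refine ⟨⟨fun x hx y _ hxy hyx => ?_, fun x hx y hy => ?_⟩, ⟨w, fun v => ⟨fun a => ?_⟩⟩,
    ⟨c, hheart, hloop⟩, fun x hx c' hc' => ⟨fun a => ?_⟩, c, hheart ▸ rfl, s,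
    ⟨(hmem s).2 hs, hsrc⟩, ?_⟩
  · obtain ⟨k, hk⟩ := nonempty_path_iff.1 hxy
    obtain ⟨l, hl⟩ := nonempty_path_iff.1 hyx
    by_contra hne
    have hk0 : k ≠ 0 := fun h => by subst h; exact hne hk
    refine (hmem x).1 hx (endless_of_cycle (c := k + l - 1) ?_)
    rw [show k + l - 1 + 1 = k + l by omega]
    exact hk.trans hl
  · obtain ⟨i, hi, rfl⟩ := hmem' x hx
    obtain ⟨j, hj, rfl⟩ := hmem' y hy
    rw [nonempty_path_iff, nonempty_path_iff]
    rcases le_total i j with h | h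
    · exact Or.inl ⟨_, hp i j h hj⟩
    · exact Or.inr ⟨_, hp j i h hi⟩
  · have := (hw.trans (walk_one ⟨a⟩)).succ_lt_card hs hc
    omega
  · rw [hheart, Set.mem_singleton_iff] at hc'
    subst hc'
    exact (hmem x).1 hx (hc.of_walk (walk_one ⟨a⟩))
  · obtain ⟨a⟩ := hu
    by_cases huc : u = c
    · exact ⟨huc ▸ a⟩
    · refine ((hsrc u ?_).false a).elim
      rwa [hheart, Set.mem_compl_iff, Set.mem_singleton_iff]

/-- Let ht x be the maximal length of a walk from x. On the n − 1 vertices of the member it takes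
values below n − 1 and is injective, since the order is total and ht drops strictly along it. So the
value n − 2 is attained, at a vertex that the source s reaches. -/
theorem IsExtremal.exists_walk (h : IsExtremal K V) (hn : 3 < Fintype.card V) :
    ∃ c s w : V, Nonempty (c ⟶ c) ∧ Nonempty (c ⟶ s) ∧ ¬ Endless s ∧
      Walk (Fintype.card V - 2) s w := by
  classical
  obtain ⟨⟨-, htot⟩, -, ⟨c, hheart, hloop⟩, hno, c', hc', s, ⟨hs, hsrc⟩, ha⟩ := h
  obtain rfl : c' = c := by rwa [hheart] at hc'
  have hcE : Endless c' := endless_of_cycle (c := 0) (walk_one hloop)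
  have hstay : ∀ {k : ℕ} {x y : V}, Walk k x y → x ∈ (heart K V)ᶜ → y ∈ (heart K V)ᶜ := by
    intro k
    induction k with
    | zero => intro x y hxy hx; obtain rfl : x = y := hxy; exact hx
    | succ k ih =>
      rintro x y ⟨z, hz, ⟨a⟩⟩ hx hy
      exact (hno z (ih hz hx) y hy).false a
  -- A walk of length n repeats a vertex; the resulting cycle lies in the heart, which no walk from
  -- the member enters.
  have hE : ∀ x ∈ (heart K V)ᶜ, ¬ Endless x := by
    intro x hx hxE
    obtain ⟨y, hy⟩ := hxE (Fintype.card V)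
    obtain ⟨p, h0, -, hp⟩ := hy.exists_seq
    obtain ⟨i, hi, j, hj, hne, heq⟩ := Finset.exists_ne_map_eq_of_card_lt_of_maps_to
      (s := Finset.range (Fintype.card V + 1)) (t := (Finset.univ : Finset V)) (f := p)
      (by rw [Finset.card_range]; exact Nat.lt_succ_self _) (fun _ _ => Finset.mem_univ _)
    rw [Finset.mem_range] at hi hj
    have hmain : ∀ i j, i < j → j ≤ Fintype.card V → p i = p j → False := by
      intro i j hij hj heq
      have h1 := hp i j hij.le hj
      rw [← heq, show j - i = j - i - 1 + 1 by omega] at h1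
      have h2 := hp 0 i (Nat.zero_le _) (by omega)
      rw [h0] at h2
      exact hstay h2 hx (mem_heart_of_cycle K h1)
    rcases lt_or_gt_of_ne hne with h | h
    · exact hmain i j h (by omega) heq
    · exact hmain j i h (by omega) heq.symm
  -- The cut-off n is harmless on the member, where every walk is shorter; the value at the heart is
  -- not used.
  let ht : V → ℕ := fun x => Nat.findGreatest (fun m => ∃ w, Walk m x w) (Fintype.card V)
  have ht1 : ∀ x, ∃ w, Walk (ht x) x w := fun x =>
    Nat.findGreatest_spec (P := fun m => ∃ w, Walk m x w) (Nat.zero_le (Fintype.card V))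
      ⟨x, rfl⟩
  have ht2 : ∀ x ∈ (heart K V)ᶜ, ∀ k w, Walk k x w → k ≤ ht x := fun x hx k w hw =>
    Nat.le_findGreatest (hw.lt_card (hE x hx)).le ⟨w, hw⟩
  have hlt : ∀ x ∈ (heart K V)ᶜ, ∀ y, x ≠ y → Nonempty (Quiver.Path x y) → ht y < ht x := by
    intro x hx y hne hxy
    obtain ⟨m, hm⟩ := nonempty_path_iff.1 hxy
    obtain ⟨w, hw⟩ := ht1 y
    have h1 := ht2 x hx _ _ (hm.trans hw)
    have h2 : m ≠ 0 := fun h => by subst h; exact hne hm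
    omega
  have hmaps : Set.MapsTo ht ((Finset.univ.erase c' : Finset V) : Set V)
      (Finset.range (Fintype.card V - 1) : Set ℕ) := by
    intro x hx
    have hx' : x ∈ (heart K V)ᶜ := by
      rw [hheart]
      simpa using hx
    obtain ⟨w, hw⟩ := ht1 x
    have := hw.succ_lt_card (hE x hx') hcE
    rw [Finset.coe_range, Set.mem_Iio]
    omega
  have hinj : Set.InjOn ht ((Finset.univ.erase c' : Finset V) : Set V) := by
    intro x hx y hy heq
    have hx' : x ∈ (heart K V)ᶜ := by
      rw [hheart]
      simpa using hx
    have hy' : y ∈ (heart K V)ᶜ := by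
      rw [hheart]
      simpa using hy
    by_contra hne
    rcases htot x hx' y hy' with h | h
    · exact absurd heq (hlt x hx' y hne h).ne'
    · exact absurd heq (hlt y hy' x (Ne.symm hne) h).ne
  have hsurj := Finset.surjOn_of_injOn_of_card_le ht hmaps hinj (by
    rw [Finset.card_range, Finset.card_erase_of_mem (Finset.mem_univ _), Finset.card_univ])
  obtain ⟨t, htmem, htop⟩ := hsurj (show Fintype.card V - 2 ∈
    (Finset.range (Fintype.card V - 1) : Set ℕ) by
      rw [Finset.coe_range, Set.mem_Iio]; omega)
  have htc : t ∈ (heart K V)ᶜ := by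
    rw [hheart]
    simpa using htmem
  -- If instead t precedes s, then t = s: a last arrow into s would start in the member, whose
  -- source is s.
  obtain ⟨m, hm⟩ : ∃ m, Walk m s t := by
    rcases htot s hs t htc with h | h
    · exact nonempty_path_iff.1 h
    · obtain ⟨m, hm⟩ := nonempty_path_iff.1 h
      cases m with
      | zero => obtain rfl : t = s := hm; exact ⟨0, rfl⟩
      | succ m =>
        obtain ⟨x, hx, ⟨a⟩⟩ := hm
        exact ((hsrc x (hstay hx htc)).false a).elim
  obtain ⟨w, hw⟩ := ht1 t
  rw [htop] at hw
  obtain ⟨w', hw'⟩ := (hm.trans hw).exists_prefix (Nat.le_add_left _ _)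
  exact ⟨c', s, w', hloop, ha, hE s hs, hw'⟩

end Extremal

end RadSqZeroAlg

namespace RadSqZeroAlg

open IgusaTodorov CategoryTheory

variable {K : Type u} [Field K] {V : Type u} [Quiver.{u} V] [Fintype V]

/-! ### The local modules used for the lower bound -/

section ArrowQuotient

theorem sup_span_rad_proj_eq_top {c : V} {x : Proj K c} (hx : chi K c x ≠ 0)
    {U : Submodule (AlgOp K V) (Proj K c)} (hU : x ∈ U) : U = ⊤ := by
  refine eq_top_of_sup_rad (eq_top_iff.2 fun y _ => ?_)
  let r : AlgOp K V := algebraMap K (AlgOp K V) (chi K c y / chi K c x)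
  refine Submodule.mem_sup.2 ⟨r • x, U.smul_mem _ hU, y - r • x, mem_rad_proj ?_, by abel⟩
  change chi K c ((y : AlgOp K V) - r * x) = 0
  rw [map_sub, map_mul, AlgHom.commutes]
  change chi K c y - chi K c y / chi K c x * chi K c x = 0
  rw [div_mul_cancel₀ _ hx, sub_self]

/-- The module is local. If an element outside the radical of e_cA dies in Z, it generates e_cA and
Z = 0; otherwise everything mapping into Y lies in the radical, so Y equals its radical and vanishes
by Nakayama. -/
theorem isIndecomposable_quotient_proj {c : V} (U : Submodule (AlgOp K V) (Proj K c))
    (hU : U ≤ rad K V (Proj K c)) :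
    IsIndecomposable (AlgOp K V) (ModuleCat.of (AlgOp K V) (Proj K c ⧸ U)) := by
  constructor
  · change Nontrivial (Proj K c ⧸ U)
    rw [Submodule.Quotient.nontrivial_iff]
    rintro rfl
    have h1 := chi_eq_zero_of_mem_rad (projCover c)
      (hU (Submodule.mem_top : (⟨oe K c, oe_mem_proj c⟩ : Proj K c) ∈ ⊤))
    have h2 : chi K c (oe K c) = 0 := h1
    rw [chi_oe_self] at h2
    exact one_ne_zero h2
  · rintro Y Z ⟨e⟩
    let e' : (Proj K c ⧸ U) ≃ₗ[AlgOp K V] Y × Z := e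
    let q : Proj K c →ₗ[AlgOp K V] Y × Z := e'.toLinearMap.comp U.mkQ
    have hq : Function.Surjective q := e'.surjective.comp (Submodule.mkQ_surjective U)
    by_cases h : ∃ x : Proj K c, (q x).2 = 0 ∧ chi K c x ≠ 0
    · right
      obtain ⟨x, hx, hx'⟩ := h
      have h1 := sup_span_rad_proj_eq_top (U := LinearMap.ker ((LinearMap.snd _ _ _).comp q)) hx' hx
      refine ⟨fun z z' => ?_⟩
      have h2 : ∀ z : Z, z = 0 := fun z => by
        obtain ⟨y, hy⟩ := hq (0, z)
        have h3 : y ∈ LinearMap.ker ((LinearMap.snd _ _ _).comp q) := h1 ▸ Submodule.mem_top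
        have h4 : (q y).2 = 0 := h3
        rwa [hy] at h4
      rw [h2 z, h2 z']
    · left
      push Not at h
      have h1 : rad K V Y = ⊤ := eq_top_iff.2 fun y _ => by
        obtain ⟨x, hx⟩ := hq (y, 0)
        have h2 := map_mem_rad ((LinearMap.fst (AlgOp K V) Y Z).comp q)
          (mem_rad_proj (h x (by rw [hx])))
        rw [LinearMap.comp_apply, hx] at h2
        exact h2
      have h2 : (⊥ : Submodule (AlgOp K V) Y) = ⊤ := eq_top_of_sup_rad (by rw [h1, bot_sup_eq])
      exact (Submodule.subsingleton_iff (AlgOp K V)).1 (subsingleton_of_bot_eq_top h2)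

/-- The embedding of `S_j` into `e_i A` given by an arrow `i ⟶ j`. -/
noncomputable def arrowEmbedding {i j : V} (a : i ⟶ j) :
    Simp K V j →ₗ[AlgOp K V] Proj K i where
  toFun t := ⟨(show K from t) • oa K a, by rw [mem_proj, smul_mul_assoc, oa_mul_oe]⟩
  map_add' x y := Subtype.ext (add_smul (show K from x) (show K from y) (oa K a))
  map_smul' r x := Subtype.ext <| by
    change (chi K j r * (show K from x)) • oa K a = r * ((show K from x) • oa K a)
    rw [mul_smul_comm, mul_oa, smul_smul, mul_comm]

theorem arrowEmbedding_injective {i j : V} (a : i ⟶ j) :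
    Function.Injective (arrowEmbedding (K := K) a) := by
  rw [injective_iff_map_eq_zero]
  intro t ht
  exact smul_oa_eq_zero a (c := (show K from t)) (congrArg Subtype.val ht)

theorem range_arrowEmbedding_le {i j : V} (a : i ⟶ j) :
    LinearMap.range (arrowEmbedding (K := K) a) ≤ rad K V (Proj K i) := by
  rintro _ ⟨t, rfl⟩
  refine mem_rad_proj ?_
  change chi K i ((show K from t) • oa K a) = 0
  rw [map_smul, chi_oa, smul_zero]

/-- M is not assumed semisimple: an element of the socle outside the radical acts as a simple
summand would. -/
theorem supp_of_isSyzygy_of_mem_soc {M N : ModuleCat.{u} (AlgOp K V)}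
    (h : IsSyzygy (AlgOp K V) M N) {x : M} {v w : V} (hx : x ∈ soc K V M)
    (hv : oe K v • x ∉ rad K V M) (a : v ⟶ w) : Supp K V N w := by
  obtain ⟨P, f, hP, hf, -, ⟨e⟩⟩ := exists_cover_of_isSyzygy h
  rw [← supp_iff_of_equiv e]
  obtain ⟨y, rfl⟩ := hf x
  refine ⟨⟨oa K a • y, by rw [LinearMap.mem_ker, map_smul, hx]⟩, fun h0 => hv ?_⟩
  have h1 : oe K w • oa K a • y = 0 := congrArg Subtype.val h0
  rw [smul_smul, oe_mul_oa] at h1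
  rw [← map_smul]
  exact map_mem_rad f (oe_smul_mem_rad_of_projective a h1)

/-- The loop keeps c in the support of every syzygy, and the arrow then supplies s at each step,
whatever X is. -/
theorem supp_isNthSyzygy_simp_prod {X N : ModuleCat.{u} (AlgOp K V)} {c s : V} (l : c ⟶ c)
    (a : c ⟶ s) {m : ℕ}
    (h : IsNthSyzygy (AlgOp K V) (m + 1) (ModuleCat.of (AlgOp K V) (Simp K V c × X)) N) :
    Supp K V N c ∧ Supp K V N s := by
  induction m generalizing N with
  | zero =>
    obtain ⟨L, ⟨e⟩, h⟩ := h
    let e' : (Simp K V c × X) ≃ₗ[AlgOp K V] L := e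
    obtain ⟨t, ht⟩ := exists_ne (0 : Simp K V c)
    have hx : e' (t, 0) ∈ soc K V L := fun i j b => by
      rw [← map_smul, Prod.smul_mk, arrowsVanish_simp, smul_zero]
      exact map_zero e'
    have hv : oe K c • e' (t, 0) ∉ rad K V L := fun hr => ht (by
      have := chi_eq_zero_of_mem_rad ((LinearMap.fst _ _ _).comp e'.symm.toLinearMap) hr
      rw [← map_smul] at this
      change (e'.symm (e' (oe K c • (t, 0)))).1 = 0 at this
      rw [LinearEquiv.symm_apply_apply, Prod.smul_mk, smul_simp, chi_oe_self, one_smul] at this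
      exact this)
    exact ⟨supp_of_isSyzygy_of_mem_soc h hx hv l, supp_of_isSyzygy_of_mem_soc h hx hv a⟩
  | succ m ih =>
    obtain ⟨L, hL, h⟩ := h
    have hLv : ArrowsVanish K V L := by
      obtain ⟨L', _, h⟩ := hL
      exact arrowsVanish_of_isSyzygy h
    have hc := (ih hL).1
    exact ⟨(supp_of_isSyzygy h hLv c).2 ⟨c, ⟨l⟩, hc⟩, (supp_of_isSyzygy h hLv s).2 ⟨c, ⟨a⟩, hc⟩⟩

open Classical in
theorem combCls_single (v : NonSink V) : combCls K (Pi.single v 1) = simpCls K v.1 := by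
  rw [combCls_apply, Finset.sum_eq_single v]
  · rw [Pi.single_eq_same, one_smul]
  · intro w _ hw
    rw [Pi.single_eq_of_ne hw, zero_smul]
  · simp

end ArrowQuotient

variable [∀ i j : V, Finite (i ⟶ j)]

/-! ### The upper bound and its equality case -/

section UpperBound

/-- Either some vertex is endless and T is not nilpotent, or there is a sink. Each alternative saves
one, which pays for the initial step to the simples; `phi_lt_card` has both savings. -/
theorem phi_le_card [Nonempty V] (M : FGModuleCat.{u} (AlgOp K V)) :
    phi (AlgOp K V) M ≤ Fintype.card V := by
  have hpos : 0 < Fintype.card V := Fintype.card_pos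
  obtain ⟨b, hb⟩ : ∃ b, Fintype.card V = b + 1 := ⟨Fintype.card V - 1, by omega⟩
  rw [hb]
  refine phi_le ?_ M
  by_cases h : ∃ v : V, Endless v
  · exact Or.inr ⟨h, hb ▸ card_nonSink_le⟩
  · push Not at h
    have := card_nonSink_lt (h (Classical.arbitrary V))
    exact Or.inl (by omega)

theorem phi_lt_card {v c : V} (hv : ¬ Endless v) (hc : Endless c)
    (M : FGModuleCat.{u} (AlgOp K V)) : phi (AlgOp K V) M < Fintype.card V := by
  have h1 := card_nonSink_lt hv
  have h2 : 1 < Fintype.card V :=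
    Fintype.one_lt_card_iff.2 ⟨v, c, fun h => hv (h ▸ hc)⟩
  have h3 := phi_le (b := Fintype.card V - 2) (Or.inr ⟨⟨c, hc⟩, by omega⟩) M
  omega

/-- One syzygy makes X semisimple, and walks bound the remaining dimension by n − 1. This serves the
case φ = 0, where summands of M itself are measured. -/
theorem le_card_of_projectiveDimension_eq {k : ℕ} (X : ModuleCat.{u} (AlgOp K V)) [Nonempty V]
    (hfin : Module.Finite (AlgOp K V) X)
    (hk : projectiveDimension X = ((k : ℕ∞) : WithBot ℕ∞)) : k ≤ Fintype.card V := by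
  have hpos : 0 < Fintype.card V := Fintype.card_pos
  obtain _ | _ | k := k
  · omega
  · omega
  obtain ⟨P, f, hP, hPf, hf, hker⟩ := exists_cover X hfin
  have hv := arrowsVanish_of_le_soc (hker.trans rad_le_soc)
  have h1 := (projectiveDimension_le_iff X (k + 2)).1 hk.le
  have h2 : ¬ HasProjectiveDimensionLE X (k + 1) := (projectiveDimension_ge_iff X (k + 2)).1 hk.ge
  rw [hasProjectiveDimensionLE_succ_iff hP f hf,
    hasProjectiveDimensionLE_iff _ _ inferInstance hv] at h1 h2
  push Not at h2
  obtain ⟨v, w, hvs, hw⟩ := h2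
  have := hw.lt_card (not_endless_of_forall_not_walk fun x => h1 v x hvs)
  omega

theorem phi_add_le (hn : 3 < Fintype.card V) (M : FGModuleCat.{u} (AlgOp K V))
    {N X : ModuleCat.{u} (AlgOp K V)} {k : ℕ}
    (hN : IsNthSyzygy (AlgOp K V) (phi (AlgOp K V) M) M.obj N) (hX : IsSummand (AlgOp K V) X N)
    (hk : projectiveDimension X = ((k : ℕ∞) : WithBot ℕ∞)) :
    phi (AlgOp K V) M + k ≤ 2 * Fintype.card V - 4 ∨
      phi (AlgOp K V) M + k ≤ 2 * Fintype.card V - 3 ∧ IsExtremal K V := by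
  have hne : Nonempty V := Fintype.card_pos_iff.1 (by omega)
  obtain ⟨C, ⟨e⟩⟩ := hX
  have hNfin := finite_of_isNthSyzygy hN inferInstance
  have hsurj : Function.Surjective ((LinearMap.fst (AlgOp K V) X C).comp e.toLinearMap) :=
    Prod.fst_surjective.comp e.surjective
  have hXfin : Module.Finite (AlgOp K V) X := Module.Finite.of_surjective _ hsurj
  have hphi := phi_le_card M
  rcases Nat.eq_zero_or_pos (phi (AlgOp K V) M) with h0 | hpos
  · have := le_card_of_projectiveDimension_eq X hXfin hk
    omega
  obtain ⟨l, hl⟩ : ∃ l, phi (AlgOp K V) M = l + 1 := ⟨_, (Nat.succ_pred_eq_of_pos hpos).symm⟩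
  rw [hl] at hN hphi ⊢
  have hNv : ArrowsVanish K V N := by
    obtain ⟨L, _, h⟩ := hN
    exact arrowsVanish_of_isSyzygy h
  obtain ⟨v, w, hv, hw, hw'⟩ := exists_walk_of_projectiveDimension_eq X hXfin
    (hNv.of_surjective _ hsurj) hk
  have hvE : ¬ Endless v := not_endless_of_forall_not_walk hw'
  obtain ⟨x, hx⟩ := exists_walk_of_isNthSyzygy hN (hv.of_surjective _ hsurj)
  by_cases hc : ∃ c : V, Endless c
  · obtain ⟨c, hc⟩ := hc
    have h1 := phi_lt_card hvE hc M
    have h2 := hw.succ_lt_card hvE hc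
    rw [or_iff_not_imp_left]
    intro h3
    refine ⟨by omega, ?_⟩
    -- Exceeding 2n − 4 leaves only k = n − 2 and φ = n − 1. As n > 3, the walk of length l = φ − 1
    -- ending at v is nontrivial, and its last arrow is the arrow into v required by
    -- `isExtremal_of_walk`.
    obtain rfl : k = Fintype.card V - 2 := by omega
    obtain ⟨l, rfl⟩ : ∃ m, l = m + 1 := ⟨l - 1, by omega⟩
    obtain ⟨y, -, ha⟩ := hx
    exact isExtremal_of_walk K hn hc hvE hw ha
  · push Not at hc
    -- The concatenated walk has length φ − 1 + k < n, and n ≤ 2n − 4.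
    have := (hx.trans hw).lt_card (hc x)
    omega

/-- The bound `h0` is needed separately because the supremum may be taken over the empty set. -/
theorem psi_le {b : ℕ} (M : FGModuleCat.{u} (AlgOp K V)) (h0 : phi (AlgOp K V) M ≤ b)
    (h : ∀ (N X : ModuleCat.{u} (AlgOp K V)) (k : ℕ),
      IsNthSyzygy (AlgOp K V) (phi (AlgOp K V) M) M.obj N → IsSummand (AlgOp K V) X N →
      projectiveDimension X = ((k : ℕ∞) : WithBot ℕ∞) → phi (AlgOp K V) M + k ≤ b) :
    psi (AlgOp K V) M ≤ b := by
  have h1 : sSup {d : ℕ∞ | ∃ N X : ModuleCat.{u} (AlgOp K V), ∃ k : ℕ,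
      IsNthSyzygy (AlgOp K V) (phi (AlgOp K V) M) M.obj N ∧ IsSummand (AlgOp K V) X N ∧
      projectiveDimension X = ((k : ℕ∞) : WithBot ℕ∞) ∧ d = (k : ℕ∞)} ≤
      ((b - phi (AlgOp K V) M : ℕ) : ℕ∞) := by
    refine sSup_le ?_
    rintro _ ⟨N, X, k, hN, hX, hk, rfl⟩
    have := h N X k hN hX hk
    exact_mod_cast (by omega : k ≤ b - phi (AlgOp K V) M)
  refine (add_le_add_right h1 _).trans ?_
  rw [← Nat.cast_add]
  exact_mod_cast (by omega : phi (AlgOp K V) M + (b - phi (AlgOp K V) M) ≤ b)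

variable (K V) in
theorem psiDim_le (hn : 3 < Fintype.card V) :
    psiDim (AlgOp K V) ≤ ((2 * Fintype.card V - 3 : ℕ) : ℕ∞) := by
  have hne : Nonempty V := Fintype.card_pos_iff.1 (by omega)
  refine iSup_le fun M => psi_le M ?_ fun N X k hN hX hk => ?_
  · have := phi_le_card M
    omega
  · rcases phi_add_le hn M hN hX hk with h | h <;> omega

theorem psiDim_le_of_not_isExtremal (hn : 3 < Fintype.card V) (hE : ¬ IsExtremal K V) :
    psiDim (AlgOp K V) ≤ ((2 * Fintype.card V - 4 : ℕ) : ℕ∞) := by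
  have hne : Nonempty V := Fintype.card_pos_iff.1 (by omega)
  refine iSup_le fun M => psi_le M ?_ fun N X k hN hX hk => ?_
  · have := phi_le_card M
    omega
  · rcases phi_add_le hn M hN hX hk with h | h
    · exact h
    · exact absurd h.2 hE

end UpperBound

/-! ### The lower bound -/

section LowerBound

/-- The quotient of `e_i A` by the submodule generated by an arrow `i ⟶ j`. -/
noncomputable abbrev arrowQuotient (K : Type u) [Field K] {V : Type u} [Quiver.{u} V] [Fintype V]
    [∀ i j : V, Finite (i ⟶ j)] {i j : V} (a : i ⟶ j) : FGModuleCat.{u} (AlgOp K V) :=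
  FGModuleCat.of (AlgOp K V) (Proj K i ⧸ LinearMap.range (arrowEmbedding (K := K) a))

/-- Puts one more step in front of the chain of S_j; the walk of length n − 2 from s alone would
give only φ ≥ n − 2. -/
theorem omegaBar_cls_arrowQuotient {i j : V} (a : i ⟶ j) :
    omegaBar (AlgOp K V) (cls (AlgOp K V) (arrowQuotient K a)) = simpCls K j := by
  let P : FGModuleCat.{u} (AlgOp K V) := FGModuleCat.of (AlgOp K V) (Proj K i)
  let U := LinearMap.range (arrowEmbedding (K := K) a)
  let f : P →ₗ[AlgOp K V] arrowQuotient K a := U.mkQ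
  rw [omegaBar_cls, omegaCls_eq (AlgOp K V) (P := P) (projective_proj i) f
    (Submodule.mkQ_surjective U)]
  exact (cls_iso (AlgOp K V) (M := FGModuleCat.of (AlgOp K V) (Simp K V j))
    (N := kerObj (AlgOp K V) f)
    ((LinearEquiv.ofInjective _ (arrowEmbedding_injective a)).trans
      (LinearEquiv.ofEq _ _ (Submodule.ker_mkQ U).symm))).symm

/-- The length is k + 1 because simples at sinks vanish in K₀: a walk of length k counts only if it
can be prolonged. -/
theorem omegaBar_iterate_simpCls_eq_zero_iff {v : V} (hv : ¬ IsSink V v) (k : ℕ) :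
    (omegaBar (AlgOp K V))^[k] (simpCls K v) = 0 ↔ ∀ w, ¬ Walk (k + 1) v w := by
  classical
  obtain ⟨t, ht, ht'⟩ := exists_transfer K (V := V)
  have h := transfer_iterate_single ht' ⟨v, hv⟩ k
  rw [← combCls_single ⟨v, hv⟩, omegaBar_iterate_combCls ht,
    map_eq_zero_iff _ (combCls_injective K)]
  constructor
  · rintro h0 w ⟨x, hx, ⟨a⟩⟩
    have := (h ⟨x, fun hs => (hs w).false a⟩).2.2 hx
    rw [h0] at this
    exact lt_irrefl _ this
  · intro h0
    ext w
    refine le_antisymm (not_lt.1 fun hpos => ?_) (h w).1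
    have h1 := (h w).2.1 hpos
    have h2 := w.2
    simp only [IsSink] at h2
    push Not at h2
    obtain ⟨x, ha⟩ := h2
    exact h0 x ⟨w.1, h1, ha⟩

theorem le_psiDim_of_isExtremal (hn : 3 < Fintype.card V) (h : IsExtremal K V) :
    ((2 * Fintype.card V - 3 : ℕ) : ℕ∞) ≤ psiDim (AlgOp K V) := by
  obtain ⟨c, s, w, ⟨l⟩, ⟨a⟩, hs, hw⟩ := h.exists_walk K hn
  have hc : Endless c := endless_of_cycle (c := 0) (walk_one ⟨l⟩)
  have hno : ∀ x, ¬ Walk (Fintype.card V - 2 + 1) s x := fun x hx => by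
    have := hx.succ_lt_card hs hc
    omega
  have hsink : ¬ IsSink V s := fun h => by
    obtain ⟨x, hx⟩ := hw.exists_prefix (m := 1) (by omega)
    obtain ⟨b⟩ := walk_one_iff.1 hx
    exact (h x).false b
  -- The class of X survives exactly n − 2 applications of Ω̄ and fixes φ; the summand S_c keeps S_s
  -- alive in Ω^φ(M).
  let X : FGModuleCat.{u} (AlgOp K V) := arrowQuotient K a
  let M : FGModuleCat.{u} (AlgOp K V) := FGModuleCat.of (AlgOp K V) (Simp K V c × X)
  have hmem : cls (AlgOp K V) X ∈ addSub (AlgOp K V) M :=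
    AddSubgroup.subset_closure ⟨X, isIndecomposable_quotient_proj _ (range_arrowEmbedding_le a),
      ⟨ModuleCat.of _ (Simp K V c), ⟨LinearEquiv.prodComm _ _ _⟩⟩, rfl⟩
  have hcard := card_nonSink_lt hs
  have hlow := le_phi (b := Fintype.card V - 1) (l := Fintype.card V - 2) (Or.inl (by omega)) M hmem
    (by
      rw [Function.iterate_succ_apply, omegaBar_cls_arrowQuotient,
        omegaBar_iterate_simpCls_eq_zero_iff hsink]
      exact hno)
    (by
      rw [show Fintype.card V - 2 = Fintype.card V - 3 + 1 by omega, Function.iterate_succ_apply,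
        omegaBar_cls_arrowQuotient, Ne, omegaBar_iterate_simpCls_eq_zero_iff hsink,
        show Fintype.card V - 3 + 1 = Fintype.card V - 2 by omega]
      exact fun h => h w hw)
  have hup := phi_lt_card hs hc M
  have hphi : phi (AlgOp K V) M = Fintype.card V - 2 + 1 := by omega
  obtain ⟨N, hN⟩ := exists_isNthSyzygy (phi (AlgOp K V) M) M.obj inferInstance
  have hN' := hN
  rw [hphi] at hN'
  have hsupp := (supp_isNthSyzygy_simp_prod (X := X.obj) l a hN').2
  have hNv : ArrowsVanish K V N := by
    obtain ⟨L, _, h⟩ := hN'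
    exact arrowsVanish_of_isSyzygy h
  obtain ⟨N', ⟨e⟩⟩ := hNv.exists_equiv_prod_simp hsupp
  refine le_trans ?_ (le_iSup (psi (AlgOp K V)) M)
  have h1 : ((Fintype.card V - 2 : ℕ) : ℕ∞) ≤ sSup {d : ℕ∞ | ∃ N X : ModuleCat.{u} (AlgOp K V),
      ∃ k : ℕ, IsNthSyzygy (AlgOp K V) (phi (AlgOp K V) M) M.obj N ∧
        IsSummand (AlgOp K V) X N ∧
        projectiveDimension X = ((k : ℕ∞) : WithBot ℕ∞) ∧ d = (k : ℕ∞)} :=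
    le_sSup ⟨N, ModuleCat.of _ (Simp K V s), Fintype.card V - 2, hN,
      ⟨ModuleCat.of _ N', ⟨e.trans (LinearEquiv.prodComm _ _ _)⟩⟩,
      projectiveDimension_simp_eq ⟨w, hw⟩ hno, rfl⟩
  refine le_trans ?_ (add_le_add_right h1 _)
  rw [← Nat.cast_add]
  exact_mod_cast (by omega : 2 * Fintype.card V - 3 ≤ phi (AlgOp K V) M + (Fintype.card V - 2))

end LowerBound

end RadSqZeroAlg

theorem theorem4p42 (K : Type u) [Field K] (V : Type u) [Quiver.{u} V] [Fintype V]
    [∀ i j : V, Finite (i ⟶ j)]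
    (hconn : Subsingleton (Quiver.WeaklyConnectedComponent V))
    (hn : 3 < Fintype.card V) :
    IgusaTodorov.psiDim (RadSqZeroAlg.AlgOp K V) ≤ ((2 * Fintype.card V - 3 : ℕ) : ℕ∞) ∧
    (IgusaTodorov.psiDim (RadSqZeroAlg.AlgOp K V) = ((2 * Fintype.card V - 3 : ℕ) : ℕ∞) ↔
      RadSqZeroAlg.MemberTotallyOrdered K V ∧
      (∃ v : V, RadSqZeroAlg.IsSink V v) ∧
      (∃ c : V, RadSqZeroAlg.heart K V = {c} ∧ Nonempty (c ⟶ c)) ∧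
      (∀ x ∈ (RadSqZeroAlg.heart K V)ᶜ, ∀ c ∈ RadSqZeroAlg.heart K V, IsEmpty (x ⟶ c)) ∧
      (∃ c ∈ RadSqZeroAlg.heart K V, ∃ s : V,
        RadSqZeroAlg.IsMemberSource K V s ∧ Nonempty (c ⟶ s))) := by
  refine ⟨RadSqZeroAlg.psiDim_le K V hn, fun h => ?_, fun h =>
    le_antisymm (RadSqZeroAlg.psiDim_le K V hn) (RadSqZeroAlg.le_psiDim_of_isExtremal hn h)⟩
  by_contra hE
  have h1 := RadSqZeroAlg.psiDim_le_of_not_isExtremal hn hE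
  rw [h] at h1
  have h2 : 2 * Fintype.card V - 3 ≤ 2 * Fintype.card V - 4 := by exact_mod_cast h1
  omega
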